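/- Let $1\le d\le 3$, let $\Omega\subset\mathbb R^d$ be a bounded domain with smooth boundary and outward unit normal $n$, let $T>0$ and $\gamma\ge 0$. Write $\langle\mu;f\rangle=\int f\,d\mu$, use $(s,v,F)\in Y:=[0,\infty)\times\mathbb R^d\times\mathbb R^d$ as dummy variables for (density, velocity, gradient of the potential), and call a vector field tangential if its normal component vanishes on $\partial\Omega$. **Strong solution.** Let $r\in C^1([0,T)\times\overline\Omega;(0,\infty))$, $U\in C^1([0,T)\times\overline\Omega;\mathbb R^d)$, $\Phi_r\in C^2([0,T)\times\overline\Omega)$ satisfy pointwise in $(0,T)\times\Omega$ $$\partial_t r+\operatorname{div}(rU)=0,\qquad \partial_t(rU)+\operatorname{div}(rU\otimes U)=-\gamma rU-r\nabla\Phi_r-rx,\qquad -\Delta\Phi_r=r-\frac1{|\Omega|}\int_\Omega r\,dx,$$ and $U\cdot n=0$, $\nabla\Phi_r\cdot n=0$ on $(0,T)\times\partial\Omega$. **Dissipative measure-valued solution.** Let $\nu=(\nu_{t,x})\in L^\infty_{\rm weak}((0,T)\times\Omega;\mathcal M^+(Y))$ be a parameterised measure, and let $m^\rho,m^{\rho|u|^2},m^{|\nabla\Phi|^2}\in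 L^\infty(0,T;\mathcal M^+(\overline\Omega))$, $m^{\rho u}\in L^\infty(0,T;\mathcal M(\overline\Omega)^d)$, $m^{\rho u\otimes u},m^{\nabla\Phi\otimes\nabla\Phi}\in L^\infty(0,T;\mathcal M(\overline\Omega)^{d\times d})$ (weakly-$*$ measurable, essentially bounded in $t$). Assume that there is a sequence of measurable maps $z^k:(0,T)\times\Omega\to Y$ that generates $\nu$ as its Young measure, i.e. $f(z^k)\to\langle\nu;f\rangle$ weakly-$*$ in $L^\infty((0,T)\times\Omega)$ for all $f\in C_0(Y)$, and whose concentration measures are the $m$'s: for each $f\in\{s,\ sv_i,\ sv_iv_j,\ s|v|^2,\ |F|^2,\ F_iF_j\}$ the sequence $f(z^k)$ is bounded in $L^1((0,T)\times\Omega)$, $\langle\nu;f\rangle\in L^1((0,T)\times\Omega)$, and $f(z^k)\,dx\,dt\to\langle\nu;f\rangle\,dx\,dt+dm^f_t(x)\,dt$ weakly-$*$ as measures, tested with all $\varphi\in C([0,T]\times\overline\Omega)$, where $m^f$ is the corresponding one of the above measures. Write $$\overline f(t)=\langle\nu_{t,x};f\rangle\,dx+m^f_t ,$$ a measure on $\overline\Omega$,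 and denote by $\overline\rho,\overline{\rho u},\overline{\rho u\otimes u},\overline{\rho|u|^2},\overline{|\nabla\Phi|^2},\overline{\nabla\Phi\otimes\nabla\Phi}$ these measures. Let initial data without concentrations be given by $$\nu_{0,x}=\delta_{(r(0,x),\,U(0,x),\,\nabla\Phi_r(0,x))}\quad\text{for a.e. }x\in\Omega,\qquad m_0^{\rho}=0,\ m_0^{\rho u}=0,\ \dots\text{ (all six vanish)},$$ define the barred quantities at time $0$ from these data in the same way, and put $M=|\Omega|^{-1}\int_\Omega\langle\nu_{0,x};s\rangle dx$. Assume that for a.e. $\tau\in(0,T)$: 1. for all $\psi\in C^1([0,T]\times\overline\Omega)$, $$\int_{\overline\Omega}\psi(\tau)\,d\overline\rho(\tau)-\int_{\overline\Omega}\psi(0)\,d\overline\rho(0)=\int_0^\tau\Big[\int_{\overline\Omega}\partial_t\psi\,d\overline\rho+\int_{\overline\Omega}\nabla\psi\cdot d\overline{\rho u}\Big]dt;$$ 2. for all $\phi\in C^1([0,T]\times\overline\Omega;\mathbb R^d)$ with $\phi\cdot n=0$ on $[0,T]\times\partial\Omega$, $$\int_{\overline\Omega}\phi(\tau)\cdot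 d\overline{\rho u}(\tau)-\int_{\overline\Omega}\phi(0)\cdot d\overline{\rho u}(0)=\int_0^\tau\Big[\int\partial_t\phi\cdot d\overline{\rho u}+\int\nabla\phi:d\overline{\rho u\otimes u}-\gamma\int\phi\cdot d\overline{\rho u}-\int x\cdot\phi\,d\overline\rho+\tfrac12\int\operatorname{div}\phi\,d\overline{|\nabla\Phi|^2}-\int\nabla\phi:d\overline{\nabla\Phi\otimes\nabla\Phi}-M\int_\Omega\langle\nu_{t,x};F\rangle\cdot\phi\,dx\Big]dt;$$ 3. for all $\vartheta\in C^1(\overline\Omega)$, $\int_\Omega\langle\nu_{\tau,x};F\rangle\cdot\nabla\vartheta\,dx=\int_{\overline\Omega}\vartheta\,d\overline\rho(\tau)-M\int_\Omega\vartheta\,dx$; 4. the energy inequality $\mathcal E(\tau)\le\mathcal E(0)-\gamma\int_0^\tau\overline{\rho|u|^2}(t)(\overline\Omega)\,dt$, where $\mathcal E=\tfrac12\overline{\rho|u|^2}(\overline\Omega)+\tfrac12\overline{|\nabla\Phi|^2}(\overline\Omega)+\tfrac12\int_{\overline\Omega}|x|^2d\overline\rho$; and that, moreover, there is $\Psi\in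 L^2(0,T;W^{1,2}(\Omega))$ with $\nabla\Psi(t,x)=\langle\nu_{t,x};F\rangle$ a.e. in $(0,T)\times\Omega$. **Conclusion.** Then: * $m^{|\nabla\Phi|^2}=0$ and $m^{\nabla\Phi\otimes\nabla\Phi}=0$. * For a.e. $t\in(0,T)$, as measures on $\overline\Omega$, $\ \overline\rho=r\,dx$, $\ \overline{\rho u}=rU\,dx$, $\ \overline{\rho u\otimes u}=rU\otimes U\,dx$, $\ \overline{\rho|u|^2}=r|U|^2\,dx$. * There is $\bar\nu\in L^\infty_{\rm weak}((0,T)\times\Omega;\mathcal M^+([0,\infty)\times\mathbb R^d))$ with $\nu_{t,x}=\bar\nu_{t,x}\otimes\delta_{\nabla\Phi_r(t,x)}$ for a.e. $(t,x)\in(0,T)\times\Omega$, and there is $\bar{\bar\nu}\in L^\infty_{\rm weak}((0,T)\times\Omega;\mathcal M^+((0,\infty)))$ such that the restriction of $\bar\nu_{t,x}$ to $(0,\infty)\times\mathbb R^d$ equals $\bar{\bar\nu}_{t,x}\otimes\delta_{U(t,x)}$ for a.e. $(t,x)\in(0,T)\times\Omega$. * $m^\rho,m^{\rho u},m^{\rho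 u\otimes u},m^{\rho|u|^2}$ are absolutely continuous with respect to Lebesgue measure (namely, $m^\rho_t$, $m^{\rho u}_t$, $m^{\rho u\otimes u}_t$ and $m^{\rho|u|^2}_t$ are, for a.e. $t$). -/

import Mathlib

open Set Filter Topology MeasureTheory
open scoped NNReal ENNReal ContDiff

noncomputable section

namespace EulerPoisson

/-! ### Geometry and differential operators -/

/-- Euclidean space `ℝ^d`. -/
abbrev E (d : ℕ) : Type := EuclideanSpace ℝ (Fin d)

variable {d : ℕ}

/-- `g` is a smooth defining function of `Ω`. -/
def IsDefiningFunction (g : E d → ℝ) (Ω : Set (E d)) : Prop :=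
  ContDiff ℝ ∞ g ∧ Ω = {x | g x < 0} ∧ ∀ x ∈ frontier Ω, gradient g x ≠ 0

/-- A bounded domain (open, connected, non-empty) with smooth boundary. -/
def IsBoundedSmoothDomain (Ω : Set (E d)) : Prop :=
  IsOpen Ω ∧ IsConnected Ω ∧ Bornology.IsBounded Ω ∧ ∃ g, IsDefiningFunction g Ω

/-- `n` is the outward unit normal to `∂Ω` at `x`. -/
def IsOutwardUnitNormal (Ω : Set (E d)) (x n : E d) : Prop :=
  x ∈ frontier Ω ∧ ∃ g, IsDefiningFunction g Ω ∧ n = ‖gradient g x‖⁻¹ • gradient g x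

/-- The vector field `V` is tangential on `∂Ω`, i.e. `V · n = 0` there. -/
def IsTangential (Ω : Set (E d)) (V : E d → E d) : Prop :=
  ∀ x n, IsOutwardUnitNormal Ω x n → inner ℝ (V x) n = 0

/-- The partial derivative `∂_i f` on `closure Ω` (at points of the open set `Ω` it is the usual
one, at boundary points it is the one-sided derivative from `closure Ω`). -/
def pd (Ω : Set (E d)) (i : Fin d) (f : E d → ℝ) (x : E d) : ℝ :=
  fderivWithin ℝ f (closure Ω) x (EuclideanSpace.single i 1)

/-- The gradient of `f` on `closure Ω`. -/
def grad (Ω : Set (E d)) (f : E d → ℝ) (x : E d) : E d :=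
  WithLp.toLp 2 (fun i => pd Ω i f x)

/-- The time derivative on `[0,T]` (one-sided at the end points). -/
def dt (T : ℝ) (f : ℝ × E d → ℝ) (t : ℝ) (x : E d) : ℝ :=
  derivWithin (fun s => f (s, x)) (Icc 0 T) t

/-- The space-time cylinder `(0,T) × Ω`. -/
def cyl (T : ℝ) (Ω : Set (E d)) : Set (ℝ × E d) := Ioo 0 T ×ˢ Ω

/-! ### Strong solutions -/

/-- The space average of a function over `Ω`. -/
def average (Ω : Set (E d)) (f : E d → ℝ) : ℝ := (volume.real Ω)⁻¹ * ∫ x in Ω, f x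

/-- `(r, U, Φ)` is a regular solution, with `r > 0`, of
`∂ₜ r + div (r U) = 0`, `∂ₜ (r U) + div (r U ⊗ U) = - γ r U - r ∇Φ - r x`, `- Δ Φ = r - M_r`
on `(0,T) × Ω`, with `U · n = 0` and `∇Φ · n = 0` on `(0,T) × ∂Ω`. -/
structure IsStrongSolution (T γ : ℝ) (Ω : Set (E d))
    (r : ℝ → E d → ℝ) (U : ℝ → E d → E d) (Φ : ℝ → E d → ℝ) : Prop where
  r_C1 : ContDiffOn ℝ 1 (fun p : ℝ × E d => r p.1 p.2) (Ico 0 T ×ˢ closure Ω)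
  U_C1 : ContDiffOn ℝ 1 (fun p : ℝ × E d => U p.1 p.2) (Ico 0 T ×ˢ closure Ω)
  Φ_C2 : ContDiffOn ℝ 2 (fun p : ℝ × E d => Φ p.1 p.2) (Ico 0 T ×ˢ closure Ω)
  r_pos : ∀ t ∈ Ico 0 T, ∀ x ∈ closure Ω, 0 < r t x
  continuity : ∀ t ∈ Ioo 0 T, ∀ x ∈ Ω,
    deriv (fun s => r s x) t + ∑ j, pd Ω j (fun y => r t y * U t y j) x = 0
  momentum : ∀ t ∈ Ioo 0 T, ∀ x ∈ Ω, ∀ i,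
    deriv (fun s => r s x * U s x i) t + ∑ j, pd Ω j (fun y => r t y * U t y i * U t y j) x
      = - γ * (r t x * U t x i) - r t x * pd Ω i (Φ t) x - r t x * x i
  poisson : ∀ t ∈ Ioo 0 T, ∀ x ∈ Ω,
    - ∑ j, pd Ω j (fun y => pd Ω j (Φ t) y) x = r t x - average Ω (r t)
  impermeable : ∀ t ∈ Ioo 0 T, IsTangential Ω (U t)
  neumann : ∀ t ∈ Ioo 0 T, IsTangential Ω (grad Ω (Φ t))

/-! ### Parameterised measures and concentration measures -/

/-- The phase space `[0,∞) × ℝ^d × ℝ^d` of the dummy variables `((s, v), F)`, which stand for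
the density, the velocity and the gradient of the potential. -/
abbrev Phase (d : ℕ) : Type := (ℝ≥0 × E d) × E d

/-- `ν ∈ L^∞_weak(X; M⁺(Y))`: weakly-* measurable and essentially bounded. -/
def IsParameterizedMeasure {Z Y : Type*} [MeasureSpace Z] [TopologicalSpace Y] [MeasurableSpace Y]
    (X : Set Z) (ν : Z → Measure Y) : Prop :=
  (∀ f : ZeroAtInftyContinuousMap Y ℝ,
      AEMeasurable (fun z => ∫ y, f y ∂(ν z)) (volume.restrict X)) ∧
    ∃ C : ℝ≥0, ∀ᵐ z ∂(volume.restrict X), ν z univ ≤ C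

/-- `ν` is the Young measure on `X` generated by the sequence `z`: for every `f ∈ C₀(Y)` the
functions `f (z n)` converge to `⟨ν; f⟩` weakly-* in `L^∞(X)`. -/
def IsYoungMeasureOf {Z Y : Type*} [MeasureSpace Z] [TopologicalSpace Y] [MeasurableSpace Y]
    (X : Set Z) (z : ℕ → Z → Y) (ν : Z → Measure Y) : Prop :=
  IsParameterizedMeasure X ν ∧
  (∀ n, AEMeasurable (z n) (volume.restrict X)) ∧
  ∀ f : ZeroAtInftyContinuousMap Y ℝ, ∀ φ : Z → ℝ, Integrable φ (volume.restrict X) →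
    Tendsto (fun n => ∫ p in X, φ p * f (z n p)) atTop
      (𝓝 (∫ p in X, φ p * ∫ y, f y ∂(ν p)))

/-- The integral of a function against a signed measure. -/
def sint (μ : SignedMeasure (E d)) (g : E d → ℝ) : ℝ :=
  μ.integral g (ContinuousLinearMap.lsmul ℝ ℝ)

/-- `m ∈ L^∞(0,T; M(closure Ω))`: a weakly-* measurable, essentially bounded family of signed
measures concentrated on `closure Ω`. -/
def IsLinftyMeasureFamily (T : ℝ) (Ω : Set (E d)) (m : ℝ → SignedMeasure (E d)) : Prop :=
  (∀ g : E d → ℝ, Continuous g →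
      AEMeasurable (fun t => sint (m t) g) (volume.restrict (Ioo 0 T))) ∧
  (∃ C : ℝ≥0, ∀ᵐ t ∂(volume.restrict (Ioo 0 T)), (m t).totalVariation univ ≤ C) ∧
  ∀ᵐ t ∂(volume.restrict (Ioo 0 T)), (m t).totalVariation (closure Ω)ᶜ = 0

/-- `m` (that is, the measure `dm_t(x) ⊗ dt` on `(0,T) × closure Ω`) is the concentration measure
associated to the nonlinearity `f` along the sequence `z`, whose Young measure is `ν`: the
functions `f (z n)` are bounded in `L¹`, `⟨ν; f⟩` is integrable, and `f (z n)` converges to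
`⟨ν; f⟩ + m` weakly-* in the sense of measures up to the boundary. -/
def IsConcentrationMeasure (T : ℝ) (Ω : Set (E d)) (z : ℕ → ℝ × E d → Phase d)
    (ν : ℝ × E d → Measure (Phase d)) (f : Phase d → ℝ) (m : ℝ → SignedMeasure (E d)) : Prop :=
  IsLinftyMeasureFamily T Ω m ∧
  (∃ C : ℝ, ∀ n, Integrable (fun p => f (z n p)) (volume.restrict (cyl T Ω)) ∧
    ∫ p in cyl T Ω, |f (z n p)| ≤ C) ∧
  (∀ᵐ p ∂(volume.restrict (cyl T Ω)), Integrable f (ν p)) ∧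
  Integrable (fun p => ∫ y, f y ∂(ν p)) (volume.restrict (cyl T Ω)) ∧
  ∀ φ : ℝ × E d → ℝ, Continuous φ →
    Tendsto (fun n => ∫ p in cyl T Ω, φ p * f (z n p)) atTop
      (𝓝 ((∫ p in cyl T Ω, φ p * ∫ y, f y ∂(ν p)) +
        ∫ t in Ioo 0 T, sint (m t) (fun x => φ (t, x))))

/-! ### The nonlinearities -/

/-- `s`, for `ρ`. -/
def fRho (y : Phase d) : ℝ := y.1.1
/-- `s v_i`, for `ρ u`. -/
def fMom (i : Fin d) (y : Phase d) : ℝ := y.1.1 * y.1.2 i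
/-- `s v_i v_j`, for `ρ u ⊗ u`. -/
def fConv (i j : Fin d) (y : Phase d) : ℝ := y.1.1 * (y.1.2 i * y.1.2 j)
/-- `s |v|²`, for `ρ |u|²`. -/
def fKin (y : Phase d) : ℝ := y.1.1 * ‖y.1.2‖ ^ 2
/-- `F_i`, for `∇Φ`. -/
def fGrad (i : Fin d) (y : Phase d) : ℝ := y.2 i
/-- `|F|²`, for `|∇Φ|²`. -/
def fGradSq (y : Phase d) : ℝ := ‖y.2‖ ^ 2
/-- `F_i F_j`, for `∇Φ ⊗ ∇Φ`. -/
def fGradTensor (i j : Fin d) (y : Phase d) : ℝ := y.2 i * y.2 j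

/-- A collection of concentration measures, at one time, for `ρ`, `ρ u`, `ρ u ⊗ u`, `ρ |u|²`,
`|∇Φ|²` and `∇Φ ⊗ ∇Φ`. -/
@[ext] structure Defects (d : ℕ) where
  rho : SignedMeasure (E d)
  mom : Fin d → SignedMeasure (E d)
  conv : Fin d → Fin d → SignedMeasure (E d)
  kin : SignedMeasure (E d)
  gradSq : SignedMeasure (E d)
  gradTensor : Fin d → Fin d → SignedMeasure (E d)

/-- The absence of concentrations. -/
instance : Zero (Defects d) := ⟨⟨0, 0, 0, 0, 0, 0⟩⟩

/-- `∫ g f̄`, where `f̄ = ⟨ν; f⟩ dx + m` is the sum of the oscillation and the concentration part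
(at one time). -/
def barInt (Ω : Set (E d)) (ν : E d → Measure (Phase d)) (f : Phase d → ℝ)
    (m : SignedMeasure (E d)) (g : E d → ℝ) : ℝ :=
  (∫ x in Ω, (∫ y, f y ∂(ν x)) * g x) + sint m g

/-- The signed measure `f̄ = ⟨ν; f⟩ dx + m` (at one time). -/
def barMeasure (Ω : Set (E d)) (ν : E d → Measure (Phase d)) (f : Phase d → ℝ)
    (m : SignedMeasure (E d)) : SignedMeasure (E d) :=
  (volume.restrict Ω).withDensityᵥ (fun x => ∫ y, f y ∂(ν x)) + m

/-- The signed measure `h dx` on `Ω`. -/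
def densityMeasure (Ω : Set (E d)) (h : E d → ℝ) : SignedMeasure (E d) :=
  (volume.restrict Ω).withDensityᵥ h

/-! ### Dissipative measure-valued solutions -/

/-- The mean density of the initial state, concentrations included. -/
def meanDensity (Ω : Set (E d)) (ν₀ : E d → Measure (Phase d)) (m₀ : Defects d) : ℝ :=
  (volume.real Ω)⁻¹ * barInt Ω ν₀ fRho m₀.rho (fun _ => 1)

/-- The measure-valued continuity equation. -/
def MVContinuity (T : ℝ) (Ω : Set (E d)) (ν₀ : E d → Measure (Phase d)) (m₀ : Defects d)
    (ν : ℝ × E d → Measure (Phase d)) (m : ℝ → Defects d) : Prop :=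
  ∀ᵐ τ ∂(volume.restrict (Ioo 0 T)), ∀ ψ : ℝ × E d → ℝ,
    ContDiffOn ℝ 1 ψ (Icc 0 T ×ˢ closure Ω) →
    barInt Ω (fun x => ν (τ, x)) fRho (m τ).rho (fun x => ψ (τ, x))
        - barInt Ω ν₀ fRho m₀.rho (fun x => ψ (0, x))
      = ∫ t in (0 : ℝ)..τ,
          (barInt Ω (fun x => ν (t, x)) fRho (m t).rho (fun x => dt T ψ t x)
            + ∑ i, barInt Ω (fun x => ν (t, x)) (fMom i) ((m t).mom i)
                (fun x => pd Ω i (fun y => ψ (t, y)) x))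

/-- The measure-valued momentum equation, with `C¹` test fields that are tangential on `∂Ω`. -/
def MVMomentum (T γ : ℝ) (Ω : Set (E d)) (ν₀ : E d → Measure (Phase d)) (m₀ : Defects d)
    (ν : ℝ × E d → Measure (Phase d)) (m : ℝ → Defects d) : Prop :=
  ∀ᵐ τ ∂(volume.restrict (Ioo 0 T)), ∀ φ : ℝ × E d → E d,
    ContDiffOn ℝ 1 φ (Icc 0 T ×ˢ closure Ω) →
    (∀ t ∈ Icc 0 T, IsTangential Ω (fun x => φ (t, x))) →
    (∑ i, barInt Ω (fun x => ν (τ, x)) (fMom i) ((m τ).mom i) (fun x => φ (τ, x) i))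
        - ∑ i, barInt Ω ν₀ (fMom i) (m₀.mom i) (fun x => φ (0, x) i)
      = ∫ t in (0 : ℝ)..τ,
          ((∑ i, barInt Ω (fun x => ν (t, x)) (fMom i) ((m t).mom i)
              (fun x => dt T (fun p => φ p i) t x))
            + (∑ i, ∑ j, barInt Ω (fun x => ν (t, x)) (fConv i j) ((m t).conv i j)
                (fun x => pd Ω j (fun y => φ (t, y) i) x))
            - γ * (∑ i, barInt Ω (fun x => ν (t, x)) (fMom i) ((m t).mom i)
                (fun x => φ (t, x) i))
            - barInt Ω (fun x => ν (t, x)) fRho (m t).rho (fun x => inner ℝ x (φ (t, x)))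
            + (1 / 2) * barInt Ω (fun x => ν (t, x)) fGradSq (m t).gradSq
                (fun x => ∑ i, pd Ω i (fun y => φ (t, y) i) x)
            - (∑ i, ∑ j, barInt Ω (fun x => ν (t, x)) (fGradTensor i j) ((m t).gradTensor i j)
                (fun x => pd Ω j (fun y => φ (t, y) i) x))
            - meanDensity Ω ν₀ m₀ *
                ∑ i, ∫ x in Ω, (∫ y, fGrad i y ∂(ν (t, x))) * φ (t, x) i)

/-- The measure-valued Poisson equation. -/
def MVPoisson (T : ℝ) (Ω : Set (E d)) (ν₀ : E d → Measure (Phase d)) (m₀ : Defects d)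
    (ν : ℝ × E d → Measure (Phase d)) (m : ℝ → Defects d) : Prop :=
  ∀ᵐ τ ∂(volume.restrict (Ioo 0 T)), ∀ θ : E d → ℝ, ContDiffOn ℝ 1 θ (closure Ω) →
    (∑ i, ∫ x in Ω, (∫ y, fGrad i y ∂(ν (τ, x))) * pd Ω i θ x)
      = barInt Ω (fun x => ν (τ, x)) fRho (m τ).rho θ - meanDensity Ω ν₀ m₀ * ∫ x in Ω, θ x

/-- There is `Ψ ∈ L²(0,T; W^{1,2}(Ω))` with (weak) gradient `∇Ψ = ⟨ν; F⟩` almost everywhere. -/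
def HasPotential (T : ℝ) (Ω : Set (E d)) (ν : ℝ × E d → Measure (Phase d)) : Prop :=
  ∃ Ψ : ℝ × E d → ℝ, MemLp Ψ 2 (volume.restrict (cyl T Ω)) ∧
    (∀ i, MemLp (fun p => ∫ y, fGrad i y ∂(ν p)) 2 (volume.restrict (cyl T Ω))) ∧
    ∀ᵐ t ∂(volume.restrict (Ioo 0 T)), ∀ η : E d → ℝ,
      ContDiff ℝ ∞ η → HasCompactSupport η → tsupport η ⊆ Ω →
      ∀ i, ∫ x in Ω, Ψ (t, x) * pd Ω i η x = - ∫ x in Ω, (∫ y, fGrad i y ∂(ν (t, x))) * η x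

/-- The total energy (at one time) of a measure-valued state. -/
def mvEnergy (Ω : Set (E d)) (ν : E d → Measure (Phase d)) (m : Defects d) : ℝ :=
  (1 / 2) * barInt Ω ν fKin m.kin (fun _ => 1)
    + (1 / 2) * barInt Ω ν fGradSq m.gradSq (fun _ => 1)
    + barInt Ω ν fRho m.rho (fun x => (1 / 2) * ‖x‖ ^ 2)

/-- The energy inequality. -/
def MVEnergyInequality (T γ : ℝ) (Ω : Set (E d)) (ν₀ : E d → Measure (Phase d)) (m₀ : Defects d)
    (ν : ℝ × E d → Measure (Phase d)) (m : ℝ → Defects d) : Prop :=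
  ∀ᵐ τ ∂(volume.restrict (Ioo 0 T)),
    mvEnergy Ω (fun x => ν (τ, x)) (m τ) ≤ mvEnergy Ω ν₀ m₀
      - γ * ∫ t in (0 : ℝ)..τ, barInt Ω (fun x => ν (t, x)) fKin (m t).kin (fun _ => 1)

/-- `(ν, m)` consists of a Young measure on `(0,T) × Ω` and of the concentration measures of the
nonlinearities of the system, all generated by one sequence of measurable functions. -/
def IsGenerated (T : ℝ) (Ω : Set (E d)) (ν : ℝ × E d → Measure (Phase d))
    (m : ℝ → Defects d) : Prop :=
  ∃ z : ℕ → ℝ × E d → Phase d,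
    IsYoungMeasureOf (cyl T Ω) z ν ∧
    IsConcentrationMeasure T Ω z ν fRho (fun t => (m t).rho) ∧
    (∀ i, IsConcentrationMeasure T Ω z ν (fMom i) (fun t => (m t).mom i)) ∧
    (∀ i j, IsConcentrationMeasure T Ω z ν (fConv i j) (fun t => (m t).conv i j)) ∧
    IsConcentrationMeasure T Ω z ν fKin (fun t => (m t).kin) ∧
    IsConcentrationMeasure T Ω z ν fGradSq (fun t => (m t).gradSq) ∧
    (∀ i j, IsConcentrationMeasure T Ω z ν (fGradTensor i j) (fun t => (m t).gradTensor i j))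

/-- Dissipative measure-valued solution on `(0,T) × Ω` with initial data `(ν₀, m₀)`. -/
structure IsDissipativeMVSolution (T γ : ℝ) (Ω : Set (E d)) (ν₀ : E d → Measure (Phase d))
    (m₀ : Defects d) (ν : ℝ × E d → Measure (Phase d)) (m : ℝ → Defects d) : Prop where
  generated : IsGenerated T Ω ν m
  nonneg : ∀ᵐ t ∂(volume.restrict (Ioo 0 T)),
    0 ≤ (m t).rho ∧ 0 ≤ (m t).kin ∧ 0 ≤ (m t).gradSq
  continuity : MVContinuity T Ω ν₀ m₀ ν m
  momentum : MVMomentum T γ Ω ν₀ m₀ ν m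
  poisson : MVPoisson T Ω ν₀ m₀ ν m
  potential : HasPotential T Ω ν
  energy : MVEnergyInequality T γ Ω ν₀ m₀ ν m

end EulerPoisson

end

/-!
The proof is the relative energy method. For a measure-valued state at time `t`, let `kinRel` be
twice the kinetic relative energy `½ ∫ s |v - U|²` and let `gradRel` be twice the relative energy
`½ ∫ |F - ∇Φ|²` of the field, concentrations included. Both are nonnegative, their sum vanishes at
time zero, and a Gronwall argument shows that it vanishes for almost every time
(`IsDissipativeMVSolution.ae_relEnergy_eq_zero`).

*The inequality.* Expanding the squares, the relative energy is the energy plus terms that are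
linear in the conserved quantities (`IsStrongSolution.relEnergy_eq`). The momentum equation is
tested with `U`, the continuity equation with `½|U|² - ½|x|² - Φ`, and together with the energy
inequality this bounds the relative energy by the time integral of a rate
(`GeneratedBy.relEnergy_le`). The strong solution is only defined on `[0, T)`, whereas test
functions live on `[0, T]`, so the test fields are composed with a change of time (`IsTimeCutoff`).
The rate is split by adding and subtracting the density tested with the material derivative
`∂ₜΦ + U · ∇Φ`.

*The kinetic rate.* By the velocity equation its integrand is pointwise quadratic in `v - U` and is
bounded by a multiple of `s |v - U|²` (`kinetic_identity`, `GeneratedBy.kinRate_le`). Pointwise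
inequalities for nonlinearities hold along the generating sequence, and hence for the limits, by
`HasLimit.total_nonneg`.

*The field rate.* Here the mean field `f = ⟨ν; F⟩` enters without a concentration, so oscillation
and concentration have to be estimated separately. The concentration of a nonnegative nonlinearity
is nonnegative, because its truncations do not concentrate (`HasLimit.defect_nonneg`). In the
oscillation part one expands around `∇Φ`; a Young measure of mass less than one contributes the
missing mass times a nonnegative quantity (`integral_quadratic_form`). What has to vanish is the
part linear in `f`. The Poisson equation turns the density term into a field term, and the linear
part becomes the integral of `f` against the field `elField`, which is `r U - ∂ₜ∇Φ` plus the
divergence of the antisymmetric matrix `U ⊗ ∇Φ - ∇Φ ⊗ U`. It is divergence-free and tangential, and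
`f` is a weak gradient, so the integral is zero (`IsStrongSolution.integral_mul_elField`). The
integration by parts behind this (`HasWeakGradient.integral_mul_tangential`) uses no trace theory:
the tangential field is cut off near the boundary by functions of a defining function `g`, and the
normal component of the field is `O(|g|)` by `IsDefiningFunction.exists_abs_le_mul`.

*Conclusions.* If `gradRel` vanishes, then `F = ∇Φ` almost surely, no mass is lost where `∇Φ ≠ 0`,
and `|F|²` does not concentrate (`GeneratedBy.ae_field`); nonlinearities dominated by `|F|²` do not
concentrate either (`GeneratedBy.ae_concentration_eq_zero`). The Poisson equations for the two
solutions then have the same left-hand sides, which gives `ρ̄ = r dx`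
(`GeneratedBy.ae_barMeasure_rho_eq`). If `kinRel` vanishes, then `v = U` almost surely where `s > 0`
(`GeneratedBy.ae_velocity`), and each kinetic nonlinearity `f`, with `f = a s` on `v = U`, satisfies
`|f - a s| ≤ ε s + C s |v - U|²` for every `ε > 0`, whence `f̄ = a ρ̄` (`GeneratedBy.ae_barInt_eq`,
`GeneratedBy.ae_barMeasure_kinetic_eq`). For this step it is enough to compare countably many
trigonometric integrals (`signedMeasure_ext_of_wave`), so that the exceptional sets of times remain
null. A concentration measure whose sum with a density is a density is absolutely continuous.
-/

noncomputable section

namespace EulerPoisson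

variable {d : ℕ}

/-! ### Geometry of the domain -/

/-- The standard basis vector of `ℝ^d`. -/
abbrev bv (i : Fin d) : E d := EuclideanSpace.single i 1

lemma fderiv_apply_eq_inner_gradient (g : E d → ℝ) (x v : E d) :
    fderiv ℝ g x v = inner ℝ (gradient g x) v := by
  rw [gradient, InnerProductSpace.toDual_symm_apply]

lemma IsDefiningFunction.eq_zero_of_mem_frontier {g : E d → ℝ} {Ω : Set (E d)}
    (hg : IsDefiningFunction g Ω) {x : E d} (hx : x ∈ frontier Ω) : g x = 0 := by
  obtain ⟨hs, hΩ, -⟩ := hg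
  have := frontier_lt_subset_eq (f := g) (g := fun _ => (0:ℝ)) hs.continuous continuous_const
  exact this (by rwa [hΩ] at hx)

lemma IsDefiningFunction.mem_iff {g : E d → ℝ} {Ω : Set (E d)}
    (hg : IsDefiningFunction g Ω) {x : E d} : x ∈ Ω ↔ g x < 0 := by
  conv_lhs => rw [hg.2.1]
  rfl

lemma IsDefiningFunction.isOpen {g : E d → ℝ} {Ω : Set (E d)}
    (hg : IsDefiningFunction g Ω) : IsOpen Ω := by
  rw [hg.2.1]; exact isOpen_lt hg.1.continuous continuous_const

/-- At a boundary point the domain contains the tip of an open cone around the inner normal, hence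
its closure has unique derivatives. -/
lemma IsDefiningFunction.uniqueDiffOn_closure {g : E d → ℝ} {Ω : Set (E d)}
    (hg : IsDefiningFunction g Ω) : UniqueDiffOn ℝ (closure Ω) := by
  intro x₀ hx₀
  by_cases hx : x₀ ∈ Ω
  · exact (hg.isOpen.uniqueDiffWithinAt hx).mono subset_closure
  have hfr : x₀ ∈ frontier Ω := by rw [hg.isOpen.frontier_eq]; exact ⟨hx₀, hx⟩
  have h0 := hg.eq_zero_of_mem_frontier hfr
  have he := hg.2.2 x₀ hfr
  set e := gradient g x₀ with hedef
  have hpos : 0 < ‖e‖ := norm_pos_iff.2 he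
  have hd : HasFDerivAt g (fderiv ℝ g x₀) x₀ :=
    (hg.1.differentiable (by simp)).differentiableAt.hasFDerivAt
  have hev := (hasFDerivAt_iff_isLittleO.1 hd).bound (c := ‖e‖ / 4) (by positivity)
  obtain ⟨δ, hδ, hball⟩ := Metric.eventually_nhds_iff_ball.1 hev
  let S : Set (E d) := {x | inner ℝ e (x - x₀) + ‖e‖ / 2 * ‖x - x₀‖ < 0} ∩ Metric.ball x₀ δ
  have hSΩ : S ⊆ Ω := by
    rintro x ⟨h1, h2⟩
    have := hball x h2
    rw [fderiv_apply_eq_inner_gradient, h0, Real.norm_eq_abs] at this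
    have h3 := (abs_le.1 this).2
    simp only [mem_ofPred_eq] at h1
    have : 0 ≤ ‖e‖ * ‖x - x₀‖ := by positivity
    rw [hg.mem_iff]
    linarith
  have hSo : IsOpen S := by
    refine IsOpen.inter (isOpen_lt (by fun_prop) continuous_const) Metric.isOpen_ball
  have hSc : Convex ℝ S := by
    refine Convex.inter ?_ (convex_ball _ _)
    have : ConvexOn ℝ univ (fun x : E d => inner ℝ e (x - x₀) + ‖e‖ / 2 * ‖x - x₀‖) := by
      refine ConvexOn.add ?_ ?_
      · have h1 : ConvexOn ℝ univ (fun x : E d => (innerSL ℝ e) x + (-inner ℝ e x₀)) :=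
          ((innerSL ℝ e).toLinearMap.convexOn convex_univ).add_const _
        refine h1.congr fun x _ => ?_
        simp [inner_sub_right]; ring
      · refine ConvexOn.smul (c := ‖e‖ / 2) (by positivity) ?_
        have := (convexOn_univ_norm (E := E d)).translate_left (-x₀)
        simpa [Function.comp_def, sub_eq_add_neg] using this
    simpa using this.convex_lt 0
  have htend : Tendsto (fun s : ℝ => x₀ - s • e) (𝓝[>] 0) (𝓝 x₀) := by
    have : Tendsto (fun s : ℝ => x₀ - s • e) (𝓝 0) (𝓝 (x₀ - (0:ℝ) • e)) :=
      (Continuous.tendsto (by fun_prop) 0)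
    simp only [zero_smul, sub_zero] at this
    exact this.mono_left nhdsWithin_le_nhds
  have hmem : ∀ᶠ s : ℝ in 𝓝[>] 0, x₀ - s • e ∈ S := by
    filter_upwards [htend (Metric.ball_mem_nhds x₀ hδ), self_mem_nhdsWithin] with s hs hs0
    refine ⟨?_, hs⟩
    have hs0 : 0 < s := hs0
    have : 0 < s * ‖e‖ ^ 2 := by positivity
    simp only [mem_ofPred_eq, sub_sub_cancel_left, inner_neg_right, inner_smul_right, norm_neg,
      norm_smul, Real.norm_eq_abs, abs_of_pos hs0, real_inner_self_eq_norm_sq]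
    nlinarith
  have hne : (interior S).Nonempty := by
    rw [hSo.interior_eq]
    obtain ⟨s, hs⟩ := hmem.exists
    exact ⟨_, hs⟩
  exact (uniqueDiffWithinAt_convex hSc hne (mem_closure_of_tendsto htend hmem)).mono
    (hSΩ.trans subset_closure)

/-- A `C¹` function on the closure of a smooth bounded domain that vanishes on the boundary is
dominated by the defining function: follow the straight line in the direction of the outer normal
until it leaves the domain. -/
lemma IsDefiningFunction.exists_abs_le_mul {g : E d → ℝ} {Ω : Set (E d)}
    (hg : IsDefiningFunction g Ω) (hb : Bornology.IsBounded Ω) {w : E d → ℝ}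
    (hw : ContDiffOn ℝ 1 w (closure Ω)) (hw0 : ∀ x ∈ frontier Ω, w x = 0) :
    ∃ C : ℝ, ∀ x ∈ Ω, |w x| ≤ C * |g x| := by
  have hK : IsCompact (closure Ω) := hb.isCompact_closure
  have hgc := hg.1.continuous
  have hu := hg.uniqueDiffOn_closure
  obtain ⟨L, hL⟩ : ∃ L : ℝ, ∀ x ∈ closure Ω, ‖fderivWithin ℝ w (closure Ω) x‖ ≤ L :=
    hK.exists_bound_of_continuousOn (hw.continuousOn_fderivWithin hu le_rfl)
  suffices h : ∃ C : ℝ, ∀ x ∈ closure Ω, x ∈ Ω → |w x| ≤ C * |g x| by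
    obtain ⟨C, hC⟩ := h
    exact ⟨C, fun x hx => hC x (subset_closure hx) hx⟩
  refine hK.induction_on (p := fun s => ∃ C : ℝ, ∀ x ∈ s, x ∈ Ω → |w x| ≤ C * |g x|)
    ⟨0, by simp⟩ ?_ ?_ ?_
  · rintro s t hst ⟨C, hC⟩
    exact ⟨C, fun x hx => hC x (hst hx)⟩
  · rintro s t ⟨C, hC⟩ ⟨C', hC'⟩
    refine ⟨max C C', ?_⟩
    rintro x (hx | hx) hxΩ
    · exact (hC x hx hxΩ).trans (by gcongr; exact le_max_left _ _)
    · exact (hC' x hx hxΩ).trans (by gcongr; exact le_max_right _ _)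
  intro x₀ hx₀
  by_cases hx : x₀ ∈ Ω
  · -- near an interior point `g` is bounded away from zero and `w` is bounded
    have hg0 : g x₀ < 0 := hg.mem_iff.1 hx
    have hwc : ContinuousAt w x₀ :=
      (hw.continuousOn.mono subset_closure).continuousAt (hg.isOpen.mem_nhds hx)
    have h1 : ∀ᶠ x in 𝓝 x₀, |w x| < |w x₀| + 1 :=
      (hwc.abs).eventually_lt continuousAt_const (by linarith)
    have h2 : ∀ᶠ x in 𝓝 x₀, |g x₀| / 2 < |g x| := by
      have : 0 < |g x₀| := abs_pos.2 hg0.ne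
      exact continuousAt_const.eventually_lt hgc.continuousAt.abs (by linarith)
    refine ⟨_, mem_nhdsWithin_of_mem_nhds (h1.and h2), (|w x₀| + 1) * (2 / |g x₀|), ?_⟩
    rintro x ⟨hx1, hx2⟩ -
    have hp : 0 < |g x₀| := abs_pos.2 hg0.ne
    have h3 : (1:ℝ) ≤ 2 / |g x₀| * |g x| := by
      rw [div_mul_eq_mul_div, le_div_iff₀ hp]; linarith
    calc |w x| ≤ (|w x₀| + 1) * 1 := by linarith
      _ ≤ (|w x₀| + 1) * (2 / |g x₀| * |g x|) := by gcongr
      _ = _ := by ring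
  -- near a boundary point `g` grows at rate at least `‖e‖² / 2` in the direction of its gradient `e`
  -- at that point, so the line `x + s e` has left the domain at time `s₁ = 2 |g x| / ‖e‖²`
  have hfr : x₀ ∈ frontier Ω := by rw [hg.isOpen.frontier_eq]; exact ⟨hx₀, hx⟩
  have h0 := hg.eq_zero_of_mem_frontier hfr
  have he := hg.2.2 x₀ hfr
  set e := gradient g x₀ with hedef
  have hpos : 0 < ‖e‖ := norm_pos_iff.2 he
  have hder : ∀ x, HasFDerivAt g (fderiv ℝ g x) x := fun x =>
    (hg.1.differentiable (by simp)).differentiableAt.hasFDerivAt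
  have hcd : Continuous fun x => fderiv ℝ g x e :=
    (hg.1.continuous_fderiv (by simp)).clm_apply continuous_const
  have hgt : ∀ᶠ x in 𝓝 x₀, ‖e‖ ^ 2 / 2 < fderiv ℝ g x e := by
    refine continuousAt_const.eventually_lt hcd.continuousAt ?_
    rw [fderiv_apply_eq_inner_gradient, ← hedef, real_inner_self_eq_norm_sq]
    have : 0 < ‖e‖ ^ 2 := by positivity
    linarith
  obtain ⟨ρ, hρ, hball⟩ := Metric.eventually_nhds_iff_ball.1 hgt
  have hgsmall : ∀ᶠ x in 𝓝 x₀, 2 * |g x| / ‖e‖ < ρ / 2 := by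
    refine ContinuousAt.eventually_lt (by fun_prop) continuousAt_const ?_
    simp [h0, hρ]
  refine ⟨_, mem_nhdsWithin_of_mem_nhds
    (hgsmall.and (Metric.ball_mem_nhds x₀ (half_pos hρ))), L * (2 / ‖e‖), ?_⟩
  rintro x ⟨hx1, hx2⟩ hxΩ
  have hgx : g x < 0 := hg.mem_iff.1 hxΩ
  have habs : |g x| = -g x := abs_of_neg hgx
  set s₁ : ℝ := 2 * |g x| / ‖e‖ ^ 2 with hs₁
  have hs₁pos : 0 < s₁ := by
    have : 0 < |g x| := abs_pos.2 hgx.ne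
    positivity
  have hs₁e : s₁ * ‖e‖ = 2 * |g x| / ‖e‖ := by
    rw [hs₁]; field_simp
  have hpath : ∀ s ∈ Icc 0 s₁, x + s • e ∈ Metric.ball x₀ ρ := by
    intro s hs
    have h1 : ‖s • e‖ ≤ s₁ * ‖e‖ := by
      rw [norm_smul, Real.norm_eq_abs, abs_of_nonneg hs.1]
      gcongr; exact hs.2
    have h2 : dist x x₀ < ρ / 2 := hx2
    rw [Metric.mem_ball, dist_eq_norm]
    rw [dist_eq_norm] at h2
    calc ‖x + s • e - x₀‖ = ‖(x - x₀) + s • e‖ := by congr 1; abel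
      _ ≤ ‖x - x₀‖ + ‖s • e‖ := norm_add_le _ _
      _ < ρ / 2 + ρ / 2 := by
        have : s₁ * ‖e‖ < ρ / 2 := by rw [hs₁e]; exact hx1
        linarith
      _ = ρ := by ring
  have hline : ∀ s, HasDerivAt (fun s : ℝ => g (x + s • e)) (fderiv ℝ g (x + s • e) e) s := by
    intro s
    have h1 : HasDerivAt (fun s : ℝ => x + s • e) e s := by
      simpa using ((hasDerivAt_id s).smul_const e).const_add x
    exact (hder _).comp_hasDerivAt s h1
  have hcl : Continuous fun s : ℝ => g (x + s • e) := by fun_prop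
  have hgrow : ∀ a ∈ Icc 0 s₁, ∀ b ∈ Icc 0 s₁, a ≤ b →
      ‖e‖ ^ 2 / 2 * (b - a) ≤ g (x + b • e) - g (x + a • e) := by
    refine (convex_Icc 0 s₁).mul_sub_le_image_sub_of_le_deriv hcl.continuousOn
      (fun s _ => (hline s).differentiableAt.differentiableWithinAt) ?_
    intro s hs
    rw [(hline s).deriv]
    exact (hball _ (hpath s (interior_subset hs))).le
  have hend : 0 ≤ g (x + s₁ • e) := by
    have := hgrow 0 ⟨le_rfl, hs₁pos.le⟩ s₁ ⟨hs₁pos.le, le_rfl⟩ hs₁pos.le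
    have h2 : ‖e‖ ^ 2 / 2 * (s₁ - 0) = |g x| := by rw [hs₁]; field_simp; ring
    rw [h2, habs] at this
    simp only [zero_smul, add_zero] at this
    linarith
  obtain ⟨s, hs, hgs⟩ : ∃ s ∈ Icc 0 s₁, g (x + s • e) = 0 := by
    have := intermediate_value_Icc hs₁pos.le hcl.continuousOn
    have h3 := this (show (0:ℝ) ∈ _ from ⟨by simpa using hgx.le, hend⟩)
    obtain ⟨s, hs, h⟩ := h3
    exact ⟨s, hs, h⟩
  have hin : ∀ σ ∈ Ico 0 s, x + σ • e ∈ Ω := by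
    intro σ hσ
    have := hgrow σ ⟨hσ.1, hσ.2.le.trans hs.2⟩ s hs hσ.2.le
    rw [hgs] at this
    have h4 : 0 < ‖e‖ ^ 2 / 2 * (s - σ) := by
      have := hσ.2
      have : 0 < s - σ := by linarith
      positivity
    rw [hg.mem_iff]; linarith
  have hspos : 0 < s := by
    rcases hs.1.eq_or_lt with h | h
    · rw [← h] at hgs; simp at hgs; linarith
    · exact h
  have hycl : x + s • e ∈ closure Ω := by
    have htd : Tendsto (fun σ : ℝ => x + σ • e) (𝓝[<] s) (𝓝 (x + s • e)) :=
      (Continuous.tendsto (by fun_prop) s).mono_left nhdsWithin_le_nhds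
    refine mem_closure_of_tendsto htd ?_
    filter_upwards [Ico_mem_nhdsLT hspos] with σ hσ using hin σ hσ
  have hyfr : x + s • e ∈ frontier Ω := by
    rw [hg.isOpen.frontier_eq]
    exact ⟨hycl, fun h => by have := hg.mem_iff.1 h; linarith⟩
  have hseg : segment ℝ x (x + s • e) ⊆ closure Ω := by
    rw [segment_eq_image']
    rintro _ ⟨θ, hθ, rfl⟩
    simp only [add_sub_cancel_left, smul_smul]
    rcases hθ.2.eq_or_lt with h | h
    · rw [h, one_mul]; exact hycl
    · refine subset_closure (hin _ ⟨mul_nonneg hθ.1 hspos.le, ?_⟩)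
      nlinarith
  have hmv := (convex_segment x (x + s • e)).norm_image_sub_le_of_norm_hasFDerivWithin_le
    (f := w) (f' := fun z => fderivWithin ℝ w (closure Ω) z) (C := L)
    (fun z hz => ((hw.differentiableOn (by simp)) z (hseg hz)).hasFDerivWithinAt.mono hseg)
    (fun z hz => hL z (hseg hz)) (left_mem_segment ℝ _ _) (right_mem_segment ℝ _ _)
  rw [hw0 _ hyfr, zero_sub, norm_neg, Real.norm_eq_abs, add_sub_cancel_left] at hmv
  have hL0 : 0 ≤ L := (norm_nonneg _).trans (hL x (subset_closure hxΩ))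
  calc |w x| ≤ L * ‖s • e‖ := hmv
    _ ≤ L * (s₁ * ‖e‖) := by
      gcongr
      rw [norm_smul, Real.norm_eq_abs, abs_of_nonneg hs.1]
      gcongr; exact hs.2
    _ = L * (2 / ‖e‖) * |g x| := by rw [hs₁e]; ring

/-! ### Weak gradients -/

/-- Uniform mollification of compactly supported `C¹` functions, together with the first
derivatives. -/
lemma exists_smooth_approx {Ω : Set (E d)} (hΩ : IsOpen Ω) {η : E d → ℝ} (hη : ContDiff ℝ 1 η)
    (hc : HasCompactSupport η) (hs : tsupport η ⊆ Ω) {ε : ℝ} (hε : 0 < ε) :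
    ∃ η' : E d → ℝ, ContDiff ℝ ∞ η' ∧ HasCompactSupport η' ∧ tsupport η' ⊆ Ω ∧
      (∀ x, |η' x - η x| ≤ ε) ∧ ∀ x, ‖fderiv ℝ η' x - fderiv ℝ η x‖ ≤ ε := by
  have hdc : Continuous (fderiv ℝ η) := hη.continuous_fderiv (by simp)
  have hu0 := hc.uniformContinuous_of_continuous hη.continuous
  have hu1 := (hc.fderiv (𝕜 := ℝ)).uniformContinuous_of_continuous hdc
  obtain ⟨δ₀, hδ₀, h0⟩ := Metric.uniformContinuous_iff.1 hu0 ε hε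
  obtain ⟨δ₁, hδ₁, h1⟩ := Metric.uniformContinuous_iff.1 hu1 ε hε
  obtain ⟨δ₂, hδ₂, h2⟩ := hc.isCompact.exists_cthickening_subset_open hΩ hs
  set δ := min δ₀ (min δ₁ δ₂) with hδ
  have hδpos : 0 < δ := lt_min hδ₀ (lt_min hδ₁ hδ₂)
  let φ : ContDiffBump (0 : E d) := ⟨δ / 2, δ, half_pos hδpos, half_lt_self hδpos⟩
  let L : ℝ →L[ℝ] ℝ →L[ℝ] ℝ := ContinuousLinearMap.lsmul ℝ ℝ
  let η' : E d → ℝ := convolution (φ.normed volume) η L volume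
  have hφi : LocallyIntegrable (φ.normed volume) (volume : Measure (E d)) :=
    (φ.continuous_normed).locallyIntegrable
  have hsupp : tsupport η' ⊆ Metric.cthickening δ (tsupport η) := by
    refine closure_minimal ?_ Metric.isClosed_cthickening
    refine (support_convolution_subset L).trans ?_
    rintro _ ⟨a, ha, b, hb, rfl⟩
    rw [φ.support_normed_eq] at ha
    refine Metric.thickening_subset_cthickening _ _ ?_
    rw [Metric.mem_thickening_iff]
    refine ⟨b, subset_tsupport _ hb, ?_⟩
    simpa [dist_eq_norm] using ha
  have hsΩ : tsupport η' ⊆ Ω := hsupp.trans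
    ((Metric.cthickening_mono ((min_le_right _ _).trans (min_le_right _ _)) _).trans h2)
  refine ⟨η', ?_, ?_, hsΩ, ?_, ?_⟩
  · exact φ.hasCompactSupport_normed.contDiff_convolution_left L φ.contDiff_normed
      hη.continuous.locallyIntegrable
  · exact HasCompactSupport.intro' (hc.isCompact.cthickening) Metric.isClosed_cthickening
      fun x hx => image_eq_zero_of_notMem_tsupport fun h => hx (hsupp h)
  · intro x
    rw [← Real.dist_eq]
    refine φ.dist_normed_convolution_le hη.continuous.aestronglyMeasurable fun y hy => ?_
    exact (h0 (lt_of_lt_of_le hy (min_le_left _ _))).le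
  · intro x
    have hd := hc.hasFDerivAt_convolution_right L hφi hη x
    rw [hd.fderiv]
    have : convolution (φ.normed volume) (fderiv ℝ η) (L.precompR (E d)) volume x
        = convolution (φ.normed volume) (fderiv ℝ η)
            (ContinuousLinearMap.lsmul ℝ ℝ : ℝ →L[ℝ] (E d →L[ℝ] ℝ) →L[ℝ] (E d →L[ℝ] ℝ)) volume x := by
      simp only [convolution]
      congr 1
    rw [this, ← dist_eq_norm]
    refine φ.dist_normed_convolution_le hdc.aestronglyMeasurable fun y hy => ?_
    exact (h1 (lt_of_lt_of_le hy ((min_le_right _ _).trans (min_le_left _ _)))).le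

lemma pd_eq_fderiv {Ω : Set (E d)} (hΩ : IsOpen Ω) (i : Fin d) (f : E d → ℝ) {x : E d}
    (hx : x ∈ Ω) : pd Ω i f x = fderiv ℝ f x (bv i) := by
  rw [pd, fderivWithin_of_mem_nhds (mem_of_superset (hΩ.mem_nhds hx) subset_closure)]

/-- `f` is the weak gradient of `Ψ` on `Ω`, both being integrable. -/
structure HasWeakGradient (Ω : Set (E d)) (Ψ : E d → ℝ) (f : Fin d → E d → ℝ) : Prop where
  integrable : IntegrableOn Ψ Ω
  integrable_grad : ∀ i, IntegrableOn (f i) Ω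
  weak : ∀ η : E d → ℝ, ContDiff ℝ ∞ η → HasCompactSupport η → tsupport η ⊆ Ω →
    ∀ i, ∫ x in Ω, Ψ x * fderiv ℝ η x (bv i) = - ∫ x in Ω, f i x * η x

lemma tendsto_integral_mul_of_abs_sub_le {Ω : Set (E d)} {F : E d → ℝ} (hF : IntegrableOn F Ω)
    {u : ℕ → E d → ℝ} {v : E d → ℝ} (hu : ∀ n, Continuous (u n))
    {B : ℝ} (hB : ∀ x, |v x| ≤ B) (h : ∀ n x, |u n x - v x| ≤ 1 / ((n : ℝ) + 1)) :
    Tendsto (fun n => ∫ x in Ω, F x * u n x) atTop (𝓝 (∫ x in Ω, F x * v x)) := by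
  refine tendsto_integral_of_dominated_convergence (fun x => |F x| * (B + 1)) ?_ ?_ ?_ ?_
  · exact fun n => hF.aestronglyMeasurable.mul (hu n).aestronglyMeasurable
  · exact hF.abs.mul_const _
  · refine fun n => ae_of_all _ fun x => ?_
    rw [Real.norm_eq_abs, abs_mul]
    gcongr
    have h1 := h n x
    have h2 : 1 / ((n : ℝ) + 1) ≤ 1 := by
      rw [div_le_one (by positivity)]; linarith [(Nat.cast_nonneg n : (0:ℝ) ≤ n)]
    have h3 := abs_add_le (u n x - v x) (v x)
    rw [sub_add_cancel] at h3
    linarith [hB x]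
  · refine ae_of_all _ fun x => Tendsto.const_mul _ ?_
    rw [tendsto_iff_dist_tendsto_zero]
    refine squeeze_zero (fun _ => dist_nonneg) (fun n => ?_)
      tendsto_one_div_add_atTop_nhds_zero_nat
    rw [Real.dist_eq]; exact h n x

lemma exists_smooth_seq {Ω : Set (E d)} (hΩ : IsOpen Ω) {η : E d → ℝ} (hη : ContDiff ℝ 1 η)
    (hc : HasCompactSupport η) (hs : tsupport η ⊆ Ω) :
    ∃ η' : ℕ → E d → ℝ, (∀ n, ContDiff ℝ ∞ (η' n)) ∧ (∀ n, HasCompactSupport (η' n)) ∧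
      (∀ n, tsupport (η' n) ⊆ Ω) ∧ (∀ n x, |η' n x - η x| ≤ 1 / ((n : ℝ) + 1)) ∧
      ∀ n x i, |fderiv ℝ (η' n) x (bv i) - fderiv ℝ η x (bv i)| ≤ 1 / ((n : ℝ) + 1) := by
  choose η' h using fun n : ℕ =>
    exists_smooth_approx hΩ hη hc hs (ε := 1 / ((n : ℝ) + 1)) (by positivity)
  refine ⟨η', fun n => (h n).1, fun n => (h n).2.1, fun n => (h n).2.2.1,
    fun n => (h n).2.2.2.1, fun n x i => ?_⟩
  have h1 := (h n).2.2.2.2 x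
  have h2 := (fderiv ℝ (η' n) x - fderiv ℝ η x).le_opNorm (bv i)
  simp only [sub_apply, Real.norm_eq_abs, PiLp.norm_single,
    norm_one, mul_one] at h2
  exact h2.trans h1

lemma exists_bound_of_compactSupport {η : E d → ℝ} (hη : Continuous η)
    (hc : HasCompactSupport η) : ∃ B : ℝ, ∀ x, |η x| ≤ B := by
  obtain ⟨B, hB⟩ := hη.bounded_above_of_compact_support hc
  exact ⟨B, hB⟩

lemma continuous_fderiv_apply_bv {η : E d → ℝ} (hη : ContDiff ℝ 1 η) (i : Fin d) :
    Continuous fun x => fderiv ℝ η x (bv i) :=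
  (hη.continuous_fderiv (by simp)).clm_apply continuous_const

lemma exists_bound_fderiv {η : E d → ℝ} (hη : ContDiff ℝ 1 η)
    (hc : HasCompactSupport η) (i : Fin d) : ∃ B : ℝ, ∀ x, |fderiv ℝ η x (bv i)| ≤ B :=
  exists_bound_of_compactSupport (continuous_fderiv_apply_bv hη i)
    (hc.fderiv_apply (𝕜 := ℝ) (v := bv i))

/-- Weak gradients may be tested with compactly supported `C¹` functions. -/
lemma HasWeakGradient.weak_one {Ω : Set (E d)} (hΩ : IsOpen Ω) {Ψ : E d → ℝ}
    {f : Fin d → E d → ℝ} (h : HasWeakGradient Ω Ψ f) {η : E d → ℝ} (hη : ContDiff ℝ 1 η)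
    (hc : HasCompactSupport η) (hs : tsupport η ⊆ Ω) (i : Fin d) :
    ∫ x in Ω, Ψ x * fderiv ℝ η x (bv i) = - ∫ x in Ω, f i x * η x := by
  obtain ⟨η', h1, h2, h3, h4, h5⟩ := exists_smooth_seq hΩ hη hc hs
  obtain ⟨B, hB⟩ := exists_bound_of_compactSupport hη.continuous hc
  obtain ⟨B', hB'⟩ := exists_bound_fderiv hη hc i
  have l1 := tendsto_integral_mul_of_abs_sub_le h.integrable
    (fun n => continuous_fderiv_apply_bv ((h1 n).of_le (by simp)) i) hB' (fun n x => h5 n x i)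
  have l2 := (tendsto_integral_mul_of_abs_sub_le (h.integrable_grad i)
    (fun n => (h1 n).continuous) hB h4).neg
  refine tendsto_nhds_unique l1 (l2.congr fun n => ?_)
  exact (h.weak _ (h1 n) (h2 n) (h3 n) i).symm

/-- Weak gradients are curl-free in the sense of distributions. -/
lemma HasWeakGradient.integral_mul_fderiv_comm {Ω : Set (E d)} (hΩ : IsOpen Ω) {Ψ : E d → ℝ}
    {f : Fin d → E d → ℝ} (h : HasWeakGradient Ω Ψ f) {η : E d → ℝ} (hη : ContDiff ℝ 1 η)
    (hc : HasCompactSupport η) (hs : tsupport η ⊆ Ω) (i j : Fin d) :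
    ∫ x in Ω, f i x * fderiv ℝ η x (bv j) = ∫ x in Ω, f j x * fderiv ℝ η x (bv i) := by
  obtain ⟨η', h1, h2, h3, h4, h5⟩ := exists_smooth_seq hΩ hη hc hs
  have hl : ∀ i j : Fin d, Tendsto (fun n => ∫ x in Ω, f i x * fderiv ℝ (η' n) x (bv j)) atTop
      (𝓝 (∫ x in Ω, f i x * fderiv ℝ η x (bv j))) := by
    intro i j
    obtain ⟨B', hB'⟩ := exists_bound_fderiv hη hc j
    exact tendsto_integral_mul_of_abs_sub_le (h.integrable_grad i)
      (fun n => continuous_fderiv_apply_bv ((h1 n).of_le (by simp)) j) hB' (fun n x => h5 n x j)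
  refine tendsto_nhds_unique (hl i j) ((hl j i).congr fun n => ?_)
  have key : ∀ i j : Fin d, ∫ x in Ω, f i x * fderiv ℝ (η' n) x (bv j)
      = - ∫ x in Ω, Ψ x * fderiv ℝ (fderiv ℝ (η' n)) x (bv i) (bv j) := by
    intro i j
    have hcd : ContDiff ℝ ∞ fun x => fderiv ℝ (η' n) x (bv j) :=
      ((h1 n).fderiv_right (m := ∞) (by simp)).clm_apply contDiff_const
    have hh := h.weak (fun x => fderiv ℝ (η' n) x (bv j)) hcd
      ((h2 n).fderiv_apply (𝕜 := ℝ) (v := bv j)) ?_ i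
    · rw [← neg_eq_iff_eq_neg] at hh
      rw [← hh]
      congr 1
      refine integral_congr_ae (ae_of_all _ fun x => ?_)
      have hd : DifferentiableAt ℝ (fderiv ℝ (η' n)) x :=
        ((h1 n).fderiv_right (m := ∞) (by simp)).differentiable (by simp) x
      simp only
      congr 1
      rw [fderiv_clm_apply hd (differentiableAt_const _)]
      simp
    · exact (tsupport_fderiv_apply_subset ℝ (bv j)).trans (h3 n)
  rw [key, key]
  congr 1
  refine integral_congr_ae (ae_of_all _ fun x => ?_)
  have hsym : IsSymmSndFDerivAt ℝ (η' n) x :=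
    (h1 n).contDiffAt.isSymmSndFDerivAt (by
      simp only [minSmoothness_of_isRCLikeNormedField]
      exact WithTop.coe_le_coe.2 (le_top : (2 : ℕ∞) ≤ ⊤))
  simp only
  rw [hsym.eq]

/-! ### Integration by parts for tangential fields -/

lemma contDiff_mul_of_tsupport_subset {Ω : Set (E d)} (hΩ : IsOpen Ω) {η v : E d → ℝ}
    (hη : ContDiff ℝ 1 η) (hs : tsupport η ⊆ Ω) (hv : ContDiffOn ℝ 1 v Ω) :
    ContDiff ℝ 1 fun x => η x * v x := by
  refine contDiff_iff_contDiffAt.2 fun x => ?_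
  by_cases hx : x ∈ tsupport η
  · exact hη.contDiffAt.mul (hv.contDiffAt (hΩ.mem_nhds (hs hx)))
  · refine (contDiffAt_const (c := (0:ℝ))).congr_of_eventuallyEq ?_
    filter_upwards [(isClosed_tsupport η).isOpen_compl.mem_nhds hx] with y hy
    rw [image_eq_zero_of_notMem_tsupport hy, zero_mul]

/-- The derivative of `smoothTransition` lives on `[0, 1]`, so that `|S'(u)| |u + 1|` is bounded. -/
lemma exists_bound_deriv_smoothTransition :
    ∃ S : ℝ, ∀ u : ℝ, |deriv Real.smoothTransition u| * |u + 1| ≤ S := by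
  have hc : ContDiff ℝ 1 Real.smoothTransition := Real.smoothTransition.contDiff
  obtain ⟨S, hS⟩ := (isCompact_Icc (a := (0:ℝ)) (b := 1)).exists_bound_of_continuousOn
    (f := fun u => |deriv Real.smoothTransition u| * |u + 1|)
    (((hc.continuous_deriv (by simp)).abs.mul (by fun_prop)).continuousOn)
  have hS0 : 0 ≤ S := (norm_nonneg _).trans (hS 0 (by simp))
  refine ⟨S, fun u => ?_⟩
  by_cases hu : u ∈ Icc (0:ℝ) 1
  · exact (le_abs_self _).trans (hS u hu)
  · have : deriv Real.smoothTransition u = 0 := by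
      rw [mem_Icc, not_and_or, not_le, not_le] at hu
      rcases hu with hu | hu
      · have : Real.smoothTransition =ᶠ[𝓝 u] fun _ => 0 := by
          filter_upwards [Iio_mem_nhds hu] with s hs
          exact Real.smoothTransition.zero_of_nonpos (le_of_lt hs)
        rw [this.deriv_eq]; simp
      · have : Real.smoothTransition =ᶠ[𝓝 u] fun _ => 1 := by
          filter_upwards [Ioi_mem_nhds hu] with s hs
          exact Real.smoothTransition.one_of_one_le (le_of_lt hs)
        rw [this.deriv_eq]; simp
    rw [this]; simpa using hS0

/-- Cutoff functions `χ(k g)`: they exhaust the domain, and their gradients are multiples of `∇g`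
by a factor of size `O(1 / |g|)`. -/
lemma IsDefiningFunction.exists_cutoff {g : E d → ℝ} {Ω : Set (E d)}
    (hg : IsDefiningFunction g Ω) (hb : Bornology.IsBounded Ω) :
    ∃ (η : ℕ → E d → ℝ) (c : ℕ → E d → ℝ) (S : ℝ),
      (∀ k, ContDiff ℝ 1 (η k)) ∧ (∀ k, HasCompactSupport (η k)) ∧ (∀ k, tsupport (η k) ⊆ Ω) ∧
      (∀ k x, |η k x| ≤ 1) ∧ (∀ k, Continuous (c k)) ∧
      (∀ k x v, fderiv ℝ (η k) x v = c k x * fderiv ℝ g x v) ∧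
      (∀ k x, |c k x| * |g x| ≤ S) ∧
      (∀ x ∈ Ω, ∀ᶠ k in atTop, η k x = 1 ∧ c k x = 0) := by
  obtain ⟨S, hS⟩ := exists_bound_deriv_smoothTransition
  have hc : ContDiff ℝ 1 Real.smoothTransition := Real.smoothTransition.contDiff
  have hg1 : ContDiff ℝ 1 g := hg.1.of_le (by simp)
  let u : ℕ → E d → ℝ := fun k x => -(k : ℝ) * g x - 1
  have hu : ∀ k, ContDiff ℝ 1 (u k) := fun k => (contDiff_const.mul hg1).sub contDiff_const
  have hsub : ∀ k, tsupport (fun x => Real.smoothTransition (u k x)) ⊆ {x | (k : ℝ) * g x ≤ -1} := by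
    intro k
    refine closure_minimal ?_ (isClosed_le (by fun_prop) continuous_const)
    intro x hx
    by_contra hcon
    simp only [mem_ofPred_eq, not_le] at hcon
    exact hx (Real.smoothTransition.zero_of_nonpos (by simp only [u]; linarith))
  have hsubΩ : ∀ k, tsupport (fun x => Real.smoothTransition (u k x)) ⊆ Ω := by
    intro k x hx
    have := hsub k hx
    simp only [mem_ofPred_eq] at this
    rw [hg.mem_iff]
    by_contra hcon
    have : 0 ≤ (k : ℝ) * g x := mul_nonneg (by positivity) (not_lt.1 hcon)
    linarith
  refine ⟨fun k x => Real.smoothTransition (u k x),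
    fun k x => deriv Real.smoothTransition (u k x) * (-(k : ℝ)), S, fun k => hc.comp (hu k), ?_,
    hsubΩ, ?_, ?_, ?_, ?_, ?_⟩
  · intro k
    exact HasCompactSupport.intro' (hb.isCompact_closure.of_isClosed_subset (isClosed_tsupport _)
      ((hsubΩ k).trans subset_closure)) (isClosed_tsupport _)
      fun x hx => image_eq_zero_of_notMem_tsupport (f := fun x => Real.smoothTransition (u k x)) hx
  · intro k x
    rw [abs_of_nonneg (Real.smoothTransition.nonneg _)]
    exact Real.smoothTransition.le_one _
  · exact fun k => ((hc.continuous_deriv (by simp)).comp (hu k).continuous).mul continuous_const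
  · intro k x v
    have h1 : HasDerivAt Real.smoothTransition (deriv Real.smoothTransition (u k x)) (u k x) :=
      (hc.differentiable (by simp)).differentiableAt.hasDerivAt
    have h2 : HasFDerivAt (u k) (-(k : ℝ) • fderiv ℝ g x) x := by
      have := ((hg1.differentiable (by simp)).differentiableAt (x := x)).hasFDerivAt
      exact (this.const_mul (-(k : ℝ))).sub_const 1
    have h3 := h1.comp_hasFDerivAt x h2
    have h4 : (fun x => Real.smoothTransition (u k x)) = Real.smoothTransition ∘ u k := rfl
    simp only [h4]
    rw [h3.fderiv]
    simp; ring
  · intro k x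
    have := hS (u k x)
    refine le_trans (le_of_eq ?_) this
    simp only [u, abs_mul, abs_neg, sub_add_cancel]
    ring
  · intro x hx
    have hgx := hg.mem_iff.1 hx
    have h1 : Tendsto (fun k : ℕ => (k : ℝ) * (-g x)) atTop atTop :=
      tendsto_natCast_atTop_atTop.atTop_mul_const (by linarith)
    filter_upwards [h1.eventually_gt_atTop 2] with k hk
    have hk' : 1 < u k x := by simp only [u]; linarith
    refine ⟨Real.smoothTransition.one_of_one_le hk'.le, ?_⟩
    have : Real.smoothTransition =ᶠ[𝓝 (u k x)] fun _ => 1 := by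
      filter_upwards [Ioi_mem_nhds hk'] with s hs
      exact Real.smoothTransition.one_of_one_le (le_of_lt hs)
    rw [this.deriv_eq]; simp

lemma fderiv_mul_apply {η v : E d → ℝ} {x : E d} (hη : DifferentiableAt ℝ η x)
    (hv : DifferentiableAt ℝ v x) (e : E d) :
    fderiv ℝ (fun y => η y * v y) x e = η x * fderiv ℝ v x e + fderiv ℝ η x e * v x := by
  rw [fderiv_fun_mul hη hv]
  simp; ring

lemma exists_bound_mul_of_continuousOn {Ω : Set (E d)} (hb : Bornology.IsBounded Ω)
    {v : E d → ℝ} (hv : ContinuousOn v (closure Ω)) : ∃ B : ℝ, ∀ x ∈ Ω, |v x| ≤ B := by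
  obtain ⟨B, hB⟩ := hb.isCompact_closure.exists_bound_of_continuousOn hv
  exact ⟨B, fun x hx => hB x (subset_closure hx)⟩

lemma aestronglyMeasurable_restrict_of_continuousOn {Ω : Set (E d)} (hΩ : IsOpen Ω)
    {v : E d → ℝ} (hv : ContinuousOn v (closure Ω)) :
    AEStronglyMeasurable v (volume.restrict Ω) :=
  (hv.mono subset_closure).aestronglyMeasurable hΩ.measurableSet

/-- Products of integrable functions with functions continuous up to the boundary. -/
lemma integrableOn_mul_continuousOn {Ω : Set (E d)} (hΩ : IsOpen Ω)
    (hb : Bornology.IsBounded Ω) {F v : E d → ℝ} (hF : IntegrableOn F Ω)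
    (hv : ContinuousOn v (closure Ω)) : IntegrableOn (fun x => F x * v x) Ω := by
  obtain ⟨B, hB⟩ := exists_bound_mul_of_continuousOn hb hv
  refine Integrable.mul_bdd (c := B) hF (aestronglyMeasurable_restrict_of_continuousOn hΩ hv) ?_
  exact (ae_restrict_iff' hΩ.measurableSet).2 (ae_of_all _ hB)

lemma continuousOn_pd {Ω : Set (E d)} (hu : UniqueDiffOn ℝ (closure Ω)) {v : E d → ℝ}
    (hv : ContDiffOn ℝ 1 v (closure Ω)) (i : Fin d) :
    ContinuousOn (fun x => pd Ω i v x) (closure Ω) :=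
  (hv.continuousOn_fderivWithin hu le_rfl).clm_apply continuousOn_const

/-- Removing the cutoff: `∫ F (η_k v + c_k w) → ∫ F v` when `w` vanishes on the boundary. -/
lemma tendsto_integral_cutoff {g : E d → ℝ} {Ω : Set (E d)} (hg : IsDefiningFunction g Ω)
    (hb : Bornology.IsBounded Ω) {η c : ℕ → E d → ℝ} {S : ℝ}
    (hη : ∀ k, Continuous (η k)) (hη1 : ∀ k x, |η k x| ≤ 1) (hc : ∀ k, Continuous (c k))
    (hcS : ∀ k x, |c k x| * |g x| ≤ S)
    (hlim : ∀ x ∈ Ω, ∀ᶠ k in atTop, η k x = 1 ∧ c k x = 0)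
    {F v w : E d → ℝ} (hF : IntegrableOn F Ω) (hv : ContinuousOn v (closure Ω))
    (hw : ContDiffOn ℝ 1 w (closure Ω)) (hw0 : ∀ x ∈ frontier Ω, w x = 0) :
    Tendsto (fun k => ∫ x in Ω, F x * (η k x * v x + c k x * w x)) atTop
      (𝓝 (∫ x in Ω, F x * v x)) := by
  obtain ⟨B, hB⟩ := exists_bound_mul_of_continuousOn hb hv
  obtain ⟨C, hC⟩ := hg.exists_abs_le_mul hb hw hw0
  have hm := hg.isOpen.measurableSet
  refine tendsto_integral_of_dominated_convergence (fun x => |F x| * (B + |C| * S)) ?_ ?_ ?_ ?_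
  · intro k
    exact hF.aestronglyMeasurable.mul (((hη k).aestronglyMeasurable.mul
      (aestronglyMeasurable_restrict_of_continuousOn hg.isOpen hv)).add ((hc k).aestronglyMeasurable.mul
      (aestronglyMeasurable_restrict_of_continuousOn hg.isOpen hw.continuousOn)))
  · exact hF.abs.mul_const _
  · intro k
    refine (ae_restrict_iff' hm).2 (ae_of_all _ fun x hx => ?_)
    rw [Real.norm_eq_abs, abs_mul]
    gcongr
    refine (abs_add_le _ _).trans ?_
    rw [abs_mul, abs_mul]
    have h1 := hB x hx
    have h2 := hη1 k x
    have h3 := hC x hx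
    have h4 := hcS k x
    have h5 : C * |g x| ≤ |C| * |g x| := by gcongr; exact le_abs_self C
    have h6 : |c k x| * |w x| ≤ |C| * S := by
      calc |c k x| * |w x| ≤ |c k x| * (|C| * |g x|) := by gcongr; exact h3.trans h5
        _ = |C| * (|c k x| * |g x|) := by ring
        _ ≤ |C| * S := by gcongr
    have h7 : |η k x| * |v x| ≤ 1 * B := by gcongr
    linarith
  · refine (ae_restrict_iff' hm).2 (ae_of_all _ fun x hx => ?_)
    refine tendsto_const_nhds.congr' ?_
    filter_upwards [hlim x hx] with k hk
    rw [hk.1, hk.2]; ring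

/-- **Integration by parts** of a weak gradient against a `C¹` field that is tangential on the
boundary. -/
lemma HasWeakGradient.integral_mul_tangential {g : E d → ℝ} {Ω : Set (E d)}
    (hg : IsDefiningFunction g Ω) (hb : Bornology.IsBounded Ω) {Ψ : E d → ℝ}
    {f : Fin d → E d → ℝ} (h : HasWeakGradient Ω Ψ f) {V : Fin d → E d → ℝ}
    (hV : ∀ i, ContDiffOn ℝ 1 (V i) (closure Ω))
    (hV0 : ∀ x ∈ frontier Ω, ∑ i, V i x * fderiv ℝ g x (bv i) = 0) :
    ∑ i, ∫ x in Ω, f i x * V i x = - ∫ x in Ω, Ψ x * ∑ i, pd Ω i (V i) x := by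
  obtain ⟨η, c, S, h1, h2, h3, h4, h5, h6, h7, h8⟩ := hg.exists_cutoff hb
  have hΩ := hg.isOpen
  have hu := hg.uniqueDiffOn_closure
  have hg1 : ∀ i, ContDiff ℝ 1 fun x => fderiv ℝ g x (bv i) := fun i =>
    ((hg.1.fderiv_right (m := ∞) (by simp)).clm_apply contDiff_const).of_le (by simp)
  have l1 : Tendsto (fun k => ∑ i, ∫ x in Ω, f i x * (η k x * V i x)) atTop
      (𝓝 (∑ i, ∫ x in Ω, f i x * V i x)) := by
    refine tendsto_finsetSum _ fun i _ => ?_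
    have := tendsto_integral_cutoff hg hb (fun k => (h1 k).continuous) h4 h5 h7 h8
      (h.integrable_grad i) (hV i).continuousOn (w := fun _ => 0) contDiffOn_const (by simp)
    simpa using this
  have hwd : ContDiffOn ℝ 1 (fun x => ∑ i, V i x * fderiv ℝ g x (bv i)) (closure Ω) :=
    ContDiffOn.sum fun i _ => (hV i).mul (hg1 i).contDiffOn
  have hdiv : ContinuousOn (fun x => ∑ i, pd Ω i (V i) x) (closure Ω) :=
    continuousOn_finsetSum _ fun i _ => continuousOn_pd hu (hV i) i
  have l2 := (tendsto_integral_cutoff hg hb (fun k => (h1 k).continuous) h4 h5 h7 h8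
      h.integrable hdiv hwd hV0).neg
  refine tendsto_nhds_unique l1 (l2.congr fun k => ?_)
  have hVd : ∀ i, ∀ x ∈ Ω, DifferentiableAt ℝ (V i) x := fun i x hx =>
    (((hV i).mono subset_closure).contDiffAt (hΩ.mem_nhds hx)).differentiableAt (by simp)
  have hprod : ∀ i, ContDiff ℝ 1 fun x => η k x * V i x := fun i =>
    contDiff_mul_of_tsupport_subset hΩ (h1 k) (h3 k) ((hV i).mono subset_closure)
  have hcs : ∀ i, HasCompactSupport fun x => η k x * V i x := fun i => (h2 k).mul_right
  have hts : ∀ i, tsupport (fun x => η k x * V i x) ⊆ Ω := fun i =>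
    tsupport_mul_subset_left.trans (h3 k)
  have key : ∀ i, ∫ x in Ω, f i x * (η k x * V i x)
      = - ∫ x in Ω, Ψ x * (fderiv ℝ (fun x => η k x * V i x) x (bv i)) := fun i => by
    rw [h.weak_one hΩ (hprod i) (hcs i) (hts i) i, neg_neg]
  simp_rw [key, Finset.sum_neg_distrib]
  congr 1
  rw [← integral_finsetSum]
  · refine setIntegral_congr_fun hΩ.measurableSet fun x hx => ?_
    beta_reduce
    rw [← Finset.mul_sum]
    congr 1
    simp_rw [pd_eq_fderiv hΩ _ _ hx]
    rw [Finset.mul_sum, Finset.mul_sum, ← Finset.sum_add_distrib]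
    refine Finset.sum_congr rfl fun i _ => ?_
    rw [fderiv_mul_apply ((h1 k).differentiable (by simp) x) (hVd i x hx), h6]
    ring
  · intro i _
    exact integrableOn_mul_continuousOn hΩ hb h.integrable
      (continuous_fderiv_apply_bv (hprod i) i).continuousOn

/-- A weak gradient is orthogonal to the divergence-free fields `(∑ⱼ ∂ⱼ Aᵢⱼ)ᵢ`, where `A` is
antisymmetric and annihilates the normal on the boundary. -/
lemma HasWeakGradient.integral_mul_div_antisymm {g : E d → ℝ} {Ω : Set (E d)}
    (hg : IsDefiningFunction g Ω) (hb : Bornology.IsBounded Ω) {Ψ : E d → ℝ}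
    {f : Fin d → E d → ℝ} (h : HasWeakGradient Ω Ψ f) {A : Fin d → Fin d → E d → ℝ}
    (hA : ∀ i j, ContDiffOn ℝ 1 (A i j) (closure Ω)) (hanti : ∀ i j x, A i j x = - A j i x)
    (hA0 : ∀ x ∈ frontier Ω, ∀ i, ∑ j, A i j x * fderiv ℝ g x (bv j) = 0) :
    ∑ i, ∫ x in Ω, f i x * ∑ j, pd Ω j (A i j) x = 0 := by
  obtain ⟨η, c, S, h1, h2, h3, h4, h5, h6, h7, h8⟩ := hg.exists_cutoff hb
  have hΩ := hg.isOpen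
  have hu := hg.uniqueDiffOn_closure
  have hg1 : ∀ i, ContDiff ℝ 1 fun x => fderiv ℝ g x (bv i) := fun i =>
    ((hg.1.fderiv_right (m := ∞) (by simp)).clm_apply contDiff_const).of_le (by simp)
  have l1 : Tendsto (fun k => ∑ i, ∫ x in Ω, f i x * (η k x * (∑ j, pd Ω j (A i j) x)
      + c k x * ∑ j, A i j x * fderiv ℝ g x (bv j))) atTop
      (𝓝 (∑ i, ∫ x in Ω, f i x * ∑ j, pd Ω j (A i j) x)) := by
    refine tendsto_finsetSum _ fun i _ => ?_
    exact tendsto_integral_cutoff hg hb (fun k => (h1 k).continuous) h4 h5 h7 h8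
      (h.integrable_grad i) (continuousOn_finsetSum _ fun j _ => continuousOn_pd hu (hA i j) j)
      (ContDiffOn.sum fun j _ => (hA i j).mul (hg1 j).contDiffOn) (fun x hx => hA0 x hx i)
  refine tendsto_nhds_unique l1 (tendsto_const_nhds.congr fun k => ?_)
  have hAd : ∀ i j, ∀ x ∈ Ω, DifferentiableAt ℝ (A i j) x := fun i j x hx =>
    (((hA i j).mono subset_closure).contDiffAt (hΩ.mem_nhds hx)).differentiableAt (by simp)
  have hprod : ∀ i j, ContDiff ℝ 1 fun x => η k x * A i j x := fun i j =>
    contDiff_mul_of_tsupport_subset hΩ (h1 k) (h3 k) ((hA i j).mono subset_closure)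
  have hcs : ∀ i j, HasCompactSupport fun x => η k x * A i j x := fun i j => (h2 k).mul_right
  have hts : ∀ i j, tsupport (fun x => η k x * A i j x) ⊆ Ω := fun i j =>
    tsupport_mul_subset_left.trans (h3 k)
  have hint : ∀ i j l m, IntegrableOn
      (fun x => f l x * fderiv ℝ (fun x => η k x * A i j x) x (bv m)) Ω := fun i j l m =>
    integrableOn_mul_continuousOn hΩ hb (h.integrable_grad l)
      (continuous_fderiv_apply_bv (hprod i j) m).continuousOn
  have hsplit : ∀ i, ∫ x in Ω, f i x * (η k x * (∑ j, pd Ω j (A i j) x)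
      + c k x * ∑ j, A i j x * fderiv ℝ g x (bv j))
      = ∑ j, ∫ x in Ω, f i x * fderiv ℝ (fun x => η k x * A i j x) x (bv j) := by
    intro i
    rw [← integral_finsetSum _ fun j _ => hint i j i j]
    refine setIntegral_congr_fun hΩ.measurableSet fun x hx => ?_
    beta_reduce
    rw [← Finset.mul_sum]
    congr 1
    simp_rw [pd_eq_fderiv hΩ _ _ hx]
    rw [Finset.mul_sum, Finset.mul_sum, ← Finset.sum_add_distrib]
    refine Finset.sum_congr rfl fun j _ => ?_
    rw [fderiv_mul_apply ((h1 k).differentiable (by simp) x) (hAd i j x hx), h6]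
    ring
  simp_rw [hsplit]
  -- the double sum changes sign under exchange of the indices
  have hsw : ∀ i j, ∫ x in Ω, f i x * fderiv ℝ (fun x => η k x * A i j x) x (bv j)
      = - ∫ x in Ω, f j x * fderiv ℝ (fun x => η k x * A j i x) x (bv i) := by
    intro i j
    rw [h.integral_mul_fderiv_comm hΩ (hprod i j) (hcs i j) (hts i j) i j, ← integral_neg]
    refine integral_congr_ae (ae_of_all _ fun x => ?_)
    have : (fun x => η k x * A i j x) = fun x => -(η k x * A j i x) := by
      funext y; rw [hanti i j y]; ring
    simp only [this, fderiv_fun_neg, neg_apply]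
    ring
  have hneg : ∑ i, ∑ j, ∫ x in Ω, f i x * fderiv ℝ (fun x => η k x * A i j x) x (bv j)
      = - ∑ i, ∑ j, ∫ x in Ω, f i x * fderiv ℝ (fun x => η k x * A i j x) x (bv j) := by
    conv_lhs => rw [Finset.sum_comm]
    simp_rw [← Finset.sum_neg_distrib]
    exact Finset.sum_congr rfl fun i _ => Finset.sum_congr rfl fun j _ => hsw j i
  linarith

/-- A `C¹` function on the closure has its pointwise gradient as weak gradient. -/
lemma hasWeakGradient_of_contDiffOn {Ω : Set (E d)} (hΩ : IsOpen Ω)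
    (hb : Bornology.IsBounded Ω) (hu : UniqueDiffOn ℝ (closure Ω)) {θ : E d → ℝ}
    (hθ : ContDiffOn ℝ 1 θ (closure Ω)) :
    HasWeakGradient Ω θ (fun i x => pd Ω i θ x) := by
  have hfin : IsFiniteMeasure (volume.restrict Ω) := ⟨by
    rw [Measure.restrict_apply_univ]; exact hb.measure_lt_top⟩
  have hone : IntegrableOn (fun _ : E d => (1:ℝ)) Ω := integrable_const _
  have hint : ∀ v : E d → ℝ, ContinuousOn v (closure Ω) → IntegrableOn v Ω := fun v hv => by
    simpa using integrableOn_mul_continuousOn hΩ hb hone hv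
  refine ⟨hint _ hθ.continuousOn, fun i => hint _ (continuousOn_pd hu hθ i), ?_⟩
  intro η hη hc hs i
  have hη1 : ContDiff ℝ 1 η := hη.of_le (by simp)
  have e1 : ∫ x in Ω, pd Ω i θ x * η x = ∫ x in Ω, fderiv ℝ θ x (bv i) * η x :=
    setIntegral_congr_fun hΩ.measurableSet fun x hx => by
      simp only [pd_eq_fderiv hΩ i θ hx]
  have z1 : ∀ x, x ∉ Ω → η x = 0 := fun x hx =>
    image_eq_zero_of_notMem_tsupport fun h => hx (hs h)
  have z2 : ∀ x, x ∉ Ω → fderiv ℝ η x (bv i) = 0 := fun x hx => by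
    have := image_eq_zero_of_notMem_tsupport
      (f := fun x => fderiv ℝ η x (bv i)) (x := x) fun h =>
        hx (hs (tsupport_fderiv_apply_subset ℝ (bv i) h))
    exact this
  have w1 : ∀ x, x ∉ Ω → θ x * fderiv ℝ η x (bv i) = 0 := fun x hx => by rw [z2 x hx, mul_zero]
  have w2 : ∀ x, x ∉ Ω → fderiv ℝ θ x (bv i) * η x = 0 := fun x hx => by rw [z1 x hx, mul_zero]
  have w3 : ∀ x, x ∉ Ω → θ x * η x = 0 := fun x hx => by rw [z1 x hx, mul_zero]
  have toWhole : ∀ F : E d → ℝ, (∀ x, x ∉ Ω → F x = 0) → IntegrableOn F Ω → Integrable F := by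
    intro F hF hi
    refine (integrableOn_iff_integrable_of_support_subset fun x hx => ?_).1 hi
    by_contra hcon; exact hx (hF x hcon)
  have i1 : IntegrableOn (fun x => pd Ω i θ x * η x) Ω :=
    integrableOn_mul_continuousOn hΩ hb (hint _ (continuousOn_pd hu hθ i)) hη.continuous.continuousOn
  have i1' : IntegrableOn (fun x => fderiv ℝ θ x (bv i) * η x) Ω :=
    i1.congr_fun (fun x hx => by simp only [pd_eq_fderiv hΩ i θ hx]) hΩ.measurableSet
  rw [e1, setIntegral_eq_integral_of_forall_compl_eq_zero w1,
    setIntegral_eq_integral_of_forall_compl_eq_zero w2]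
  refine integral_mul_fderiv_eq_neg_fderiv_mul_of_integrable (toWhole _ w2 i1')
    (toWhole _ w1 (integrableOn_mul_continuousOn hΩ hb (hint _ hθ.continuousOn)
      (continuous_fderiv_apply_bv hη1 i).continuousOn))
    (toWhole _ w3 (integrableOn_mul_continuousOn hΩ hb (hint _ hθ.continuousOn)
      hη.continuous.continuousOn)) ?_ ?_
  · intro x hx
    exact ((hθ.mono subset_closure).contDiffAt (hΩ.mem_nhds (hs hx))).differentiableAt (by simp)
  · exact fun x _ => hη1.differentiable (by simp) x

lemma IsTangential.sum_mul_fderiv_eq_zero {g : E d → ℝ} {Ω : Set (E d)}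
    (hg : IsDefiningFunction g Ω) {V : E d → E d} (hV : IsTangential Ω V) {x : E d}
    (hx : x ∈ frontier Ω) : ∑ i, V x i * fderiv ℝ g x (bv i) = 0 := by
  have hne := hg.2.2 x hx
  have h := hV x _ ⟨hx, g, hg, rfl⟩
  rw [inner_smul_right, mul_eq_zero] at h
  have h' : inner ℝ (V x) (gradient g x) = 0 :=
    h.resolve_left (inv_ne_zero (norm_ne_zero_iff.2 hne))
  rw [PiLp.inner_apply] at h'
  rw [← h']
  refine Finset.sum_congr rfl fun i _ => ?_
  rw [fderiv_apply_eq_inner_gradient, EuclideanSpace.inner_single_right]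
  simp [mul_comm]

/-! ### Calculus on space-time cylinders -/

section Calculus

variable {Ω : Set (E d)} {I : Set ℝ} {F : ℝ × E d → ℝ}

lemma differentiableAt_of_contDiffOn (hΩ : IsOpen Ω) {v : E d → ℝ}
    (hv : ContDiffOn ℝ 1 v (closure Ω)) {x : E d} (hx : x ∈ Ω) : DifferentiableAt ℝ v x :=
  ((hv.mono subset_closure).contDiffAt (hΩ.mem_nhds hx)).differentiableAt (by simp)

lemma pd_add (hΩ : IsOpen Ω) {v w : E d → ℝ} (hv : ContDiffOn ℝ 1 v (closure Ω))
    (hw : ContDiffOn ℝ 1 w (closure Ω)) (i : Fin d) {x : E d} (hx : x ∈ Ω) :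
    pd Ω i (fun y => v y + w y) x = pd Ω i v x + pd Ω i w x := by
  rw [pd_eq_fderiv hΩ _ _ hx, pd_eq_fderiv hΩ _ _ hx, pd_eq_fderiv hΩ _ _ hx,
    fderiv_fun_add (differentiableAt_of_contDiffOn hΩ hv hx)
      (differentiableAt_of_contDiffOn hΩ hw hx)]
  simp

lemma pd_sub (hΩ : IsOpen Ω) {v w : E d → ℝ} (hv : ContDiffOn ℝ 1 v (closure Ω))
    (hw : ContDiffOn ℝ 1 w (closure Ω)) (i : Fin d) {x : E d} (hx : x ∈ Ω) :
    pd Ω i (fun y => v y - w y) x = pd Ω i v x - pd Ω i w x := by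
  rw [pd_eq_fderiv hΩ _ _ hx, pd_eq_fderiv hΩ _ _ hx, pd_eq_fderiv hΩ _ _ hx,
    fderiv_fun_sub (differentiableAt_of_contDiffOn hΩ hv hx)
      (differentiableAt_of_contDiffOn hΩ hw hx)]
  simp

lemma pd_mul (hΩ : IsOpen Ω) {v w : E d → ℝ} (hv : ContDiffOn ℝ 1 v (closure Ω))
    (hw : ContDiffOn ℝ 1 w (closure Ω)) (i : Fin d) {x : E d} (hx : x ∈ Ω) :
    pd Ω i (fun y => v y * w y) x = v x * pd Ω i w x + pd Ω i v x * w x := by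
  rw [pd_eq_fderiv hΩ _ _ hx, pd_eq_fderiv hΩ _ _ hx, pd_eq_fderiv hΩ _ _ hx,
    fderiv_mul_apply (differentiableAt_of_contDiffOn hΩ hv hx)
      (differentiableAt_of_contDiffOn hΩ hw hx)]

lemma pd_const_mul (hΩ : IsOpen Ω) {v : E d → ℝ} (hv : ContDiffOn ℝ 1 v (closure Ω))
    (c : ℝ) (i : Fin d) {x : E d} (hx : x ∈ Ω) :
    pd Ω i (fun y => c * v y) x = c * pd Ω i v x := by
  rw [pd_mul hΩ contDiffOn_const hv i hx, pd_eq_fderiv hΩ i (fun _ => c) hx]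
  simp

lemma pd_sum (hΩ : IsOpen Ω) {v : Fin d → E d → ℝ} (hv : ∀ k, ContDiffOn ℝ 1 (v k) (closure Ω))
    (i : Fin d) {x : E d} (hx : x ∈ Ω) :
    pd Ω i (fun y => ∑ k, v k y) x = ∑ k, pd Ω i (v k) x := by
  simp_rw [pd_eq_fderiv hΩ _ _ hx]
  rw [fderiv_fun_sum fun k _ => differentiableAt_of_contDiffOn hΩ (hv k) hx]
  simp

lemma contDiffOn_slice {n : WithTop ℕ∞} (hF : ContDiffOn ℝ n F (I ×ˢ closure Ω)) {t : ℝ}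
    (ht : t ∈ I) : ContDiffOn ℝ n (fun x => F (t, x)) (closure Ω) :=
  hF.comp (contDiff_const.prodMk contDiff_id).contDiffOn fun _ hx => ⟨ht, hx⟩

lemma pd_slice (hu : UniqueDiffOn ℝ (closure Ω)) (hF : ContDiffOn ℝ 1 F (I ×ˢ closure Ω))
    (i : Fin d) {t : ℝ} (ht : t ∈ I) {x : E d} (hx : x ∈ closure Ω) :
    pd Ω i (fun y => F (t, y)) x = fderivWithin ℝ F (I ×ˢ closure Ω) (t, x) (0, bv i) := by
  have h1 := ((hF.differentiableOn (by simp)) (t, x) ⟨ht, hx⟩).hasFDerivWithinAt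
  have h2 : HasFDerivWithinAt (fun y : E d => (t, y))
      (ContinuousLinearMap.inr ℝ ℝ (E d)) (closure Ω) x :=
    (hasFDerivAt_prodMk_right t x).hasFDerivWithinAt
  have h3 := h1.comp x h2 (fun y hy => (⟨ht, hy⟩ : (t, y) ∈ I ×ˢ closure Ω))
  rw [pd]
  have h4 := h3.fderivWithin (hu x hx)
  simp only [Function.comp_def] at h4
  rw [h4]
  simp

lemma derivWithin_slice (hI : UniqueDiffOn ℝ I) (hF : ContDiffOn ℝ 1 F (I ×ˢ closure Ω))
    {t : ℝ} (ht : t ∈ I) {x : E d} (hx : x ∈ closure Ω) :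
    HasDerivWithinAt (fun s => F (s, x)) (fderivWithin ℝ F (I ×ˢ closure Ω) (t, x) (1, 0)) I t ∧
    derivWithin (fun s => F (s, x)) I t
      = fderivWithin ℝ F (I ×ˢ closure Ω) (t, x) (1, 0) := by
  have h1 := ((hF.differentiableOn (by simp)) (t, x) ⟨ht, hx⟩).hasFDerivWithinAt
  have h2 : HasFDerivWithinAt (fun s : ℝ => (s, x))
      (ContinuousLinearMap.inl ℝ ℝ (E d)) I t :=
    (hasFDerivAt_prodMk_left t x).hasFDerivWithinAt
  have h3 := (h1.comp t h2 (fun s hs => (⟨hs, hx⟩ : (s, x) ∈ I ×ˢ closure Ω))).hasDerivWithinAt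
  simp only [Function.comp_def] at h3
  have h5 : HasDerivWithinAt (fun s => F (s, x))
      (fderivWithin ℝ F (I ×ˢ closure Ω) (t, x) (1, 0)) I t := by simpa using h3
  exact ⟨h5, h5.derivWithin (hI t ht)⟩

/-- Spatial derivatives of a `C^{n+1}` function on a cylinder are jointly `C^n`. -/
lemma contDiffOn_pd_slice {n : ℕ} (hI : UniqueDiffOn ℝ I) (hu : UniqueDiffOn ℝ (closure Ω))
    (hF : ContDiffOn ℝ (n + 1) F (I ×ˢ closure Ω)) (i : Fin d) :
    ContDiffOn ℝ n (fun p : ℝ × E d => pd Ω i (fun y => F (p.1, y)) p.2) (I ×ˢ closure Ω) := by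
  have h : ContDiffOn ℝ n
      (fun p => fderivWithin ℝ F (I ×ˢ closure Ω) p (0, bv i)) (I ×ˢ closure Ω) :=
    (hF.fderivWithin (hI.prod hu) le_rfl).clm_apply contDiffOn_const
  refine h.congr fun p hp => ?_
  exact pd_slice hu (hF.of_le (by simp)) i hp.1 hp.2

lemma contDiffOn_derivWithin_slice {n : ℕ} (hI : UniqueDiffOn ℝ I)
    (hu : UniqueDiffOn ℝ (closure Ω)) (hF : ContDiffOn ℝ (n + 1) F (I ×ˢ closure Ω)) :
    ContDiffOn ℝ n (fun p : ℝ × E d => derivWithin (fun s => F (s, p.2)) I p.1)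
      (I ×ˢ closure Ω) := by
  have h : ContDiffOn ℝ n
      (fun p => fderivWithin ℝ F (I ×ˢ closure Ω) p ((1 : ℝ), (0 : E d))) (I ×ˢ closure Ω) :=
    (hF.fderivWithin (hI.prod hu) le_rfl).clm_apply contDiffOn_const
  refine h.congr fun p hp => ?_
  exact (derivWithin_slice hI (hF.of_le (by simp)) hp.1 hp.2).2

lemma uniqueDiffOn_Ico_zero (T : ℝ) : UniqueDiffOn ℝ (Ico 0 T) := uniqueDiffOn_Ico 0 T

lemma hasDerivAt_slice {T : ℝ} (hF : ContDiffOn ℝ 1 F (Ico 0 T ×ˢ closure Ω)) {t : ℝ}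
    (ht : t ∈ Ioo 0 T) {x : E d} (hx : x ∈ closure Ω) :
    HasDerivAt (fun s => F (s, x)) (derivWithin (fun s => F (s, x)) (Ico 0 T) t) t := by
  have h := derivWithin_slice (uniqueDiffOn_Ico_zero T) hF (Ioo_subset_Ico_self ht) hx
  rw [h.2]
  exact h.1.hasDerivAt (mem_of_superset (Ioo_mem_nhds ht.1 ht.2) Ioo_subset_Ico_self)

lemma hasDerivAt_integral_slice {T : ℝ} (hΩ : IsOpen Ω) (hb : Bornology.IsBounded Ω)
    (hu : UniqueDiffOn ℝ (closure Ω)) (hF : ContDiffOn ℝ 1 F (Ico 0 T ×ˢ closure Ω))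
    {G : E d → ℝ} (hG : IntegrableOn G Ω) {t : ℝ} (ht : t ∈ Ioo 0 T) :
    HasDerivAt (fun s => ∫ x in Ω, G x * F (s, x))
      (∫ x in Ω, G x * derivWithin (fun s => F (s, x)) (Ico 0 T) t) t := by
  obtain ⟨t₁, htt, ht₁⟩ := exists_between ht.2
  have hdc : ContinuousOn (fun p : ℝ × E d => derivWithin (fun s => F (s, p.2)) (Ico 0 T) p.1)
      (Ico 0 T ×ˢ closure Ω) :=
    (contDiffOn_derivWithin_slice (n := 0) (uniqueDiffOn_Ico_zero T) hu
      (by simpa using hF)).continuousOn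
  have hsub : Icc 0 t₁ ×ˢ closure Ω ⊆ Ico 0 T ×ˢ closure Ω :=
    prod_mono (fun s hs => ⟨hs.1, hs.2.trans_lt ht₁⟩) subset_rfl
  obtain ⟨B, hB⟩ := (isCompact_Icc.prod hb.isCompact_closure).exists_bound_of_continuousOn
    (hdc.mono hsub)
  have hm := hΩ.measurableSet
  have hint : ∀ s ∈ Ico 0 T, IntegrableOn (fun x => G x * F (s, x)) Ω := fun s hs =>
    integrableOn_mul_continuousOn hΩ hb hG (contDiffOn_slice hF hs).continuousOn
  refine (hasDerivAt_integral_of_dominated_loc_of_deriv_le (s := Ioo 0 t₁)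
    (F := fun s x => G x * F (s, x)) (μ := volume.restrict Ω)
    (bound := fun x => |G x| * B)
    (F' := fun s x => G x * derivWithin (fun s => F (s, x)) (Ico 0 T) s)
    (Ioo_mem_nhds ht.1 htt) ?_ (hint t (Ioo_subset_Ico_self ht)) ?_ ?_ ?_ ?_).2
  · filter_upwards [Ioo_mem_nhds ht.1 ht.2] with s hs
    exact (hint s (Ioo_subset_Ico_self hs)).aestronglyMeasurable
  · refine hG.aestronglyMeasurable.mul (aestronglyMeasurable_restrict_of_continuousOn hΩ ?_)
    exact hdc.comp (continuousOn_const.prodMk continuousOn_id)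
      fun x hx => ⟨Ioo_subset_Ico_self ht, hx⟩
  · refine (ae_restrict_iff' hm).2 (ae_of_all _ fun x hx s hs => ?_)
    rw [norm_mul, Real.norm_eq_abs]
    exact mul_le_mul_of_nonneg_left
      (hB (s, x) ⟨⟨hs.1.le, hs.2.le⟩, subset_closure hx⟩) (abs_nonneg _)
  · exact hG.abs.mul_const _
  · refine (ae_restrict_iff' hm).2 (ae_of_all _ fun x hx s hs => ?_)
    exact (hasDerivAt_slice hF ⟨hs.1, hs.2.trans ht₁⟩ (subset_closure hx)).const_mul _

lemma continuousOn_integral_slice {T : ℝ} (hΩ : IsOpen Ω) (hb : Bornology.IsBounded Ω)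
    (hF : ContinuousOn F (Ico 0 T ×ˢ closure Ω)) {G : E d → ℝ} (hG : IntegrableOn G Ω) :
    ContinuousOn (fun s => ∫ x in Ω, G x * F (s, x)) (Ico 0 T) := by
  intro t ht
  obtain ⟨t₁, htt, ht₁⟩ := exists_between ht.2
  have hsub : Icc 0 t₁ ×ˢ closure Ω ⊆ Ico 0 T ×ˢ closure Ω :=
    prod_mono (fun s hs => ⟨hs.1, hs.2.trans_lt ht₁⟩) subset_rfl
  obtain ⟨B, hB⟩ := (isCompact_Icc.prod hb.isCompact_closure).exists_bound_of_continuousOn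
    (hF.mono hsub)
  have hm := hΩ.measurableSet
  have hsl : ∀ s ∈ Ico 0 T, ContinuousOn (fun x => F (s, x)) (closure Ω) := fun s hs =>
    hF.comp (continuousOn_const.prodMk continuousOn_id) fun x hx => ⟨hs, hx⟩
  have hev : ∀ᶠ s in 𝓝[Ico 0 T] t, s ∈ Icc 0 t₁ := by
    filter_upwards [self_mem_nhdsWithin, mem_nhdsWithin_of_mem_nhds (Iio_mem_nhds htt)] with s h1 h2
    exact ⟨h1.1, le_of_lt h2⟩
  refine continuousWithinAt_of_dominated (bound := fun x => |G x| * B) ?_ ?_ (hG.abs.mul_const _) ?_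
  · filter_upwards [self_mem_nhdsWithin] with s hs
    exact (integrableOn_mul_continuousOn hΩ hb hG (hsl s hs)).aestronglyMeasurable
  · filter_upwards [hev] with s hs
    refine (ae_restrict_iff' hm).2 (ae_of_all _ fun x hx => ?_)
    rw [norm_mul, Real.norm_eq_abs]
    exact mul_le_mul_of_nonneg_left (hB (s, x) ⟨hs, subset_closure hx⟩) (abs_nonneg _)
  · refine (ae_restrict_iff' hm).2 (ae_of_all _ fun x hx => ?_)
    refine ContinuousWithinAt.mul continuousWithinAt_const ?_
    exact (hF.comp (continuousOn_id.prodMk continuousOn_const)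
      fun s hs => ⟨hs, subset_closure hx⟩) t ht

/-- A continuous function on `[0, T)` that vanishes on `(0, T)` vanishes. -/
lemma eq_zero_of_continuousOn_Ico {T : ℝ} {f : ℝ → ℝ} (hf : ContinuousOn f (Ico 0 T))
    (h : ∀ t ∈ Ioo 0 T, f t = 0) {t : ℝ} (ht : t ∈ Ico 0 T) : f t = 0 := by
  rcases ht.1.eq_or_lt with h0 | h0
  · have hT : 0 < T := ht.1.trans_lt ht.2
    have l1 : Tendsto f (𝓝[Ioo 0 T] t) (𝓝 (f t)) := (hf t ht).mono Ioo_subset_Ico_self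
    have l2 : Tendsto f (𝓝[Ioo 0 T] t) (𝓝 0) :=
      tendsto_const_nhds.congr' (by
        filter_upwards [self_mem_nhdsWithin] with s hs using (h s hs).symm)
    have : (𝓝[Ioo 0 T] t).NeBot := by
      rw [← mem_closure_iff_nhdsWithin_neBot, closure_Ioo hT.ne, ← h0]
      exact ⟨le_rfl, hT.le⟩
    exact tendsto_nhds_unique l1 l2
  · exact h t ⟨h0, ht.2⟩

end Calculus

/-! ### Identities for the strong solution -/

/-- The time derivative along `[0, T)`, one-sided at `0`. -/
def tderiv (T : ℝ) (f : ℝ → E d → ℝ) (t : ℝ) (x : E d) : ℝ :=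
  derivWithin (fun s => f s x) (Ico 0 T) t

namespace IsStrongSolution

variable {T γ : ℝ} {Ω : Set (E d)} {r : ℝ → E d → ℝ} {U : ℝ → E d → E d} {Φ : ℝ → E d → ℝ}
  {g : E d → ℝ}

lemma contDiffOn_U (hs : IsStrongSolution T γ Ω r U Φ) (i : Fin d) :
    ContDiffOn ℝ 1 (fun p : ℝ × E d => U p.1 p.2 i) (Ico 0 T ×ˢ closure Ω) :=
  contDiffOn_euclidean.1 hs.U_C1 i

lemma contDiffOn_U_slice (hs : IsStrongSolution T γ Ω r U Φ) (i : Fin d) {t : ℝ}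
    (ht : t ∈ Ico 0 T) : ContDiffOn ℝ 1 (fun x => U t x i) (closure Ω) :=
  contDiffOn_slice (hs.contDiffOn_U i) ht

lemma contDiffOn_r_slice (hs : IsStrongSolution T γ Ω r U Φ) {t : ℝ}
    (ht : t ∈ Ico 0 T) : ContDiffOn ℝ 1 (r t) (closure Ω) :=
  contDiffOn_slice hs.r_C1 ht

lemma contDiffOn_grad (hg : IsDefiningFunction g Ω) (hs : IsStrongSolution T γ Ω r U Φ)
    (i : Fin d) :
    ContDiffOn ℝ 1 (fun p : ℝ × E d => pd Ω i (Φ p.1) p.2) (Ico 0 T ×ˢ closure Ω) := by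
  have h := contDiffOn_pd_slice (n := 1) (F := fun p : ℝ × E d => Φ p.1 p.2)
    (uniqueDiffOn_Ico_zero T) hg.uniqueDiffOn_closure
    (by simpa [one_add_one_eq_two] using hs.Φ_C2) i
  rwa [Nat.cast_one] at h

lemma contDiffOn_grad_slice (hg : IsDefiningFunction g Ω) (hs : IsStrongSolution T γ Ω r U Φ)
    (i : Fin d) {t : ℝ} (ht : t ∈ Ico 0 T) :
    ContDiffOn ℝ 1 (fun x => pd Ω i (Φ t) x) (closure Ω) :=
  contDiffOn_slice (hs.contDiffOn_grad hg i) ht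

lemma contDiffOn_tderiv_potential (hg : IsDefiningFunction g Ω)
    (hs : IsStrongSolution T γ Ω r U Φ) :
    ContDiffOn ℝ 1 (fun p : ℝ × E d => tderiv T Φ p.1 p.2) (Ico 0 T ×ˢ closure Ω) := by
  have h := contDiffOn_derivWithin_slice (n := 1) (F := fun p : ℝ × E d => Φ p.1 p.2)
    (uniqueDiffOn_Ico_zero T) hg.uniqueDiffOn_closure
    (by simpa [one_add_one_eq_two] using hs.Φ_C2)
  rwa [Nat.cast_one] at h

lemma contDiffOn_tderiv_potential_slice (hg : IsDefiningFunction g Ω)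
    (hs : IsStrongSolution T γ Ω r U Φ) {t : ℝ} (ht : t ∈ Ico 0 T) :
    ContDiffOn ℝ 1 (fun x => tderiv T Φ t x) (closure Ω) :=
  contDiffOn_slice (hs.contDiffOn_tderiv_potential hg) ht

lemma contDiffOn_potential_slice (hs : IsStrongSolution T γ Ω r U Φ) {t : ℝ}
    (ht : t ∈ Ico 0 T) : ContDiffOn ℝ 2 (Φ t) (closure Ω) :=
  contDiffOn_slice hs.Φ_C2 ht

lemma continuity' (hs : IsStrongSolution T γ Ω r U Φ) {t : ℝ} (ht : t ∈ Ioo 0 T) {x : E d}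
    (hx : x ∈ Ω) :
    tderiv T r t x + ∑ j, pd Ω j (fun y => r t y * U t y j) x = 0 := by
  have h := hs.continuity t ht x hx
  rwa [(hasDerivAt_slice hs.r_C1 ht (subset_closure hx)).deriv] at h

/-- The momentum equation in non-conservative form. -/
lemma velocity_eq (hΩ : IsOpen Ω) (hs : IsStrongSolution T γ Ω r U Φ) {t : ℝ}
    (ht : t ∈ Ioo 0 T) {x : E d} (hx : x ∈ Ω) (i : Fin d) :
    tderiv T (fun s y => U s y i) t x + ∑ j, U t x j * pd Ω j (fun y => U t y i) x
      = - γ * U t x i - pd Ω i (Φ t) x - x i := by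
  have ht' := Ioo_subset_Ico_self ht
  have h := hs.momentum t ht x hx i
  have hc := hs.continuity' ht hx
  have hr := hasDerivAt_slice hs.r_C1 ht (subset_closure hx)
  have hU := hasDerivAt_slice (hs.contDiffOn_U i) ht (subset_closure hx)
  have hd : deriv (fun s => r s x * U s x i) t
      = tderiv T r t x * U t x i + r t x * tderiv T (fun s y => U s y i) t x :=
    (hr.mul hU).deriv
  have hpd : ∀ j, pd Ω j (fun y => r t y * U t y i * U t y j) x
      = U t x i * pd Ω j (fun y => r t y * U t y j) x
        + pd Ω j (fun y => U t y i) x * (r t x * U t x j) := by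
    intro j
    have : (fun y => r t y * U t y i * U t y j) = fun y => U t y i * (r t y * U t y j) := by
      funext y; ring
    rw [this, pd_mul hΩ (hs.contDiffOn_U_slice i ht')
      ((hs.contDiffOn_r_slice ht').mul (hs.contDiffOn_U_slice j ht')) j hx]
  simp_rw [hpd] at h
  rw [hd, Finset.sum_add_distrib, ← Finset.mul_sum] at h
  have hsum : ∑ j, pd Ω j (fun y => U t y i) x * (r t x * U t x j)
      = r t x * ∑ j, U t x j * pd Ω j (fun y => U t y i) x := by
    rw [Finset.mul_sum]; exact Finset.sum_congr rfl fun j _ => by ring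
  rw [hsum] at h
  have hpos := hs.r_pos t ht' x (subset_closure hx)
  refine mul_left_cancel₀ hpos.ne' ?_
  linear_combination h - U t x i * hc

lemma tangential_U (hs : IsStrongSolution T γ Ω r U Φ) {t : ℝ}
    (ht : t ∈ Ico 0 T) : IsTangential Ω (U t) := by
  intro x n hn
  have hx : x ∈ closure Ω := frontier_subset_closure hn.1
  refine eq_zero_of_continuousOn_Ico (f := fun s => inner ℝ (U s x) n) ?_
    (fun s hs' => hs.impermeable s hs' x n hn) ht
  have : ContinuousOn (fun s => U s x) (Ico 0 T) := hs.U_C1.continuousOn.comp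
    (continuousOn_id.prodMk continuousOn_const) fun s hs => ⟨hs, hx⟩
  exact this.inner continuousOn_const

lemma tangential_grad (hg : IsDefiningFunction g Ω) (hs : IsStrongSolution T γ Ω r U Φ) {t : ℝ}
    (ht : t ∈ Ico 0 T) : IsTangential Ω (grad Ω (Φ t)) := by
  intro x n hn
  have hx : x ∈ closure Ω := frontier_subset_closure hn.1
  refine eq_zero_of_continuousOn_Ico (f := fun s => inner ℝ (grad Ω (Φ s) x) n) ?_
    (fun s hs' => hs.neumann s hs' x n hn) ht
  simp only [PiLp.inner_apply]
  refine continuousOn_finsetSum _ fun i _ => ?_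
  have h1 : ContinuousOn (fun s => pd Ω i (Φ s) x) (Ico 0 T) :=
    (hs.contDiffOn_grad hg i).continuousOn.comp
      (continuousOn_id.prodMk continuousOn_const) fun s hs => ⟨hs, hx⟩
  exact h1.inner continuousOn_const

lemma sum_U_mul_normal (hg : IsDefiningFunction g Ω) (hs : IsStrongSolution T γ Ω r U Φ) {t : ℝ}
    (ht : t ∈ Ico 0 T) {x : E d} (hx : x ∈ frontier Ω) :
    ∑ i, U t x i * fderiv ℝ g x (bv i) = 0 :=
  (hs.tangential_U ht).sum_mul_fderiv_eq_zero hg hx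

lemma sum_grad_mul_normal (hg : IsDefiningFunction g Ω) (hs : IsStrongSolution T γ Ω r U Φ)
    {t : ℝ} (ht : t ∈ Ico 0 T) {x : E d} (hx : x ∈ frontier Ω) :
    ∑ i, pd Ω i (Φ t) x * fderiv ℝ g x (bv i) = 0 :=
  (hs.tangential_grad hg ht).sum_mul_fderiv_eq_zero hg hx

end IsStrongSolution

lemma isFiniteMeasure_restrict {Ω : Set (E d)} (hb : Bornology.IsBounded Ω) :
    IsFiniteMeasure (volume.restrict Ω) := ⟨by
  rw [Measure.restrict_apply_univ]; exact hb.measure_lt_top⟩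

lemma integrableOn_one {Ω : Set (E d)} (hb : Bornology.IsBounded Ω) :
    IntegrableOn (fun _ : E d => (1 : ℝ)) Ω :=
  haveI := isFiniteMeasure_restrict hb
  integrable_const _

lemma integrableOn_of_continuousOn_closure {Ω : Set (E d)} (hΩ : IsOpen Ω)
    (hb : Bornology.IsBounded Ω) {v : E d → ℝ} (hv : ContinuousOn v (closure Ω)) :
    IntegrableOn v Ω := by
  simpa using integrableOn_mul_continuousOn hΩ hb (integrableOn_one hb) hv

/-- The divergence theorem for `C¹` fields that are tangential on the boundary. -/
lemma integral_div_eq_zero {g : E d → ℝ} {Ω : Set (E d)}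
    (hg : IsDefiningFunction g Ω) (hb : Bornology.IsBounded Ω) {V : Fin d → E d → ℝ}
    (hV : ∀ i, ContDiffOn ℝ 1 (V i) (closure Ω))
    (hV0 : ∀ x ∈ frontier Ω, ∑ i, V i x * fderiv ℝ g x (bv i) = 0) :
    ∫ x in Ω, ∑ i, pd Ω i (V i) x = 0 := by
  have h := (hasWeakGradient_of_contDiffOn hg.isOpen hb hg.uniqueDiffOn_closure
    (θ := fun _ => (1 : ℝ)) contDiffOn_const).integral_mul_tangential hg hb hV hV0
  have hz : ∀ i, ∫ x in Ω, pd Ω i (fun _ => (1 : ℝ)) x * V i x = 0 := fun i => by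
    have : ∀ x, pd Ω i (fun _ => (1 : ℝ)) x = 0 := fun x => by simp [pd]
    simp [this]
  simp only [hz, Finset.sum_const_zero, one_mul] at h
  linarith

namespace IsStrongSolution

variable {T γ : ℝ} {Ω : Set (E d)} {r : ℝ → E d → ℝ} {U : ℝ → E d → E d} {Φ : ℝ → E d → ℝ}
  {g : E d → ℝ}

/-- Conservation of mass for the strong solution. -/
lemma average_eq (hg : IsDefiningFunction g Ω) (hb : Bornology.IsBounded Ω)
    (hs : IsStrongSolution T γ Ω r U Φ) {t : ℝ} (ht : t ∈ Ico 0 T) :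
    average Ω (r t) = average Ω (r 0) := by
  have hΩ := hg.isOpen
  have hT : 0 < T := ht.1.trans_lt ht.2
  have hone := integrableOn_one hb
  have hcont := continuousOn_integral_slice hΩ hb hs.r_C1.continuousOn hone
  have hder : ∀ s ∈ Ioo 0 T, HasDerivAt (fun s => ∫ x in Ω, (1 : ℝ) * r s x) 0 s := by
    intro s hs'
    have h := hasDerivAt_integral_slice hΩ hb hg.uniqueDiffOn_closure hs.r_C1 hone hs'
    have hs'' := Ioo_subset_Ico_self hs'
    convert h using 1
    have e : ∫ x in Ω, (1 : ℝ) * derivWithin (fun s => r s x) (Ico 0 T) s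
        = ∫ x in Ω, -∑ j, pd Ω j (fun y => r s y * U s y j) x :=
      setIntegral_congr_fun hΩ.measurableSet fun x hx => by
        have := hs.continuity' hs' hx
        rw [tderiv] at this
        simp only; linarith
    refine Eq.symm (e.trans ?_)
    rw [integral_neg, integral_div_eq_zero hg hb, neg_zero]
    · exact fun i => (hs.contDiffOn_r_slice hs'').mul (hs.contDiffOn_U_slice i hs'')
    · intro x hx
      have := hs.sum_U_mul_normal hg hs'' hx
      simp_rw [mul_assoc]
      rw [← Finset.mul_sum, this, mul_zero]
  have hconst : ∫ x in Ω, (1 : ℝ) * r t x = ∫ x in Ω, (1 : ℝ) * r 0 x := by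
    have := intervalIntegral.integral_eq_sub_of_hasDerivAt_of_le ht.1
      (hcont.mono fun s hs' => ⟨hs'.1, hs'.2.trans_lt ht.2⟩)
      (fun s hs' => hder s ⟨hs'.1, hs'.2.trans ht.2⟩) (by simp)
    simp only [intervalIntegral.integral_zero] at this
    linarith
  simp only [one_mul] at hconst
  rw [average, average, hconst]

lemma poisson' (hg : IsDefiningFunction g Ω) (hb : Bornology.IsBounded Ω)
    (hs : IsStrongSolution T γ Ω r U Φ) {t : ℝ} (ht : t ∈ Ico 0 T) {x : E d} (hx : x ∈ Ω) :
    ∑ j, pd Ω j (fun y => pd Ω j (Φ t) y) x = average Ω (r 0) - r t x := by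
  have hxK := subset_closure hx
  have h0 : ∀ {f : ℝ × E d → ℝ}, ContinuousOn f (Ico 0 T ×ˢ closure Ω) →
      ContinuousOn (fun s => f (s, x)) (Ico 0 T) := fun hf =>
    hf.comp (continuousOn_id.prodMk continuousOn_const) fun s hs => ⟨hs, hxK⟩
  have hcont : ContinuousOn (fun s => ∑ j, pd Ω j (fun y => pd Ω j (Φ s) y) x
      - (average Ω (r 0) - r s x)) (Ico 0 T) := by
    refine ContinuousOn.sub (continuousOn_finsetSum _ fun j _ => ?_)
      (continuousOn_const.sub (h0 hs.r_C1.continuousOn))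
    exact h0 (contDiffOn_pd_slice (n := 0) (uniqueDiffOn_Ico_zero T) hg.uniqueDiffOn_closure
      (by simpa using hs.contDiffOn_grad hg j) j).continuousOn
  have h := eq_zero_of_continuousOn_Ico hcont (fun s hs' => by
    have h1 := hs.poisson s hs' x hx
    rw [hs.average_eq hg hb (Ioo_subset_Ico_self hs')] at h1
    linarith) ht
  linarith

/-- The weak form of the Poisson equation of the strong solution. -/
lemma integral_grad_mul (hg : IsDefiningFunction g Ω) (hb : Bornology.IsBounded Ω)
    (hs : IsStrongSolution T γ Ω r U Φ) {t : ℝ} (ht : t ∈ Ico 0 T) {Ψ : E d → ℝ}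
    {f : Fin d → E d → ℝ} (h : HasWeakGradient Ω Ψ f) :
    ∑ i, ∫ x in Ω, f i x * pd Ω i (Φ t) x
      = ∫ x in Ω, Ψ x * (r t x - average Ω (r 0)) := by
  rw [h.integral_mul_tangential hg hb (fun i => hs.contDiffOn_grad_slice hg i ht)
    (fun x hx => hs.sum_grad_mul_normal hg ht hx), ← integral_neg]
  refine setIntegral_congr_fun hg.isOpen.measurableSet fun x hx => ?_
  simp only [hs.poisson' hg hb ht hx]
  ring

/-- Second derivatives of the potential commute. -/
lemma pd_grad_comm (hg : IsDefiningFunction g Ω) (hs : IsStrongSolution T γ Ω r U Φ) {t : ℝ}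
    (ht : t ∈ Ico 0 T) {x : E d} (hx : x ∈ Ω) (i j : Fin d) :
    pd Ω i (fun y => pd Ω j (Φ t) y) x = pd Ω j (fun y => pd Ω i (Φ t) y) x := by
  have hΩ := hg.isOpen
  have hC : ContDiffAt ℝ 2 (Φ t) x :=
    ((hs.contDiffOn_potential_slice ht).mono subset_closure).contDiffAt (hΩ.mem_nhds hx)
  have hd : DifferentiableAt ℝ (fderiv ℝ (Φ t)) x :=
    (hC.fderiv_right (m := 1) (by simp [one_add_one_eq_two])).differentiableAt (by simp)
  have key : ∀ i j, pd Ω i (fun y => pd Ω j (Φ t) y) x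
      = fderiv ℝ (fderiv ℝ (Φ t)) x (bv i) (bv j) := by
    intro i j
    have e : (fun y => pd Ω j (Φ t) y) =ᶠ[𝓝 x] fun y => fderiv ℝ (Φ t) y (bv j) := by
      filter_upwards [hΩ.mem_nhds hx] with y hy using pd_eq_fderiv hΩ j _ hy
    rw [pd_eq_fderiv hΩ _ _ hx, e.fderiv_eq, fderiv_clm_apply hd (differentiableAt_const _)]
    simp
  rw [key, key]
  exact (hC.isSymmSndFDerivAt (by simp)).eq _ _

/-- Time and space derivatives of the potential commute. -/
lemma tderiv_grad_eq (hg : IsDefiningFunction g Ω) (hs : IsStrongSolution T γ Ω r U Φ) {t : ℝ}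
    (ht : t ∈ Ioo 0 T) {x : E d} (hx : x ∈ Ω) (i : Fin d) :
    tderiv T (fun s y => pd Ω i (Φ s) y) t x = pd Ω i (fun y => tderiv T Φ t y) x := by
  have hΩ := hg.isOpen
  let G : ℝ × E d → ℝ := fun p => Φ p.1 p.2
  have hO : IsOpen (Ioo 0 T ×ˢ Ω) := isOpen_Ioo.prod hΩ
  have hsub : Ioo 0 T ×ˢ Ω ⊆ Ico 0 T ×ˢ closure Ω :=
    prod_mono Ioo_subset_Ico_self subset_closure
  have hC : ∀ p ∈ Ioo 0 T ×ˢ Ω, ContDiffAt ℝ 2 G p := fun p hp =>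
    (hs.Φ_C2.mono hsub).contDiffAt (hO.mem_nhds hp)
  have hp : (t, x) ∈ Ioo 0 T ×ˢ Ω := ⟨ht, hx⟩
  have hd : HasFDerivAt (fderiv ℝ G) (fderiv ℝ (fderiv ℝ G) (t, x)) (t, x) :=
    (((hC _ hp).fderiv_right (m := 1) (by simp [one_add_one_eq_two])).differentiableAt
      (by simp)).hasFDerivAt
  have hG1 : ∀ p ∈ Ioo 0 T ×ˢ Ω, HasFDerivAt G (fderiv ℝ G p) p := fun p hp =>
    ((hC p hp).differentiableAt (by simp)).hasFDerivAt
  have e1 : ∀ p ∈ Ioo 0 T ×ˢ Ω, pd Ω i (Φ p.1) p.2 = fderiv ℝ G p (0, bv i) := by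
    intro p hp
    have h2 : HasFDerivAt (fun y : E d => (p.1, y)) (ContinuousLinearMap.inr ℝ ℝ (E d)) p.2 :=
      hasFDerivAt_prodMk_right p.1 p.2
    have h3 := (hG1 p hp).comp p.2 h2
    rw [pd_eq_fderiv hΩ _ _ hp.2]
    have h4 : Φ p.1 = G ∘ fun y => (p.1, y) := rfl
    rw [h4, h3.fderiv]; simp
  have e2 : ∀ p ∈ Ioo 0 T ×ˢ Ω, tderiv T Φ p.1 p.2 = fderiv ℝ G p (1, 0) := by
    intro p hp
    have h2 : HasFDerivAt (fun s : ℝ => (s, p.2)) (ContinuousLinearMap.inl ℝ ℝ (E d)) p.1 :=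
      hasFDerivAt_prodMk_left p.1 p.2
    have h3 := ((hG1 p hp).comp p.1 h2).hasDerivAt.hasDerivWithinAt (s := Ico 0 T)
    have h4 := h3.derivWithin (uniqueDiffOn_Ico_zero T _ (Ioo_subset_Ico_self hp.1))
    simpa [tderiv, Function.comp_def, G] using h4
  have hx1 : ∀ᶠ s in 𝓝 t, (s, x) ∈ Ioo 0 T ×ˢ Ω := by
    filter_upwards [Ioo_mem_nhds ht.1 ht.2] with s hs using ⟨hs, hx⟩
  have hx2 : ∀ᶠ y in 𝓝 x, (t, y) ∈ Ioo 0 T ×ˢ Ω := by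
    filter_upwards [hΩ.mem_nhds hx] with y hy using ⟨ht, hy⟩
  have L : tderiv T (fun s y => pd Ω i (Φ s) y) t x
      = fderiv ℝ (fderiv ℝ G) (t, x) (1, 0) (0, bv i) := by
    have h2 : HasFDerivAt (fun s : ℝ => (s, x)) (ContinuousLinearMap.inl ℝ ℝ (E d)) t :=
      hasFDerivAt_prodMk_left t x
    have h3 := ((hd.comp t h2).clm_apply (hasFDerivAt_const ((0 : ℝ), bv i) t)).hasDerivAt
    have h4 : HasDerivAt (fun s => pd Ω i (Φ s) x) _ t := h3.congr_of_eventuallyEq (by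
      filter_upwards [hx1] with s hs using e1 _ hs)
    have h5 := h4.hasDerivWithinAt.derivWithin
      (uniqueDiffOn_Ico_zero T _ (Ioo_subset_Ico_self ht))
    rw [tderiv, h5]
    simp
  have R : pd Ω i (fun y => tderiv T Φ t y) x
      = fderiv ℝ (fderiv ℝ G) (t, x) (0, bv i) (1, 0) := by
    have h2 : HasFDerivAt (fun y : E d => (t, y)) (ContinuousLinearMap.inr ℝ ℝ (E d)) x :=
      hasFDerivAt_prodMk_right t x
    have h3 := (hd.comp x h2).clm_apply (hasFDerivAt_const ((1 : ℝ), (0 : E d)) x)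
    have h4 : HasFDerivAt (fun y => tderiv T Φ t y) _ x := h3.congr_of_eventuallyEq (by
      filter_upwards [hx2] with s hs using e2 _ hs)
    rw [pd_eq_fderiv hΩ _ _ hx, h4.fderiv]
    simp
  rw [L, R]
  exact ((hC _ hp).isSymmSndFDerivAt (by simp)).eq _ _

end IsStrongSolution

/-! ### A divergence-free field and the quadratic identity -/

/-- The field `W = -∂ₜ∇Φ - ∇(U · ∇Φ) + M U + (∇Φ · ∇) U + (∇U)ᵀ ∇Φ - ∇Φ div U`, where `M` is the
mean density. It is divergence-free and tangential. -/
def elField (T : ℝ) (Ω : Set (E d)) (M : ℝ) (U : ℝ → E d → E d) (Φ : ℝ → E d → ℝ) (t : ℝ)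
    (i : Fin d) (x : E d) : ℝ :=
  - pd Ω i (fun y => tderiv T Φ t y + ∑ k, U t y k * pd Ω k (Φ t) y) x + M * U t x i
    + (∑ k, pd Ω k (Φ t) x * pd Ω k (fun y => U t y i) x)
    + (∑ k, pd Ω k (Φ t) x * pd Ω i (fun y => U t y k) x)
    - pd Ω i (Φ t) x * ∑ k, pd Ω k (fun y => U t y k) x

namespace IsStrongSolution

variable {T γ : ℝ} {Ω : Set (E d)} {r : ℝ → E d → ℝ} {U : ℝ → E d → E d} {Φ : ℝ → E d → ℝ}
  {g : E d → ℝ}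

lemma pd_tderiv_add (hg : IsDefiningFunction g Ω)
    (hs : IsStrongSolution T γ Ω r U Φ) {t : ℝ} (ht : t ∈ Ioo 0 T) {x : E d} (hx : x ∈ Ω)
    (i : Fin d) :
    pd Ω i (fun y => tderiv T Φ t y + ∑ k, U t y k * pd Ω k (Φ t) y) x
      = tderiv T (fun s y => pd Ω i (Φ s) y) t x
        + ∑ k, (U t x k * pd Ω k (fun y => pd Ω i (Φ t) y) x
          + pd Ω k (Φ t) x * pd Ω i (fun y => U t y k) x) := by
  have hΩ := hg.isOpen
  have ht' := Ioo_subset_Ico_self ht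
  have hmul : ∀ k, ContDiffOn ℝ 1 (fun y => U t y k * pd Ω k (Φ t) y) (closure Ω) := fun k =>
    (hs.contDiffOn_U_slice k ht').mul (hs.contDiffOn_grad_slice hg k ht')
  rw [pd_add hΩ (hs.contDiffOn_tderiv_potential_slice hg ht') (ContDiffOn.sum fun k _ => hmul k)
    i hx, pd_sum hΩ hmul i hx, hs.tderiv_grad_eq hg ht hx]
  congr 1
  refine Finset.sum_congr rfl fun k _ => ?_
  rw [pd_mul hΩ (hs.contDiffOn_U_slice k ht') (hs.contDiffOn_grad_slice hg k ht') i hx,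
    hs.pd_grad_comm hg ht' hx]
  ring

lemma continuousOn_tderiv_grad_slice (hg : IsDefiningFunction g Ω)
    (hs : IsStrongSolution T γ Ω r U Φ) (i : Fin d) {t : ℝ} (ht : t ∈ Ico 0 T) :
    ContinuousOn (fun x => tderiv T (fun s y => pd Ω i (Φ s) y) t x) (closure Ω) := by
  have h := contDiffOn_derivWithin_slice (n := 0) (uniqueDiffOn_Ico_zero T)
    hg.uniqueDiffOn_closure (by simpa using hs.contDiffOn_grad hg i)
  exact (contDiffOn_slice h ht).continuousOn

/-- The time derivative of `∫ f · ∇Φ`, computed by means of the Poisson and of the continuity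
equation. -/
lemma integral_mul_tderiv_grad (hg : IsDefiningFunction g Ω) (hb : Bornology.IsBounded Ω)
    (hs : IsStrongSolution T γ Ω r U Φ) {t : ℝ} (ht : t ∈ Ioo 0 T) {Ψ : E d → ℝ}
    {f : Fin d → E d → ℝ} (h : HasWeakGradient Ω Ψ f) :
    ∑ i, ∫ x in Ω, f i x * tderiv T (fun s y => pd Ω i (Φ s) y) t x
      = ∑ i, ∫ x in Ω, f i x * (r t x * U t x i) := by
  have hΩ := hg.isOpen
  have ht' := Ioo_subset_Ico_self ht
  have d1 : HasDerivAt (fun s => ∑ i, ∫ x in Ω, f i x * pd Ω i (Φ s) x)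
      (∑ i, ∫ x in Ω, f i x * tderiv T (fun s y => pd Ω i (Φ s) y) t x) t :=
    HasDerivAt.fun_sum fun i _ => hasDerivAt_integral_slice hΩ hb hg.uniqueDiffOn_closure
      (hs.contDiffOn_grad hg i) (h.integrable_grad i) ht
  have hrC : ContDiffOn ℝ 1 (fun p : ℝ × E d => r p.1 p.2 - average Ω (r 0))
      (Ico 0 T ×ˢ closure Ω) := hs.r_C1.sub contDiffOn_const
  -- the same function of time is `∫ Ψ (r - M)`, by the Poisson equation
  have d2 := hasDerivAt_integral_slice hΩ hb hg.uniqueDiffOn_closure hrC h.integrable ht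
  have d3 : HasDerivAt (fun s => ∑ i, ∫ x in Ω, f i x * pd Ω i (Φ s) x) _ t :=
    d2.congr_of_eventuallyEq (by
      filter_upwards [Ioo_mem_nhds ht.1 ht.2] with s hs'
      exact hs.integral_grad_mul hg hb (Ioo_subset_Ico_self hs') h)
  rw [d1.unique d3, h.integral_mul_tangential hg hb
    (fun i => (hs.contDiffOn_r_slice ht').mul (hs.contDiffOn_U_slice i ht')), ← integral_neg]
  · refine setIntegral_congr_fun hΩ.measurableSet fun x hx => ?_
    have h1 := hs.continuity' ht hx
    have h2 : derivWithin (fun s => r s x - average Ω (r 0)) (Ico 0 T) t = tderiv T r t x := by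
      rw [tderiv, derivWithin_sub_const]
    simp only [h2]
    linear_combination Ψ x * h1
  · intro x hx
    have := hs.sum_U_mul_normal hg ht' hx
    simp_rw [mul_assoc]
    rw [← Finset.mul_sum, this, mul_zero]

/-- Weak gradients are orthogonal to `elField`: it is the sum of `r U - ∂ₜ∇Φ` and of the
divergence of the antisymmetric matrix `U ⊗ ∇Φ - ∇Φ ⊗ U`. -/
lemma integral_mul_elField (hg : IsDefiningFunction g Ω) (hb : Bornology.IsBounded Ω)
    (hs : IsStrongSolution T γ Ω r U Φ) {t : ℝ} (ht : t ∈ Ioo 0 T) {Ψ : E d → ℝ}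
    {f : Fin d → E d → ℝ} (h : HasWeakGradient Ω Ψ f) :
    ∑ i, ∫ x in Ω, f i x * elField T Ω (average Ω (r 0)) U Φ t i x = 0 := by
  have hΩ := hg.isOpen
  have ht' := Ioo_subset_Ico_self ht
  have hu := hg.uniqueDiffOn_closure
  have hUφ : ∀ i j, ContDiffOn ℝ 1 (fun y => U t y i * pd Ω j (Φ t) y) (closure Ω) := fun i j =>
    (hs.contDiffOn_U_slice i ht').mul (hs.contDiffOn_grad_slice hg j ht')
  let A : Fin d → Fin d → E d → ℝ := fun i j y =>
    U t y i * pd Ω j (Φ t) y - U t y j * pd Ω i (Φ t) y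
  have hA : ∀ i j, ContDiffOn ℝ 1 (A i j) (closure Ω) := fun i j => (hUφ i j).sub (hUφ j i)
  have h1 := h.integral_mul_div_antisymm hg hb hA (fun i j x => by simp only [A]; ring) (by
    intro x hx i
    have e1 := hs.sum_U_mul_normal hg ht' hx
    have e2 := hs.sum_grad_mul_normal hg ht' hx
    calc ∑ j, A i j x * fderiv ℝ g x (bv j)
        = U t x i * ∑ j, pd Ω j (Φ t) x * fderiv ℝ g x (bv j)
          - pd Ω i (Φ t) x * ∑ j, U t x j * fderiv ℝ g x (bv j) := by
          rw [Finset.mul_sum, Finset.mul_sum, ← Finset.sum_sub_distrib]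
          exact Finset.sum_congr rfl fun j _ => by simp only [A]; ring
      _ = 0 := by rw [e1, e2]; ring)
  have h2 := hs.integral_mul_tderiv_grad hg hb ht h
  have hcA : ∀ i, ContinuousOn (fun x => ∑ j, pd Ω j (A i j) x) (closure Ω) := fun i =>
    continuousOn_finsetSum _ fun j _ => continuousOn_pd hu (hA i j) j
  have hcr : ∀ i, ContinuousOn (fun x => r t x * U t x i) (closure Ω) := fun i =>
    ((hs.contDiffOn_r_slice ht').mul (hs.contDiffOn_U_slice i ht')).continuousOn
  have hct := fun i => hs.continuousOn_tderiv_grad_slice hg i ht'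
  have key : ∀ i, ∫ x in Ω, f i x * elField T Ω (average Ω (r 0)) U Φ t i x
      = (∫ x in Ω, f i x * ∑ j, pd Ω j (A i j) x)
        + ((∫ x in Ω, f i x * (r t x * U t x i))
          - ∫ x in Ω, f i x * tderiv T (fun s y => pd Ω i (Φ s) y) t x) := by
    intro i
    have ir := integrableOn_mul_continuousOn hΩ hb (h.integrable_grad i) (hcr i)
    have it := integrableOn_mul_continuousOn hΩ hb (h.integrable_grad i) (hct i)
    have irt : IntegrableOn (fun x => f i x * (r t x * U t x i)
        - f i x * tderiv T (fun s y => pd Ω i (Φ s) y) t x) Ω := ir.sub it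
    rw [← integral_sub ir it, ← integral_add
      (integrableOn_mul_continuousOn hΩ hb (h.integrable_grad i) (hcA i)) irt]
    refine setIntegral_congr_fun hΩ.measurableSet fun x hx => ?_
    have eA : ∑ j, pd Ω j (A i j) x
        = (∑ k, pd Ω k (Φ t) x * pd Ω k (fun y => U t y i) x)
          + U t x i * (∑ j, pd Ω j (fun y => pd Ω j (Φ t) y) x)
          - (∑ k, U t x k * pd Ω k (fun y => pd Ω i (Φ t) y) x)
          - pd Ω i (Φ t) x * ∑ k, pd Ω k (fun y => U t y k) x := by
      rw [Finset.mul_sum, Finset.mul_sum, ← Finset.sum_add_distrib, ← Finset.sum_sub_distrib,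
        ← Finset.sum_sub_distrib]
      refine Finset.sum_congr rfl fun j _ => ?_
      rw [pd_sub hΩ (hUφ i j) (hUφ j i) j hx,
        pd_mul hΩ (hs.contDiffOn_U_slice i ht') (hs.contDiffOn_grad_slice hg j ht') j hx,
        pd_mul hΩ (hs.contDiffOn_U_slice j ht') (hs.contDiffOn_grad_slice hg i ht') j hx]
      ring
    simp only [elField]
    rw [eA, hs.pd_tderiv_add hg ht hx i, hs.poisson' hg hb ht' hx, Finset.sum_add_distrib]
    ring
  simp_rw [key]
  rw [Finset.sum_add_distrib, Finset.sum_sub_distrib, h1, h2]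
  ring

/-- The part of the energy identity that is quadratic in `∇Φ`. -/
lemma integral_quadratic_eq_zero (hg : IsDefiningFunction g Ω) (hb : Bornology.IsBounded Ω)
    (hs : IsStrongSolution T γ Ω r U Φ) {t : ℝ} (ht : t ∈ Ioo 0 T) :
    ∫ x in Ω, (- average Ω (r 0) * (∑ i, U t x i * pd Ω i (Φ t) x)
      + (∑ i, pd Ω i (Φ t) x * tderiv T (fun s y => pd Ω i (Φ s) y) t x)
      - (∑ i, ∑ j, pd Ω i (Φ t) x * pd Ω j (Φ t) x * pd Ω j (fun y => U t y i) x)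
      + (1 / 2) * (∑ k, pd Ω k (Φ t) x ^ 2) * ∑ i, pd Ω i (fun y => U t y i) x) = 0 := by
  have hΩ := hg.isOpen
  have ht' := Ioo_subset_Ico_self ht
  have hu := hg.uniqueDiffOn_closure
  have hUC := fun i => hs.contDiffOn_U_slice i ht'
  have hφC := fun i => hs.contDiffOn_grad_slice hg i ht'
  have hq : ContDiffOn ℝ 1 (fun y => ∑ k, pd Ω k (Φ t) y ^ 2) (closure Ω) :=
    ContDiffOn.sum fun k _ => (hφC k).pow 2
  have hC : ∀ i, ContDiffOn ℝ 1 (fun y => U t y i * ∑ k, pd Ω k (Φ t) y ^ 2) (closure Ω) :=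
    fun i => (hUC i).mul hq
  have h1 := integral_div_eq_zero hg hb hC (by
    intro x hx
    have e1 := hs.sum_U_mul_normal hg ht' hx
    calc _ = (∑ k, pd Ω k (Φ t) x ^ 2) * ∑ i, U t x i * fderiv ℝ g x (bv i) := by
          rw [Finset.mul_sum]; exact Finset.sum_congr rfl fun j _ => by ring
      _ = 0 := by rw [e1]; ring)
  have h2 := hs.integral_mul_elField hg hb ht
    (hasWeakGradient_of_contDiffOn hΩ hb hu ((hs.contDiffOn_potential_slice ht').of_le (by simp)))
  have hint : ∀ {v : E d → ℝ}, ContinuousOn v (closure Ω) → IntegrableOn v Ω := fun hv =>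
    integrableOn_of_continuousOn_closure hΩ hb hv
  have hfield : ∀ i, IntegrableOn (fun x => pd Ω i (Φ t) x *
      elField T Ω (average Ω (r 0)) U Φ t i x) Ω := by
    intro i
    refine hint ((hφC i).continuousOn.mul ?_)
    have hpU := fun i j => continuousOn_pd hu (hUC i) j
    have hθ : ContDiffOn ℝ 1 (fun y => tderiv T Φ t y + ∑ k, U t y k * pd Ω k (Φ t) y)
      (closure Ω) := (hs.contDiffOn_tderiv_potential_slice hg ht').add
        (ContDiffOn.sum fun k _ => (hUC k).mul (hφC k))
    exact ((((continuousOn_pd hu hθ i).neg.add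
      (continuousOn_const.mul (hUC i).continuousOn)).add (continuousOn_finsetSum _ fun k _ =>
      (hφC k).continuousOn.mul (hpU i k))).add (continuousOn_finsetSum _ fun k _ =>
      (hφC k).continuousOn.mul (hpU k i))).sub ((hφC i).continuousOn.mul
      (continuousOn_finsetSum _ fun k _ => hpU k k))
  rw [← integral_finsetSum _ fun i _ => hfield i] at h2
  have hdiv : IntegrableOn (fun x => ∑ i, pd Ω i
      (fun y => U t y i * ∑ k, pd Ω k (Φ t) y ^ 2) x) Ω :=
    hint (continuousOn_finsetSum _ fun i _ => continuousOn_pd hu (hC i) i)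
  have h3 : ∫ x in Ω, (-(∑ i, pd Ω i (Φ t) x * elField T Ω (average Ω (r 0)) U Φ t i x)
      - (1 / 2) * ∑ i, pd Ω i (fun y => U t y i * ∑ k, pd Ω k (Φ t) y ^ 2) x) = 0 := by
    have hneg : IntegrableOn (fun x => -(∑ i, pd Ω i (Φ t) x *
        elField T Ω (average Ω (r 0)) U Φ t i x)) Ω :=
      (integrable_finsetSum _ fun i _ => hfield i).neg
    rw [integral_sub hneg (hdiv.const_mul _),
      integral_neg, h2, integral_const_mul, h1]
    ring
  refine Eq.trans (setIntegral_congr_fun hΩ.measurableSet fun x hx => ?_) h3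
  have e1 : ∀ i, pd Ω i (fun y => U t y i * ∑ k, pd Ω k (Φ t) y ^ 2) x
      = U t x i * (∑ k, 2 * (pd Ω k (Φ t) x * pd Ω i (fun y => pd Ω k (Φ t) y) x))
        + pd Ω i (fun y => U t y i) x * ∑ k, pd Ω k (Φ t) x ^ 2 := by
    intro i
    rw [pd_mul hΩ (hUC i) hq i hx, pd_sum hΩ (fun k => (hφC k).pow 2) i hx]
    congr 2
    refine Finset.sum_congr rfl fun k _ => ?_
    simp_rw [pow_two]
    rw [pd_mul hΩ (hφC k) (hφC k) i hx]
    ring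
  simp only [elField]
  simp_rw [e1, hs.pd_tderiv_add hg ht hx]
  -- expand everything into sums over the indices and compare
  have c1 : ∑ i, U t x i * (∑ k, 2 * (pd Ω k (Φ t) x * pd Ω i (fun y => pd Ω k (Φ t) y) x))
      = 2 * ∑ i, ∑ k, pd Ω i (Φ t) x * (U t x k * pd Ω k (fun y => pd Ω i (Φ t) y) x) := by
    simp_rw [Finset.mul_sum]
    rw [Finset.sum_comm]
    exact Finset.sum_congr rfl fun i _ => Finset.sum_congr rfl fun k _ => by ring
  have c2 : ∑ i, ∑ j, pd Ω i (Φ t) x * pd Ω j (Φ t) x * pd Ω j (fun y => U t y i) x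
      = ∑ i, pd Ω i (Φ t) x * ∑ k, pd Ω k (Φ t) x * pd Ω k (fun y => U t y i) x := by
    simp_rw [Finset.mul_sum]
    exact Finset.sum_congr rfl fun i _ => Finset.sum_congr rfl fun k _ => by ring
  rw [Finset.sum_add_distrib, c1, c2, ← Finset.sum_mul]
  have c3 : ∑ i, pd Ω i (Φ t) x *
      (-(tderiv T (fun s y => pd Ω i (Φ s) y) t x
          + ∑ k, (U t x k * pd Ω k (fun y => pd Ω i (Φ t) y) x
            + pd Ω k (Φ t) x * pd Ω i (fun y => U t y k) x))
        + average Ω (r 0) * U t x i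
        + ∑ k, pd Ω k (Φ t) x * pd Ω k (fun y => U t y i) x
        + ∑ k, pd Ω k (Φ t) x * pd Ω i (fun y => U t y k) x
        - pd Ω i (Φ t) x * ∑ k, pd Ω k (fun y => U t y k) x)
      = -(∑ i, pd Ω i (Φ t) x * tderiv T (fun s y => pd Ω i (Φ s) y) t x)
        - (∑ i, ∑ k, pd Ω i (Φ t) x * (U t x k * pd Ω k (fun y => pd Ω i (Φ t) y) x))
        + average Ω (r 0) * (∑ i, U t x i * pd Ω i (Φ t) x)
        + (∑ i, pd Ω i (Φ t) x * ∑ k, pd Ω k (Φ t) x * pd Ω k (fun y => U t y i) x)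
        - (∑ k, pd Ω k (Φ t) x ^ 2) * ∑ i, pd Ω i (fun y => U t y i) x := by
    rw [Finset.mul_sum (a := average Ω (r 0)), Finset.sum_mul, ← Finset.sum_neg_distrib,
      ← Finset.sum_sub_distrib, ← Finset.sum_add_distrib, ← Finset.sum_add_distrib,
      ← Finset.sum_sub_distrib]
    refine Finset.sum_congr rfl fun i _ => ?_
    rw [Finset.sum_add_distrib, ← Finset.mul_sum]
    ring
  rw [c3]
  ring

end IsStrongSolution

/-! ### Integrals against signed measures -/

section Sint

variable {Ω : Set (E d)} {μ : SignedMeasure (E d)}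

lemma variation_compl_closure (hμ : μ.totalVariation (closure Ω)ᶜ = 0) :
    ∀ᵐ x ∂μ.variation, x ∈ closure Ω := by
  rw [SignedMeasure.totalVariation_eq_variation] at hμ
  exact hμ

lemma isFiniteMeasure_variation (μ : SignedMeasure (E d)) : IsFiniteMeasure μ.variation := by
  rw [← SignedMeasure.totalVariation_eq_variation]; infer_instance

lemma integrable_variation_of_continuousOn (hb : Bornology.IsBounded Ω)
    (hμ : μ.totalVariation (closure Ω)ᶜ = 0) {c : E d → ℝ} (hc : ContinuousOn c (closure Ω)) :
    Integrable c μ.variation := by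
  have hfin := isFiniteMeasure_variation μ
  have hae := variation_compl_closure hμ
  obtain ⟨B, hB⟩ := hb.isCompact_closure.exists_bound_of_continuousOn hc
  have hm : AEStronglyMeasurable c μ.variation := by
    rw [← Measure.restrict_eq_self_of_ae_mem hae]
    exact hc.aestronglyMeasurable isClosed_closure.measurableSet
  exact (integrable_const B).mono' hm (hae.mono fun x hx => hB x hx)

lemma sint_congr (hμ : μ.totalVariation (closure Ω)ᶜ = 0) {c c' : E d → ℝ}
    (h : ∀ x ∈ closure Ω, c x = c' x) : sint μ c = sint μ c' :=
  VectorMeasure.integral_congr_ae ((variation_compl_closure hμ).mono fun x hx => h x hx)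

lemma sint_const_mul (a : ℝ) (c : E d → ℝ) : sint μ (fun x => a * c x) = a * sint μ c := by
  have := VectorMeasure.integral_fun_smul (μ := μ)
    (B := (ContinuousLinearMap.lsmul ℝ ℝ : ℝ →L[ℝ] ℝ →L[ℝ] ℝ)) a c
  simpa [sint] using this

lemma sint_add (hb : Bornology.IsBounded Ω) (hμ : μ.totalVariation (closure Ω)ᶜ = 0)
    {c c' : E d → ℝ} (hc : ContinuousOn c (closure Ω)) (hc' : ContinuousOn c' (closure Ω)) :
    sint μ (fun x => c x + c' x) = sint μ c + sint μ c' :=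
  VectorMeasure.integral_fun_add (integrable_variation_of_continuousOn hb hμ hc)
    (integrable_variation_of_continuousOn hb hμ hc')

lemma norm_lsmul_real_le : ‖(ContinuousLinearMap.lsmul ℝ ℝ : ℝ →L[ℝ] ℝ →L[ℝ] ℝ)‖ ≤ 1 :=
  ContinuousLinearMap.opNorm_lsmul_le

lemma abs_sint_le (hμ : μ.totalVariation (closure Ω)ᶜ = 0)
    {c : E d → ℝ} {B : ℝ} (hB : ∀ x ∈ closure Ω, |c x| ≤ B) :
    |sint μ c| ≤ B * (μ.totalVariation univ).toReal := by
  have hfin := isFiniteMeasure_variation μ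
  have h1 := VectorMeasure.norm_integral_le_integral_norm (μ := μ) (f := c)
    (B := (ContinuousLinearMap.lsmul ℝ ℝ : ℝ →L[ℝ] ℝ →L[ℝ] ℝ))
  have h2 : ∫ x, ‖c x‖ ∂μ.variation ≤ B * (μ.totalVariation univ).toReal := by
    have h3 := norm_integral_le_of_norm_le_const (μ := μ.variation) (f := fun x => ‖c x‖) (C := B)
      ((variation_compl_closure hμ).mono fun x hx => by rw [norm_norm]; exact hB x hx)
    rw [SignedMeasure.totalVariation_eq_variation]
    exact (le_abs_self _).trans h3
  refine h1.trans (le_trans ?_ h2)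
  have h4 : 0 ≤ ∫ x, ‖c x‖ ∂μ.variation := integral_nonneg fun x => norm_nonneg _
  nlinarith [norm_lsmul_real_le]

end Sint

section Family

variable {T : ℝ} {Ω : Set (E d)} {m : ℝ → SignedMeasure (E d)}

lemma exists_continuous_extension {Z : Type*} [TopologicalSpace Z] [NormalSpace Z] {s : Set Z}
    (hs : IsClosed s) {c : Z → ℝ} (hc : ContinuousOn c s) :
    ∃ c' : Z → ℝ, Continuous c' ∧ ∀ z ∈ s, c' z = c z := by
  obtain ⟨g, hg⟩ := ContinuousMap.exists_restrict_eq hs (Y := ℝ)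
    ⟨s.domRestrict c, continuousOn_iff_continuous_domRestrict.1 hc⟩
  refine ⟨g, g.continuous, fun z hz => ?_⟩
  have := congrArg (fun f : C(s, ℝ) => f ⟨z, hz⟩) hg
  exact this

/-- Weak-* measurable families may be tested with jointly continuous functions: approximate them by
functions that are piecewise constant in time. -/
lemma aemeasurable_sint (hb : Bornology.IsBounded Ω) (hm : IsLinftyMeasureFamily T Ω m)
    {c : ℝ × E d → ℝ} (hc : Continuous c) :
    AEMeasurable (fun t => sint (m t) fun x => c (t, x)) (volume.restrict (Ioo 0 T)) := by
  have hk : ∀ k : ℕ, AEMeasurable (fun t => sint (m t) fun x =>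
      c ((⌊t * ((k : ℝ) + 1)⌋ : ℝ) / ((k : ℝ) + 1), x)) (volume.restrict (Ioo 0 T)) := by
    intro k
    have hj : ∀ j : ℤ, AEMeasurable (fun t => sint (m t) fun x => c ((j : ℝ) / ((k : ℝ) + 1), x))
        (volume.restrict (Ioo 0 T)) := fun j => hm.1 _ (by fun_prop)
    choose G hG hGe using hj
    have hmeas : Measurable fun q : ℤ × ℝ => G q.1 q.2 :=
      measurable_from_prod_countable_right hG
    have hfl : Measurable fun t : ℝ => (⌊t * ((k : ℝ) + 1)⌋, t) :=
      (Int.measurable_floor.comp (measurable_id.mul_const _)).prodMk measurable_id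
    refine ⟨fun t => G ⌊t * ((k : ℝ) + 1)⌋ t, hmeas.comp hfl, ?_⟩
    filter_upwards [ae_all_iff.2 hGe] with t ht
    exact ht _
  refine aemeasurable_of_tendsto_metrizable_ae atTop hk ?_
  filter_upwards [hm.2.2] with t ht
  have hfin := isFiniteMeasure_variation (m t)
  obtain ⟨B, hB⟩ := ((isCompact_Icc (a := t - 1) (b := t + 1)).prod
    hb.isCompact_closure).exists_bound_of_continuousOn hc.continuousOn
  have hcont : ContinuousAt (fun s => sint (m t) fun x => c (s, x)) t := by
    refine VectorMeasure.continuousAt_of_dominated (bound := fun _ => B) ?_ ?_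
      (integrable_const B) ?_
    · exact Eventually.of_forall fun s =>
        (Continuous.aestronglyMeasurable (by fun_prop))
    · filter_upwards [Icc_mem_nhds (show t - 1 < t by linarith) (show t < t + 1 by linarith)]
        with s hs
      exact (variation_compl_closure ht).mono fun x hx => hB (s, x) ⟨hs, hx⟩
    · exact ae_of_all _ fun x => Continuous.continuousAt (by fun_prop)
  refine hcont.tendsto.comp ?_
  rw [tendsto_iff_dist_tendsto_zero]
  refine squeeze_zero (fun _ => dist_nonneg) (fun k => ?_) tendsto_one_div_add_atTop_nhds_zero_nat
  have hpos : (0 : ℝ) < (k : ℝ) + 1 := by positivity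
  have h1 := Int.floor_le (t * ((k : ℝ) + 1))
  have h2 := Int.lt_floor_add_one (t * ((k : ℝ) + 1))
  rw [Real.dist_eq, abs_sub_comm, abs_of_nonneg]
  · rw [sub_le_iff_le_add, ← add_div, le_div_iff₀ hpos]; linarith
  · rw [sub_nonneg, div_le_iff₀ hpos]; exact h1

lemma integrableOn_sint (hb : Bornology.IsBounded Ω) (hm : IsLinftyMeasureFamily T Ω m)
    {c : ℝ × E d → ℝ} (hc : ContinuousOn c (Icc 0 T ×ˢ closure Ω)) :
    IntegrableOn (fun t => sint (m t) fun x => c (t, x)) (Ioo 0 T) := by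
  obtain ⟨c', hc', he⟩ := exists_continuous_extension
    (isClosed_Icc.prod isClosed_closure) hc
  have hK := (isCompact_Icc (a := (0 : ℝ)) (b := T)).prod hb.isCompact_closure
  obtain ⟨B, hB⟩ := hK.exists_bound_of_continuousOn hc
  obtain ⟨C, hC⟩ := hm.2.1
  have hmeas : AEMeasurable (fun t => sint (m t) fun x => c (t, x)) (volume.restrict (Ioo 0 T)) := by
    refine (aemeasurable_sint hb hm hc').congr ?_
    filter_upwards [hm.2.2, ae_restrict_mem measurableSet_Ioo] with t ht htT
    exact sint_congr ht fun x hx => he _ ⟨Ioo_subset_Icc_self htT, hx⟩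
  refine Integrable.mono' (integrable_const (|B| * (C : ℝ))) hmeas.aestronglyMeasurable ?_
  filter_upwards [hm.2.2, hC, ae_restrict_mem measurableSet_Ioo] with t ht htC htT
  have h1 := abs_sint_le ht (c := fun x => c (t, x)) (B := |B|)
    fun x hx => (hB _ ⟨Ioo_subset_Icc_self htT, hx⟩).trans (le_abs_self B)
  refine h1.trans ?_
  gcongr
  exact ENNReal.toReal_le_coe_of_le_coe htC

end Family

/-- An integrable function of time that is nonnegative when tested with nonnegative continuous
functions supported in `(0, τ)` is nonnegative almost everywhere there. -/
lemma ae_nonneg_of_forall_integral_mul_nonneg {T τ : ℝ} (hτ : τ ≤ T) {L : ℝ → ℝ}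
    (hL : IntegrableOn L (Ioo 0 T))
    (h : ∀ χ : ℝ → ℝ, Continuous χ → (∀ s, 0 ≤ χ s) → (∀ s ∉ Ioo 0 τ, χ s = 0) →
      0 ≤ ∫ t in Ioo 0 T, χ t * L t) : ∀ᵐ t ∂(volume.restrict (Ioo 0 τ)), 0 ≤ L t := by
  let L' : ℝ → ℝ := (Ioo 0 T).indicator L
  have hL' : Integrable L' := hL.integrable_indicator measurableSet_Ioo
  let φ : ℕ → ContDiffBump (0 : ℝ) := fun n =>
    ⟨1 / ((n : ℝ) + 1) / 2, 1 / ((n : ℝ) + 1), by positivity, half_lt_self (by positivity)⟩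
  have hlim := ContDiffBump.ae_convolution_tendsto_right_of_locallyIntegrable
    (μ := (volume : Measure ℝ)) (φ := φ) (l := atTop) (K := 2)
    tendsto_one_div_add_atTop_nhds_zero_nat
    (Eventually.of_forall fun n => by simp only [φ]; linarith) hL'.locallyIntegrable
  rw [ae_restrict_iff' measurableSet_Ioo]
  filter_upwards [hlim] with t ht htτ
  have htT : t ∈ Ioo 0 T := ⟨htτ.1, htτ.2.trans_le hτ⟩
  have e : L' t = L t := indicator_of_mem htT L
  rw [← e]
  obtain ⟨δ, hδ, hball⟩ := Metric.mem_nhds_iff.1 (Ioo_mem_nhds htτ.1 htτ.2)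
  refine ge_of_tendsto ht ?_
  have hev : ∀ᶠ n : ℕ in atTop, 1 / ((n : ℝ) + 1) < δ :=
    tendsto_one_div_add_atTop_nhds_zero_nat.eventually_lt_const hδ
  filter_upwards [hev] with n hn
  rw [convolution_eq_swap]
  have h1 := h (fun s => (φ n).normed volume (t - s))
    ((φ n).continuous_normed.comp (by fun_prop)) (fun s => (φ n).nonneg_normed _) (by
      intro s hs
      by_contra hcon
      have h2 : t - s ∈ Function.support ((φ n).normed (volume : Measure ℝ)) := hcon
      rw [(φ n).support_normed_eq, Metric.mem_ball, dist_zero_right] at h2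
      refine hs (hball ?_)
      rw [Metric.mem_ball, dist_comm, Real.dist_eq]
      exact lt_trans h2 hn)
  refine h1.trans_eq ?_
  rw [← integral_indicator measurableSet_Ioo]
  refine integral_congr_ae (ae_of_all _ fun s => ?_)
  simp only [L', indicator, ContinuousLinearMap.lsmul_apply, smul_eq_mul]
  split_ifs <;> simp

/-! ### Nonlinear limits along the generating sequence -/

section Limits

variable {T : ℝ} {Ω : Set (E d)} {z : ℕ → ℝ × E d → Phase d} {ν : ℝ × E d → Measure (Phase d)}

lemma measurableSet_cyl (hΩ : IsOpen Ω) : MeasurableSet (cyl T Ω) :=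
  measurableSet_Ioo.prod hΩ.measurableSet

lemma cyl_subset : cyl T Ω ⊆ Icc 0 T ×ˢ closure Ω :=
  prod_mono Ioo_subset_Icc_self subset_closure

lemma isFiniteMeasure_cyl (hb : Bornology.IsBounded Ω) :
    IsFiniteMeasure (volume.restrict (cyl T Ω)) := ⟨by
  rw [Measure.restrict_apply_univ]
  exact (((Metric.isBounded_Ioo 0 T).prod hb).measure_lt_top)⟩

lemma restrict_cyl (Ω : Set (E d)) :
    (volume.restrict (cyl T Ω) : Measure (ℝ × E d))
      = (volume.restrict (Ioo 0 T)).prod (volume.restrict Ω) := by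
  rw [Measure.prod_restrict]; rfl

lemma integrableOn_cyl_mul (hΩ : IsOpen Ω) (hb : Bornology.IsBounded Ω) {c : ℝ × E d → ℝ}
    (hc : ContinuousOn c (Icc 0 T ×ˢ closure Ω)) {F : ℝ × E d → ℝ}
    (hF : IntegrableOn F (cyl T Ω)) : IntegrableOn (fun p => c p * F p) (cyl T Ω) := by
  obtain ⟨B, hB⟩ := ((isCompact_Icc (a := (0 : ℝ)) (b := T)).prod
    hb.isCompact_closure).exists_bound_of_continuousOn hc
  refine Integrable.bdd_mul (c := B) hF
    ((hc.mono cyl_subset).aestronglyMeasurable (measurableSet_cyl hΩ)) ?_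
  filter_upwards [ae_restrict_mem (measurableSet_cyl hΩ)] with p hp using hB p (cyl_subset hp)

lemma integrableOn_cyl_of_continuousOn (hΩ : IsOpen Ω) (hb : Bornology.IsBounded Ω)
    {c : ℝ × E d → ℝ} (hc : ContinuousOn c (Icc 0 T ×ˢ closure Ω)) :
    IntegrableOn c (cyl T Ω) := by
  have hfin := isFiniteMeasure_cyl (T := T) hb
  simpa using integrableOn_cyl_mul hΩ hb hc (F := fun _ => 1) (integrable_const _)

lemma integrableOn_cyl_time_mul (hΩ : IsOpen Ω) (hb : Bornology.IsBounded Ω) {χ : ℝ → ℝ}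
    (hχ : Continuous χ) {F : ℝ × E d → ℝ} (hF : IntegrableOn F (cyl T Ω)) :
    IntegrableOn (fun p => χ p.1 * F p) (cyl T Ω) :=
  integrableOn_cyl_mul hΩ hb (c := fun p => χ p.1) (by fun_prop) hF

lemma integrableOn_time_mul {χ : ℝ → ℝ} (hχ : Continuous χ) {L : ℝ → ℝ}
    (hL : IntegrableOn L (Ioo 0 T)) : IntegrableOn (fun t => χ t * L t) (Ioo 0 T) := by
  obtain ⟨B, hB⟩ := (isCompact_Icc (a := (0 : ℝ)) (b := T)).exists_bound_of_continuousOn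
    hχ.continuousOn
  refine Integrable.bdd_mul (c := B) hL hχ.aestronglyMeasurable ?_
  filter_upwards [ae_restrict_mem measurableSet_Ioo] with t ht
    using hB t (Ioo_subset_Icc_self ht)

/-- Along the generating sequence `z`, the functions `h(p, z_n(p))` converge, when tested with
continuous functions of time, to the function `L` of time; `D` is the part of `L` that is due to
concentrations, and `L - D` the part that is carried by the Young measure `ν`. Truncations of `h`
in phase space do not concentrate. -/
structure HasLimit (T : ℝ) (Ω : Set (E d)) (z : ℕ → ℝ × E d → Phase d)
    (ν : ℝ × E d → Measure (Phase d)) (h : ℝ × E d → Phase d → ℝ) (L D : ℝ → ℝ) : Prop where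
  integrable_total : IntegrableOn L (Ioo 0 T)
  integrable_defect : IntegrableOn D (Ioo 0 T)
  integrable_seq : ∀ n, IntegrableOn (fun p => h p (z n p)) (cyl T Ω)
  ae_integrable : ∀ᵐ p ∂(volume.restrict (cyl T Ω)), Integrable (h p) (ν p)
  integrable_osc : IntegrableOn (fun p => ∫ y, h p y ∂(ν p)) (cyl T Ω)
  split : ∀ χ : ℝ → ℝ, Continuous χ → ∫ t in Ioo 0 T, χ t * (L t - D t)
    = ∫ p in cyl T Ω, χ p.1 * ∫ y, h p y ∂(ν p)
  tendsto : ∀ χ : ℝ → ℝ, Continuous χ →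
    Tendsto (fun n => ∫ p in cyl T Ω, χ p.1 * h p (z n p)) atTop (𝓝 (∫ t in Ioo 0 T, χ t * L t))
  integrable_trunc : ∀ κ : Phase d → ℝ, Continuous κ → HasCompactSupport κ →
    IntegrableOn (fun p => ∫ y, κ y * h p y ∂(ν p)) (cyl T Ω)
  tendsto_trunc : ∀ χ : ℝ → ℝ, Continuous χ → ∀ κ : Phase d → ℝ, Continuous κ →
    HasCompactSupport κ →
    Tendsto (fun n => ∫ p in cyl T Ω, χ p.1 * (κ (z n p) * h p (z n p))) atTop
      (𝓝 (∫ p in cyl T Ω, χ p.1 * ∫ y, κ y * h p y ∂(ν p)))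

lemma integrable_trunc_mul {μ : Measure (Phase d)} {κ f : Phase d → ℝ} (hκ : Continuous κ)
    (hκc : HasCompactSupport κ) (hf : Integrable f μ) : Integrable (fun y => κ y * f y) μ := by
  obtain ⟨B, hB⟩ := hκ.bounded_above_of_compact_support hκc
  exact Integrable.bdd_mul (c := B) hf hκ.aestronglyMeasurable (ae_of_all _ hB)

lemma integrableOn_trunc_seq (hz : ∀ n, AEMeasurable (z n) (volume.restrict (cyl T Ω)))
    {κ : Phase d → ℝ} (hκ : Continuous κ) (hκc : HasCompactSupport κ) {F : ℝ × E d → ℝ}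
    (hF : IntegrableOn F (cyl T Ω)) (n : ℕ) :
    IntegrableOn (fun p => κ (z n p) * F p) (cyl T Ω) := by
  obtain ⟨B, hB⟩ := hκ.bounded_above_of_compact_support hκc
  exact Integrable.bdd_mul (c := B) hF
    (hκ.measurable.comp_aemeasurable (hz n)).aestronglyMeasurable (ae_of_all _ fun p => hB _)

namespace HasLimit

variable {h h' : ℝ × E d → Phase d → ℝ} {L L' D D' : ℝ → ℝ}

lemma integrable_diff (H : HasLimit T Ω z ν h L D) :
    IntegrableOn (fun t => L t - D t) (Ioo 0 T) :=
  H.integrable_total.sub H.integrable_defect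

lemma add (hΩ : IsOpen Ω) (hb : Bornology.IsBounded Ω)
    (hz : ∀ n, AEMeasurable (z n) (volume.restrict (cyl T Ω)))
    (H : HasLimit T Ω z ν h L D) (H' : HasLimit T Ω z ν h' L' D') :
    HasLimit T Ω z ν (fun p y => h p y + h' p y) (fun t => L t + L' t)
      (fun t => D t + D' t) where
  integrable_total := H.integrable_total.add H'.integrable_total
  integrable_defect := H.integrable_defect.add H'.integrable_defect
  integrable_seq n := (H.integrable_seq n).add (H'.integrable_seq n)
  ae_integrable := by
    filter_upwards [H.ae_integrable, H'.ae_integrable] with p h1 h2 using h1.add h2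
  integrable_osc := by
    refine (H.integrable_osc.add H'.integrable_osc).congr ?_
    filter_upwards [H.ae_integrable, H'.ae_integrable] with p h1 h2
    exact (integral_add h1 h2).symm
  split χ hχ := by
    have e1 : ∫ t in Ioo 0 T, χ t * (L t + L' t - (D t + D' t))
        = (∫ t in Ioo 0 T, χ t * (L t - D t)) + ∫ t in Ioo 0 T, χ t * (L' t - D' t) := by
      rw [← integral_add (integrableOn_time_mul hχ H.integrable_diff)
        (integrableOn_time_mul hχ H'.integrable_diff)]
      congr 1; funext t; ring
    rw [e1, H.split χ hχ, H'.split χ hχ,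
      ← integral_add (integrableOn_cyl_time_mul hΩ hb hχ H.integrable_osc)
      (integrableOn_cyl_time_mul hΩ hb hχ H'.integrable_osc)]
    refine integral_congr_ae ?_
    filter_upwards [H.ae_integrable, H'.ae_integrable] with p h1 h2
    rw [integral_add h1 h2]; ring
  tendsto χ hχ := by
    have e1 : ∫ t in Ioo 0 T, χ t * (L t + L' t)
        = (∫ t in Ioo 0 T, χ t * L t) + ∫ t in Ioo 0 T, χ t * L' t := by
      rw [← integral_add (integrableOn_time_mul hχ H.integrable_total)
        (integrableOn_time_mul hχ H'.integrable_total)]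
      congr 1; funext t; ring
    rw [e1]
    refine ((H.tendsto χ hχ).add (H'.tendsto χ hχ)).congr fun n => ?_
    rw [← integral_add (integrableOn_cyl_time_mul hΩ hb hχ (H.integrable_seq n))
      (integrableOn_cyl_time_mul hΩ hb hχ (H'.integrable_seq n))]
    congr 1; funext t; ring
  integrable_trunc κ hκ hκc := by
    refine ((H.integrable_trunc κ hκ hκc).add (H'.integrable_trunc κ hκ hκc)).congr ?_
    filter_upwards [H.ae_integrable, H'.ae_integrable] with p h1 h2
    simp only [Pi.add_apply]
    rw [← integral_add (integrable_trunc_mul hκ hκc h1) (integrable_trunc_mul hκ hκc h2)]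
    congr 1; funext y; ring
  tendsto_trunc χ hχ κ hκ hκc := by
    have e1 : ∫ p in cyl T Ω, χ p.1 * ∫ y, κ y * (h p y + h' p y) ∂(ν p)
        = (∫ p in cyl T Ω, χ p.1 * ∫ y, κ y * h p y ∂(ν p))
          + ∫ p in cyl T Ω, χ p.1 * ∫ y, κ y * h' p y ∂(ν p) := by
      rw [← integral_add (integrableOn_cyl_time_mul hΩ hb hχ (H.integrable_trunc κ hκ hκc))
        (integrableOn_cyl_time_mul hΩ hb hχ (H'.integrable_trunc κ hκ hκc))]
      refine integral_congr_ae ?_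
      filter_upwards [H.ae_integrable, H'.ae_integrable] with p h1 h2
      rw [← mul_add,
        ← integral_add (integrable_trunc_mul hκ hκc h1) (integrable_trunc_mul hκ hκc h2)]
      congr 2; funext y; ring
    rw [e1]
    refine ((H.tendsto_trunc χ hχ κ hκ hκc).add (H'.tendsto_trunc χ hχ κ hκ hκc)).congr fun n => ?_
    rw [← integral_add
      (integrableOn_cyl_time_mul hΩ hb hχ (integrableOn_trunc_seq hz hκ hκc (H.integrable_seq n) n))
      (integrableOn_cyl_time_mul hΩ hb hχ
        (integrableOn_trunc_seq hz hκ hκc (H'.integrable_seq n) n))]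
    congr 1; funext t; ring

lemma const_mul (a : ℝ) (H : HasLimit T Ω z ν h L D) :
    HasLimit T Ω z ν (fun p y => a * h p y) (fun t => a * L t) (fun t => a * D t) where
  integrable_total := H.integrable_total.const_mul a
  integrable_defect := H.integrable_defect.const_mul a
  integrable_seq n := (H.integrable_seq n).const_mul a
  ae_integrable := H.ae_integrable.mono fun p hp => hp.const_mul a
  integrable_osc := by
    simp_rw [integral_const_mul]; exact H.integrable_osc.const_mul a
  split χ hχ := by
    simp_rw [integral_const_mul, ← mul_sub, mul_left_comm _ a, integral_const_mul]
    rw [H.split χ hχ]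
  tendsto χ hχ := by
    simp_rw [mul_left_comm _ a, integral_const_mul]
    exact (H.tendsto χ hχ).const_mul a
  integrable_trunc κ hκ hκc := by
    simp_rw [mul_left_comm _ a, integral_const_mul]
    exact (H.integrable_trunc κ hκ hκc).const_mul a
  tendsto_trunc χ hχ κ hκ hκc := by
    simp_rw [mul_left_comm _ a, integral_const_mul, mul_left_comm _ a, integral_const_mul]
    exact (H.tendsto_trunc χ hχ κ hκ hκc).const_mul a

lemma sub (hΩ : IsOpen Ω) (hb : Bornology.IsBounded Ω)
    (hz : ∀ n, AEMeasurable (z n) (volume.restrict (cyl T Ω)))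
    (H : HasLimit T Ω z ν h L D) (H' : HasLimit T Ω z ν h' L' D') :
    HasLimit T Ω z ν (fun p y => h p y - h' p y) (fun t => L t - L' t)
      (fun t => D t - D' t) := by
  simpa only [neg_one_mul, ← sub_eq_add_neg] using H.add hΩ hb hz (H'.const_mul (-1))

lemma zero : HasLimit T Ω z ν (fun _ _ => 0) (fun _ => 0) (fun _ => 0) where
  integrable_total := integrableOn_zero
  integrable_defect := integrableOn_zero
  integrable_seq _ := integrableOn_zero
  ae_integrable := ae_of_all _ fun _ => integrable_zero _ _ _
  integrable_osc := by simp
  split χ hχ := by simp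
  tendsto χ hχ := by simp
  integrable_trunc κ hκ hκc := by simp
  tendsto_trunc χ hχ κ hκ hκc := by simp

lemma sum (hΩ : IsOpen Ω) (hb : Bornology.IsBounded Ω)
    (hz : ∀ n, AEMeasurable (z n) (volume.restrict (cyl T Ω))) {ι : Type*} (s : Finset ι)
    {h : ι → ℝ × E d → Phase d → ℝ} {L D : ι → ℝ → ℝ}
    (H : ∀ i, HasLimit T Ω z ν (h i) (L i) (D i)) :
    HasLimit T Ω z ν (fun p y => ∑ i ∈ s, h i p y) (fun t => ∑ i ∈ s, L i t)
      (fun t => ∑ i ∈ s, D i t) := by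
  classical
  induction s using Finset.induction_on with
  | empty => simpa using zero
  | insert a s ha ih =>
    simp only [Finset.sum_insert ha]
    exact (H a).add hΩ hb hz ih

/-- The nonlinearities of the system, multiplied by continuous functions. -/
lemma of_concentration (hΩ : IsOpen Ω) (hb : Bornology.IsBounded Ω)
    (hY : IsYoungMeasureOf (cyl T Ω) z ν) {f : Phase d → ℝ} (hf : Continuous f)
    {m : ℝ → SignedMeasure (E d)} (hm : IsConcentrationMeasure T Ω z ν f m)
    {c : ℝ × E d → ℝ} (hc : ContinuousOn c (Icc 0 T ×ˢ closure Ω)) :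
    HasLimit T Ω z ν (fun p y => c p * f y)
      (fun t => barInt Ω (fun x => ν (t, x)) f (m t) (fun x => c (t, x)))
      (fun t => sint (m t) fun x => c (t, x)) := by
  obtain ⟨hm1, ⟨C, hm2⟩, hm3, hm4, hm5⟩ := hm
  have hfin := isFiniteMeasure_cyl (T := T) hb
  have hD := integrableOn_sint hb hm1 hc
  have hosc : IntegrableOn (fun p => c p * ∫ y, f y ∂(ν p)) (cyl T Ω) :=
    integrableOn_cyl_mul hΩ hb hc hm4
  have hoscL : IntegrableOn (fun t => ∫ x in Ω, (∫ y, f y ∂(ν (t, x))) * c (t, x)) (Ioo 0 T) := by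
    have h1 := hosc
    rw [IntegrableOn, restrict_cyl] at h1
    have h2 := h1.integral_prod_left
    simp_rw [mul_comm (∫ y, f y ∂(ν (_, _)))]
    exact h2
  have hsplit : ∀ χ : ℝ → ℝ, Continuous χ →
      ∫ t in Ioo 0 T, χ t * (∫ x in Ω, (∫ y, f y ∂(ν (t, x))) * c (t, x))
        = ∫ p in cyl T Ω, χ p.1 * (c p * ∫ y, f y ∂(ν p)) := by
    intro χ hχ
    have h1 := integrableOn_cyl_time_mul hΩ hb hχ hosc
    rw [IntegrableOn, restrict_cyl] at h1
    rw [restrict_cyl, integral_prod _ h1]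
    refine integral_congr_ae (ae_of_all _ fun t => ?_)
    simp only
    rw [← integral_const_mul]
    congr 1; funext x; ring
  have hbar : ∀ t, barInt Ω (fun x => ν (t, x)) f (m t) (fun x => c (t, x))
      = (∫ x in Ω, (∫ y, f y ∂(ν (t, x))) * c (t, x)) + sint (m t) fun x => c (t, x) :=
    fun t => rfl
  refine ⟨?_, hD, fun n => integrableOn_cyl_mul hΩ hb hc (hm2 n).1,
    hm3.mono fun p hp => hp.const_mul _, ?_, ?_, ?_, ?_, ?_⟩
  · simp_rw [hbar]
    exact hoscL.add hD
  · simp_rw [integral_const_mul]; exact hosc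
  · intro χ hχ
    simp_rw [hbar, add_sub_cancel_right, integral_const_mul]
    exact hsplit χ hχ
  · intro χ hχ
    obtain ⟨c', hc', he⟩ := exists_continuous_extension (isClosed_Icc.prod isClosed_closure) hc
    have h1 := hm5 (fun p => χ p.1 * c' p) (by fun_prop)
    have hcyl : ∀ p ∈ cyl T Ω, c' p = c p := fun p hp => he p (cyl_subset hp)
    have e1 : ∀ n, ∫ p in cyl T Ω, χ p.1 * (c p * f (z n p))
        = ∫ p in cyl T Ω, χ p.1 * c' p * f (z n p) := fun n =>
      setIntegral_congr_fun (measurableSet_cyl hΩ) fun p hp => by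
        simp only [hcyl p hp]; ring
    have e2 : ∫ p in cyl T Ω, χ p.1 * c' p * ∫ y, f y ∂(ν p)
        = ∫ p in cyl T Ω, χ p.1 * (c p * ∫ y, f y ∂(ν p)) :=
      setIntegral_congr_fun (measurableSet_cyl hΩ) fun p hp => by
        simp only [hcyl p hp]; ring
    have e3 : ∫ t in Ioo 0 T, sint (m t) (fun x => χ t * c' (t, x))
        = ∫ t in Ioo 0 T, χ t * sint (m t) fun x => c (t, x) := by
      refine integral_congr_ae ?_
      filter_upwards [hm1.2.2, ae_restrict_mem measurableSet_Ioo] with t ht htT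
      rw [sint_const_mul]
      congr 1
      exact sint_congr ht fun x hx => he _ ⟨Ioo_subset_Icc_self htT, hx⟩
    simp only [e2, e3] at h1
    simp_rw [e1]
    convert h1 using 2
    rw [← hsplit χ hχ, ← integral_add (integrableOn_time_mul hχ hoscL)
      (integrableOn_time_mul hχ hD)]
    refine integral_congr_ae (ae_of_all _ fun t => ?_)
    simp only [hbar]; ring
  all_goals
    have key : ∀ κ : Phase d → ℝ, Continuous κ → HasCompactSupport κ →
        ∃ F : ZeroAtInftyContinuousMap (Phase d) ℝ, ∀ y, F y = κ y * f y := fun κ hκ hκc =>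
      ⟨⟨⟨fun y => κ y * f y, hκ.mul hf⟩, (hκc.mul_right (f' := f)).is_zero_at_infty⟩, fun y => rfl⟩
  · intro κ hκ hκc
    obtain ⟨F, hF⟩ := key κ hκ hκc
    obtain ⟨Cν, hCν⟩ := hY.1.2
    have h1 : IntegrableOn (fun p => ∫ y, F y ∂(ν p)) (cyl T Ω) := by
      obtain ⟨B, hB⟩ := (hκ.mul hf).bounded_above_of_compact_support (hκc.mul_right (f' := f))
      refine Integrable.mono' (integrable_const (|B| * (Cν : ℝ)))
        (hY.1.1 F).aestronglyMeasurable ?_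
      filter_upwards [hCν] with p hp
      have hfin' : IsFiniteMeasure (ν p) := ⟨hp.trans_lt ENNReal.coe_lt_top⟩
      refine (norm_integral_le_of_norm_le_const (C := |B|) (ae_of_all _ fun y => ?_)).trans ?_
      · rw [hF]; exact (hB y).trans (le_abs_self B)
      · gcongr
        exact ENNReal.toReal_le_coe_of_le_coe hp
    have h2 := integrableOn_cyl_mul hΩ hb hc h1
    refine h2.congr (ae_of_all _ fun p => ?_)
    simp only [hF]
    rw [← integral_const_mul]
    congr 1; funext y; ring
  · intro χ hχ κ hκ hκc
    obtain ⟨F, hF⟩ := key κ hκ hκc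
    have hφ : IntegrableOn (fun p => χ p.1 * c p) (cyl T Ω) :=
      integrableOn_cyl_time_mul hΩ hb hχ (integrableOn_cyl_of_continuousOn hΩ hb hc)
    have h1 := hY.2.2 F _ hφ
    simp only [hF] at h1
    refine (h1.congr fun n => ?_).trans (le_of_eq ?_)
    · congr 1; funext p; ring
    · congr 2; funext p
      rw [mul_assoc, ← integral_const_mul]
      congr 2; funext y; ring

end HasLimit
end Limits

/-! ### Positivity of limits and of concentrations -/

section Positivity

variable {T : ℝ} {Ω : Set (E d)} {z : ℕ → ℝ × E d → Phase d} {ν : ℝ × E d → Measure (Phase d)}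

/-- Continuous cutoff functions in phase space. -/
def phaseCutoff (n : ℕ) (y : Phase d) : ℝ := max 0 (min 1 ((n : ℝ) + 1 - dist y 0))

lemma continuous_phaseCutoff (n : ℕ) : Continuous (phaseCutoff (d := d) n) := by
  unfold phaseCutoff; fun_prop

lemma phaseCutoff_nonneg (n : ℕ) (y : Phase d) : 0 ≤ phaseCutoff n y := le_max_left _ _

lemma phaseCutoff_le_one (n : ℕ) (y : Phase d) : phaseCutoff n y ≤ 1 :=
  max_le zero_le_one (min_le_left _ _)

lemma abs_phaseCutoff_le_one (n : ℕ) (y : Phase d) : |phaseCutoff n y| ≤ 1 := by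
  rw [abs_of_nonneg (phaseCutoff_nonneg n y)]; exact phaseCutoff_le_one n y

lemma hasCompactSupport_phaseCutoff (n : ℕ) : HasCompactSupport (phaseCutoff (d := d) n) := by
  refine HasCompactSupport.intro (isCompact_closedBall (0 : Phase d) ((n : ℝ) + 1)) fun y hy => ?_
  rw [Metric.mem_closedBall, not_le] at hy
  rw [phaseCutoff, max_eq_left]
  exact (min_le_right _ _).trans (by linarith)

lemma phaseCutoff_eventually_eq_one (y : Phase d) : ∀ᶠ n : ℕ in atTop, phaseCutoff n y = 1 := by
  filter_upwards [eventually_ge_atTop ⌈dist y 0⌉₊] with n hn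
  have h1 : dist y 0 ≤ n := (Nat.le_ceil _).trans (by exact_mod_cast hn)
  rw [phaseCutoff, min_eq_left (by linarith), max_eq_right zero_le_one]

lemma tendsto_phaseCutoff_mul (y : Phase d) (a : ℝ) :
    Tendsto (fun n => phaseCutoff n y * a) atTop (𝓝 a) :=
  tendsto_const_nhds.congr' (by
    filter_upwards [phaseCutoff_eventually_eq_one y] with n hn
    rw [hn, one_mul])

lemma tendsto_integral_phaseCutoff_mul {μ : Measure (Phase d)} {f : Phase d → ℝ}
    (hf : Integrable f μ) :
    Tendsto (fun n => ∫ y, phaseCutoff n y * f y ∂μ) atTop (𝓝 (∫ y, f y ∂μ)) := by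
  refine tendsto_integral_of_dominated_convergence (fun y => |f y|) ?_ hf.abs ?_ ?_
  · exact fun n => (continuous_phaseCutoff n).aestronglyMeasurable.mul hf.aestronglyMeasurable
  · refine fun n => ae_of_all _ fun y => ?_
    rw [Real.norm_eq_abs, abs_mul]
    exact mul_le_of_le_one_left (abs_nonneg _) (abs_phaseCutoff_le_one n y)
  · exact ae_of_all _ fun y => tendsto_phaseCutoff_mul y _

namespace HasLimit

variable {h : ℝ × E d → Phase d → ℝ} {L D : ℝ → ℝ} {τ : ℝ}

/-- Pointwise nonnegative integrands have nonnegative limits, although oscillation and concentration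
are only known through the sequence. -/
lemma total_nonneg (hΩ : IsOpen Ω) (H : HasLimit T Ω z ν h L D) (hτ : τ ≤ T)
    (hpos : ∀ t ∈ Ioo 0 τ, ∀ x ∈ Ω, ∀ y, 0 ≤ h (t, x) y) :
    ∀ᵐ t ∂(volume.restrict (Ioo 0 τ)), 0 ≤ L t := by
  refine ae_nonneg_of_forall_integral_mul_nonneg hτ H.integrable_total fun χ hχ h0 hs => ?_
  refine ge_of_tendsto' (H.tendsto χ hχ) fun n => ?_
  refine setIntegral_nonneg (measurableSet_cyl hΩ) fun p hp => ?_
  by_cases hpt : p.1 ∈ Ioo 0 τ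
  · exact mul_nonneg (h0 _) (hpos p.1 hpt p.2 hp.2 _)
  · rw [hs _ hpt, zero_mul]

/-- Concentration measures of nonnegative integrands are nonnegative, since truncations of the
integrand do not concentrate. -/
lemma defect_nonneg (hΩ : IsOpen Ω) (hb : Bornology.IsBounded Ω)
    (hz : ∀ n, AEMeasurable (z n) (volume.restrict (cyl T Ω)))
    (H : HasLimit T Ω z ν h L D) (hτ : τ ≤ T)
    (hpos : ∀ t ∈ Ioo 0 τ, ∀ x ∈ Ω, ∀ y, 0 ≤ h (t, x) y) :
    ∀ᵐ t ∂(volume.restrict (Ioo 0 τ)), 0 ≤ D t := by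
  have hmc := measurableSet_cyl (T := T) hΩ
  refine ae_nonneg_of_forall_integral_mul_nonneg hτ H.integrable_defect fun χ hχ h0 hs => ?_
  have hcase : ∀ p ∈ cyl T Ω, ∀ y, 0 ≤ χ p.1 * h p y := by
    intro p hp y
    by_cases hpt : p.1 ∈ Ioo 0 τ
    · exact mul_nonneg (h0 _) (hpos p.1 hpt p.2 hp.2 _)
    · rw [hs _ hpt, zero_mul]
  -- the limit of the truncated integrand is its oscillation part, and is at most the full limit
  have h1 : ∀ n : ℕ, ∫ p in cyl T Ω, χ p.1 * ∫ y, phaseCutoff n y * h p y ∂(ν p)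
      ≤ ∫ t in Ioo 0 T, χ t * L t := by
    intro n
    have hk := H.tendsto_trunc χ hχ _ (continuous_phaseCutoff n) (hasCompactSupport_phaseCutoff n)
    refine le_of_tendsto_of_tendsto' hk (H.tendsto χ hχ) fun k => ?_
    refine setIntegral_mono_on (integrableOn_cyl_time_mul hΩ hb hχ
      (integrableOn_trunc_seq hz (continuous_phaseCutoff n) (hasCompactSupport_phaseCutoff n)
        (H.integrable_seq k) k)) (integrableOn_cyl_time_mul hΩ hb hχ (H.integrable_seq k)) hmc ?_
    intro p hp
    have h2 := hcase p hp (z k p)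
    have h3 := phaseCutoff_le_one n (z k p)
    calc χ p.1 * (phaseCutoff n (z k p) * h p (z k p))
        = phaseCutoff n (z k p) * (χ p.1 * h p (z k p)) := by ring
      _ ≤ 1 * (χ p.1 * h p (z k p)) := by gcongr
      _ = _ := one_mul _
  have h2 : Tendsto (fun n : ℕ => ∫ p in cyl T Ω, χ p.1 * ∫ y, phaseCutoff n y * h p y ∂(ν p)) atTop
      (𝓝 (∫ p in cyl T Ω, χ p.1 * ∫ y, h p y ∂(ν p))) := by
    refine tendsto_integral_of_dominated_convergence
      (fun p => |χ p.1 * ∫ y, h p y ∂(ν p)|) ?_ ?_ ?_ ?_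
    · exact fun n => (integrableOn_cyl_time_mul hΩ hb hχ (H.integrable_trunc _
        (continuous_phaseCutoff n) (hasCompactSupport_phaseCutoff n))).aestronglyMeasurable
    · exact (integrableOn_cyl_time_mul hΩ hb hχ H.integrable_osc).abs
    · intro n
      filter_upwards [H.ae_integrable, ae_restrict_mem hmc] with p hp hpc
      have e1 : ∀ F : Phase d → ℝ, χ p.1 * ∫ y, F y ∂(ν p) = ∫ y, χ p.1 * F y ∂(ν p) :=
        fun F => (integral_const_mul _ _).symm
      have hmul : ∀ y, χ p.1 * (phaseCutoff n y * h p y) = phaseCutoff n y * (χ p.1 * h p y) :=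
        fun y => by ring
      have hn : 0 ≤ ∫ y, χ p.1 * (phaseCutoff n y * h p y) ∂(ν p) :=
        integral_nonneg fun y => by
          rw [hmul y]; exact mul_nonneg (phaseCutoff_nonneg n y) (hcase p hpc y)
      rw [e1, e1, Real.norm_eq_abs, abs_of_nonneg hn,
        abs_of_nonneg (integral_nonneg fun y => hcase p hpc y)]
      refine integral_mono ((integrable_trunc_mul (continuous_phaseCutoff n)
        (hasCompactSupport_phaseCutoff n) hp).const_mul _) (hp.const_mul _) fun y => ?_
      rw [hmul y]
      exact mul_le_of_le_one_left (hcase p hpc y) (phaseCutoff_le_one n y)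
    · filter_upwards [H.ae_integrable] with p hp
      exact (tendsto_integral_phaseCutoff_mul hp).const_mul _
  have h3 := le_of_tendsto' h2 h1
  rw [← H.split χ hχ] at h3
  have e : ∫ t in Ioo 0 T, χ t * L t
      = (∫ t in Ioo 0 T, χ t * (L t - D t)) + ∫ t in Ioo 0 T, χ t * D t := by
    rw [← integral_add (integrableOn_time_mul hχ H.integrable_diff)
      (integrableOn_time_mul hχ H.integrable_defect)]
    congr 1; funext t; ring
  linarith

end HasLimit

/-- Young measures are sub-probability measures. -/
lemma IsYoungMeasureOf.measure_univ_le_one (hb : Bornology.IsBounded Ω)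
    (hY : IsYoungMeasureOf (cyl T Ω) z ν) :
    ∀ᵐ p ∂(volume.restrict (cyl T Ω)), ν p univ ≤ 1 := by
  have hfin := isFiniteMeasure_cyl (T := T) hb
  let F : ℕ → ZeroAtInftyContinuousMap (Phase d) ℝ := fun n =>
    ⟨⟨phaseCutoff n, continuous_phaseCutoff n⟩,
      (hasCompactSupport_phaseCutoff n).is_zero_at_infty⟩
  obtain ⟨C, hC⟩ := hY.1.2
  have hint : ∀ n, Integrable (fun p => ∫ y, F n y ∂(ν p)) (volume.restrict (cyl T Ω)) := by
    intro n
    refine Integrable.mono' (integrable_const (1 * (C : ℝ)))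
      (hY.1.1 (F n)).aestronglyMeasurable ?_
    filter_upwards [hC] with p hp
    have hfin' : IsFiniteMeasure (ν p) := ⟨hp.trans_lt ENNReal.coe_lt_top⟩
    refine (norm_integral_le_of_norm_le_const (C := 1)
      (ae_of_all _ fun y => abs_phaseCutoff_le_one n y)).trans ?_
    gcongr
    exact ENNReal.toReal_le_coe_of_le_coe hp
  have h1 : ∀ n, ∀ᵐ p ∂(volume.restrict (cyl T Ω)), ∫ y, F n y ∂(ν p) ≤ 1 := by
    intro n
    refine ae_le_of_forall_setIntegral_le (hint n) (integrable_const (1 : ℝ)) fun s hs _ => ?_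
    have hφ : Integrable (s.indicator fun _ => (1 : ℝ)) (volume.restrict (cyl T Ω)) :=
      (integrable_const (1 : ℝ)).indicator hs
    have hl := hY.2.2 (F n) _ hφ
    have e : ∀ G : ℝ × E d → ℝ, ∫ p in cyl T Ω, s.indicator (fun _ => (1 : ℝ)) p * G p
        = ∫ p in s, G p ∂(volume.restrict (cyl T Ω)) := by
      intro G
      rw [← integral_indicator hs]
      refine integral_congr_ae (ae_of_all _ fun p => ?_)
      simp only [indicator]; split_ifs <;> simp
    simp only [e] at hl
    refine le_of_tendsto' hl fun k => ?_
    refine integral_mono_of_nonneg (ae_of_all _ fun p => phaseCutoff_nonneg n _)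
      (integrable_const (1 : ℝ)).integrableOn (ae_of_all _ fun p => phaseCutoff_le_one n _)
  filter_upwards [ae_all_iff.2 h1, hC] with p hp hpC
  have hfin' : IsFiniteMeasure (ν p) := ⟨hpC.trans_lt ENNReal.coe_lt_top⟩
  have hl := tendsto_integral_phaseCutoff_mul (integrable_const (1 : ℝ) (μ := ν p))
  simp only [mul_one] at hl
  have h2 := le_of_tendsto' hl hp
  rw [integral_const, smul_eq_mul, mul_one, Measure.real] at h2
  rwa [← ENNReal.toReal_le_toReal (measure_ne_top _ _) ENNReal.one_ne_top, ENNReal.toReal_one]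

lemma ae_ae_of_ae_cyl {P : ℝ × E d → Prop}
    (h : ∀ᵐ p ∂(volume.restrict (cyl T Ω)), P p) :
    ∀ᵐ t ∂(volume.restrict (Ioo 0 T)), ∀ᵐ x ∂(volume.restrict Ω), P (t, x) := by
  rw [restrict_cyl] at h
  exact Measure.ae_ae_of_ae_prod h

end Positivity

/-! ### Time cutoffs and auxiliary inequalities -/

/-- For almost every time the limit splits into the oscillation and the concentration part. -/
lemma HasLimit.ae_eq_integral_add {T : ℝ} {Ω : Set (E d)} {z : ℕ → ℝ × E d → Phase d}
    {ν : ℝ × E d → Measure (Phase d)} {h : ℝ × E d → Phase d → ℝ} {L D : ℝ → ℝ}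
    (hΩ : IsOpen Ω) (hb : Bornology.IsBounded Ω) (H : HasLimit T Ω z ν h L D) :
    ∀ᵐ t ∂(volume.restrict (Ioo 0 T)), L t = (∫ x in Ω, ∫ y, h (t, x) y ∂(ν (t, x))) + D t := by
  have h1 := H.integrable_osc
  rw [IntegrableOn, restrict_cyl] at h1
  have h2 : IntegrableOn (fun t => ∫ x in Ω, ∫ y, h (t, x) y ∂(ν (t, x))) (Ioo 0 T) :=
    h1.integral_prod_left
  have key : ∀ χ : ℝ → ℝ, Continuous χ → ∫ t in Ioo 0 T, χ t * (L t - D t)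
      = ∫ t in Ioo 0 T, χ t * ∫ x in Ω, ∫ y, h (t, x) y ∂(ν (t, x)) := by
    intro χ hχ
    have h3 := integrableOn_cyl_time_mul hΩ hb hχ H.integrable_osc
    rw [IntegrableOn, restrict_cyl] at h3
    rw [H.split χ hχ, restrict_cyl, integral_prod _ h3]
    refine integral_congr_ae (ae_of_all _ fun t => ?_)
    simp only
    rw [← integral_const_mul]
  have hi : IntegrableOn (fun t => (L t - D t) - ∫ x in Ω, ∫ y, h (t, x) y ∂(ν (t, x)))
      (Ioo 0 T) := H.integrable_diff.sub h2
  have hzero : ∀ χ : ℝ → ℝ, Continuous χ → ∫ t in Ioo 0 T,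
      χ t * ((L t - D t) - ∫ x in Ω, ∫ y, h (t, x) y ∂(ν (t, x))) = 0 := by
    intro χ hχ
    simp_rw [mul_sub (χ _) (L _ - D _)]
    rw [integral_sub (integrableOn_time_mul hχ H.integrable_diff) (integrableOn_time_mul hχ h2),
      key χ hχ, sub_self]
  have a1 := ae_nonneg_of_forall_integral_mul_nonneg le_rfl hi
    fun χ hχ _ _ => (hzero χ hχ).ge
  have a2 := ae_nonneg_of_forall_integral_mul_nonneg le_rfl hi.neg fun χ hχ _ _ => by
    simp only [Pi.neg_apply, mul_neg]
    rw [integral_neg, hzero χ hχ, neg_zero]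
  filter_upwards [a1, a2] with t h3 h4
  simp only [Pi.neg_apply] at h4
  linarith

/-- A smooth change of time that is the identity on `[0, τ]` and maps `[0, T]` to `[0, T)`. It turns
functions on `[0, T)` into functions on `[0, T]`. -/
structure IsTimeCutoff (T τ : ℝ) (ζ : ℝ → ℝ) : Prop where
  contDiff : ContDiff ℝ 1 ζ
  mapsTo : ∀ t ∈ Icc 0 T, ζ t ∈ Ico 0 T
  eq_self : ∀ t ∈ Icc 0 τ, ζ t = t

lemma exists_isTimeCutoff {T τ : ℝ} (h0 : 0 < τ) (hτ : τ < T) : ∃ ζ, IsTimeCutoff T τ ζ := by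
  -- interpolate from the identity to the constant `τ`, with the transition ending before `T`
  let w : ℝ → ℝ := fun t => Real.smoothTransition ((t - τ) / ((τ + T) / 2 - τ))
  have hpos : 0 < (τ + T) / 2 - τ := by linarith
  have hw0 : ∀ t, 0 ≤ w t := fun t => Real.smoothTransition.nonneg _
  have hw1 : ∀ t, w t ≤ 1 := fun t => Real.smoothTransition.le_one _
  refine ⟨fun t => t * (1 - w t) + τ * w t, ?_, ?_, ?_⟩
  · have : ContDiff ℝ 1 w := Real.smoothTransition.contDiff.comp
      ((contDiff_id.sub contDiff_const).div_const _)
    exact (contDiff_id.mul (contDiff_const.sub this)).add (contDiff_const.mul this)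
  · intro t ht
    have e0 := hw0 t
    have e1 := hw1 t
    refine ⟨add_nonneg (mul_nonneg ht.1 (by linarith)) (mul_nonneg h0.le e0), ?_⟩
    rcases le_or_gt ((τ + T) / 2) t with h | h
    · have : w t = 1 := Real.smoothTransition.one_of_one_le
        ((one_le_div hpos).2 (by linarith))
      simp only [this]; linarith
    · nlinarith
  · intro t ht
    have : w t = 0 := Real.smoothTransition.zero_of_nonpos
      (div_nonpos_of_nonpos_of_nonneg (by linarith [ht.2]) hpos.le)
    simp only [this]; ring

namespace IsTimeCutoff

variable {T τ : ℝ} {ζ : ℝ → ℝ} {Ω : Set (E d)}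

lemma contDiffOn_comp (hζ : IsTimeCutoff T τ ζ) {X : Type*} [NormedAddCommGroup X]
    [NormedSpace ℝ X] {F : ℝ × E d → X} (hF : ContDiffOn ℝ 1 F (Ico 0 T ×ˢ closure Ω)) :
    ContDiffOn ℝ 1 (fun p : ℝ × E d => F (ζ p.1, p.2)) (Icc 0 T ×ˢ closure Ω) :=
  hF.comp ((hζ.contDiff.comp contDiff_fst).prodMk contDiff_snd).contDiffOn
    fun _ hp => ⟨hζ.mapsTo _ hp.1, hp.2⟩

lemma continuousOn_comp (hζ : IsTimeCutoff T τ ζ) {F : ℝ × E d → ℝ}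
    (hF : ContinuousOn F (Ico 0 T ×ˢ closure Ω)) :
    ContinuousOn (fun p : ℝ × E d => F (ζ p.1, p.2)) (Icc 0 T ×ˢ closure Ω) :=
  hF.comp ((hζ.contDiff.continuous.comp continuous_fst).prodMk continuous_snd).continuousOn
    fun _ hp => ⟨hζ.mapsTo _ hp.1, hp.2⟩

lemma dt_comp (hζ : IsTimeCutoff T τ ζ) (hτ : τ < T) {F : ℝ × E d → ℝ}
    (hF : ContDiffOn ℝ 1 F (Ico 0 T ×ˢ closure Ω)) {t : ℝ} (ht : t ∈ Ioo 0 τ) {x : E d}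
    (hx : x ∈ closure Ω) :
    dt T (fun p => F (ζ p.1, p.2)) t x = derivWithin (fun s => F (s, x)) (Ico 0 T) t := by
  have h1 := hasDerivAt_slice hF ⟨ht.1, ht.2.trans hτ⟩ hx
  have h2 : HasDerivAt (fun s => F (ζ s, x)) (derivWithin (fun s => F (s, x)) (Ico 0 T) t) t :=
    h1.congr_of_eventuallyEq (by
      filter_upwards [Ioo_mem_nhds ht.1 ht.2] with s hs
      rw [hζ.eq_self s (Ioo_subset_Icc_self hs)])
  exact h2.hasDerivWithinAt.derivWithin
    (uniqueDiffOn_Icc (ht.1.trans (ht.2.trans hτ)) _ ⟨ht.1.le, (ht.2.trans hτ).le⟩)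

end IsTimeCutoff

/-- Gronwall's inequality for integrable functions. -/
lemma ae_eq_zero_of_le_mul_integral {τ C : ℝ} (hτ : 0 < τ) {e : ℝ → ℝ}
    (he : IntegrableOn e (Ioo 0 τ)) (h0 : ∀ᵐ t ∂(volume.restrict (Ioo 0 τ)), 0 ≤ e t)
    (hle : ∀ᵐ t ∂(volume.restrict (Ioo 0 τ)), e t ≤ C * ∫ s in (0 : ℝ)..t, e s) :
    ∀ᵐ t ∂(volume.restrict (Ioo 0 τ)), e t = 0 := by
  let f : ℝ → ℝ := fun t => ∫ s in (0 : ℝ)..t, e s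
  have hr : volume.restrict (Ioc 0 τ) = volume.restrict (Ioo 0 τ) :=
    (Measure.restrict_congr_set Ioo_ae_eq_Ioc).symm
  have heI : IntervalIntegrable e volume 0 τ := by
    rw [intervalIntegrable_iff, uIoc_of_le hτ.le, IntegrableOn, hr]; exact he
  have hfc : ContinuousOn f (Icc 0 τ) := by
    have := intervalIntegral.continuousOn_primitive_interval' heI left_mem_uIcc
    rwa [uIcc_of_le hτ.le] at this
  have hsub : ∀ t ∈ Icc 0 τ, volume.restrict (Ioc 0 t) ≤ volume.restrict (Ioo 0 τ) := fun t ht => by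
    rw [← hr]; exact Measure.restrict_mono (Ioc_subset_Ioc_right ht.2) le_rfl
  have hf0 : ∀ t ∈ Icc 0 τ, 0 ≤ f t := fun t ht => by
    simp only [f]
    rw [intervalIntegral.integral_of_le ht.1]
    exact integral_nonneg_of_ae (ae_mono (hsub t ht) h0)
  have hfint : ∀ t ∈ Icc 0 τ, IntervalIntegrable f volume 0 t := fun t ht =>
    (hfc.mono (by rw [uIcc_of_le ht.1]; exact Icc_subset_Icc_right ht.2)).intervalIntegrable
  have hfle : ∀ t ∈ Icc 0 τ, f t ≤ C * ∫ s in (0 : ℝ)..t, f s := by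
    intro t ht
    rw [← intervalIntegral.integral_const_mul]
    refine intervalIntegral.integral_mono_ae_restrict ht.1
      (heI.mono_set (by
        rw [uIcc_of_le ht.1, uIcc_of_le hτ.le]; exact Icc_subset_Icc_right ht.2))
      ((hfint t ht).const_mul C) ?_
    have : volume.restrict (Icc 0 t) = volume.restrict (Ioc 0 t) :=
      Measure.restrict_congr_set Ioc_ae_eq_Icc.symm
    rw [this]
    exact ae_mono (hsub t ht) hle
  let G : ℝ → ℝ := fun t => ∫ s in (0 : ℝ)..t, f s
  have hG0 : ∀ t ∈ Icc 0 τ, 0 ≤ G t := fun t ht =>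
    intervalIntegral.integral_nonneg ht.1 fun s hs => hf0 s ⟨hs.1, hs.2.trans ht.2⟩
  have hGc : ContinuousOn G (Icc 0 τ) := by
    have := intervalIntegral.continuousOn_primitive_interval'
      (hfint τ (right_mem_Icc.2 hτ.le)) left_mem_uIcc
    rwa [uIcc_of_le hτ.le] at this
  have hGd : ∀ t ∈ Ico 0 τ, HasDerivWithinAt G (f t) (Ici t) t := by
    intro t ht
    have hmem : Icc 0 τ ∈ 𝓝[>] t := by
      filter_upwards [Ioo_mem_nhdsGT ht.2] with s hs
      exact ⟨ht.1.trans hs.1.le, hs.2.le⟩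
    refine intervalIntegral.integral_hasDerivWithinAt_right
      (hfint t (Ico_subset_Icc_self ht)) ?_ ?_ (t := Ioi t)
    · exact ⟨Icc 0 τ, hmem, hfc.aestronglyMeasurable measurableSet_Icc⟩
    · exact ((hfc t (Ico_subset_Icc_self ht)).mono_of_mem_nhdsWithin hmem)
  have hGz : ∀ t ∈ Icc 0 τ, G t = 0 := by
    intro t ht
    have h := norm_le_gronwallBound_of_norm_deriv_right_le (δ := 0) (K := C) (ε := 0) hGc hGd
      (by simp [G]) (fun t ht => by
        have ht' := Ico_subset_Icc_self ht
        rw [Real.norm_of_nonneg (hf0 t ht'), Real.norm_of_nonneg (hG0 t ht'), add_zero]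
        exact hfle t ht') t ht
    rw [gronwallBound_ε0_δ0] at h
    exact norm_le_zero_iff.1 h
  have hfz : f τ = 0 := by
    have ht := right_mem_Icc.2 hτ.le
    refine le_antisymm ?_ (hf0 τ ht)
    have := hfle τ ht
    rwa [show ∫ s in (0 : ℝ)..τ, f s = 0 from hGz τ ht, mul_zero] at this
  have h3 : ∫ s in Ioo 0 τ, e s = 0 := by
    rw [← hr, ← intervalIntegral.integral_of_le hτ.le]; exact hfz
  exact (integral_eq_zero_iff_of_nonneg_ae h0 he).1 h3

lemma abs_sum_sum_mul_le {a : Fin d → Fin d → ℝ} {B : ℝ} (ha : ∀ i j, |a i j| ≤ B)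
    (w : Fin d → ℝ) : |∑ i, ∑ j, w i * w j * a i j| ≤ B * d * ∑ i, w i ^ 2 := by
  have h1 : ∀ i j, |w i * w j * a i j| ≤ B * ((w i ^ 2 + w j ^ 2) / 2) := by
    intro i j
    have h2 : |w i * w j| ≤ (w i ^ 2 + w j ^ 2) / 2 := by
      rw [abs_mul, ← sq_abs (w i), ← sq_abs (w j)]
      nlinarith [sq_nonneg (|w i| - |w j|)]
    rw [abs_mul, mul_comm]
    exact mul_le_mul (ha i j) h2 (abs_nonneg _) ((abs_nonneg _).trans (ha i j))
  refine (Finset.abs_sum_le_sum_abs _ _).trans ((Finset.sum_le_sum fun i _ =>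
    (Finset.abs_sum_le_sum_abs _ _).trans (Finset.sum_le_sum fun j _ => h1 i j)).trans
    (le_of_eq ?_))
  simp_rw [← Finset.mul_sum, ← Finset.sum_div, Finset.sum_add_distrib, Finset.sum_const,
    Finset.card_univ, Fintype.card_fin, nsmul_eq_mul, ← Finset.mul_sum]
  ring

lemma ae_restrict_Ioo_of_forall_lt {T : ℝ} {P : ℝ → Prop}
    (h : ∀ τ, 0 < τ → τ < T → ∀ᵐ t ∂(volume.restrict (Ioo 0 τ)), P t) :
    ∀ᵐ t ∂(volume.restrict (Ioo 0 T)), P t := by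
  rcases le_or_gt T 0 with hT | hT
  · simp [Ioo_eq_empty_of_le hT]
  have hU : Ioo 0 T = ⋃ n : ℕ, Ioo 0 (T - T / ((n : ℝ) + 2)) := by
    ext t
    simp only [mem_iUnion, mem_Ioo]
    constructor
    · rintro ⟨h0, h1⟩
      obtain ⟨n, hn⟩ := exists_nat_gt (T / (T - t))
      refine ⟨n, h0, ?_⟩
      have h2 : 0 < T - t := by linarith
      rw [div_lt_iff₀ h2] at hn
      have h3 : T / ((n : ℝ) + 2) < T - t := by
        rw [div_lt_iff₀ (by positivity)]; nlinarith
      linarith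
    · rintro ⟨n, h0, h1⟩
      have : 0 < T / ((n : ℝ) + 2) := by positivity
      exact ⟨h0, by linarith⟩
  rw [hU, ae_restrict_iUnion_iff]
  intro n
  have h2 : T / ((n : ℝ) + 2) < T := div_lt_self hT (by have := n.cast_nonneg (α := ℝ); linarith)
  have h3 : 0 < T / ((n : ℝ) + 2) := by positivity
  exact h _ (by linarith) (by linarith)

/-! ### The kinetic part of the relative energy -/

/-- The Young measure and the concentration measures generated by the sequence `z`. -/
structure GeneratedBy (T : ℝ) (Ω : Set (E d)) (z : ℕ → ℝ × E d → Phase d)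
    (ν : ℝ × E d → Measure (Phase d)) (m : ℝ → Defects d) : Prop where
  young : IsYoungMeasureOf (cyl T Ω) z ν
  rho : IsConcentrationMeasure T Ω z ν fRho (fun t => (m t).rho)
  mom : ∀ i, IsConcentrationMeasure T Ω z ν (fMom i) (fun t => (m t).mom i)
  conv : ∀ i j, IsConcentrationMeasure T Ω z ν (fConv i j) (fun t => (m t).conv i j)
  kin : IsConcentrationMeasure T Ω z ν fKin (fun t => (m t).kin)
  gradSq : IsConcentrationMeasure T Ω z ν fGradSq (fun t => (m t).gradSq)
  gradTensor : ∀ i j,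
    IsConcentrationMeasure T Ω z ν (fGradTensor i j) (fun t => (m t).gradTensor i j)

lemma continuous_fRho : Continuous (fRho (d := d)) := by unfold fRho; fun_prop
lemma continuous_fMom (i : Fin d) : Continuous (fMom i) := by unfold fMom; fun_prop
lemma continuous_fConv (i j : Fin d) : Continuous (fConv i j) := by unfold fConv; fun_prop
lemma continuous_fKin : Continuous (fKin (d := d)) := by unfold fKin; fun_prop
lemma continuous_fGrad (i : Fin d) : Continuous (fGrad i) := by unfold fGrad; fun_prop
lemma continuous_fGradSq : Continuous (fGradSq (d := d)) := by unfold fGradSq; fun_prop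
lemma continuous_fGradTensor (i j : Fin d) : Continuous (fGradTensor i j) := by
  unfold fGradTensor; fun_prop

/-- The conditions under which a concentration measure and an oscillation measure at one time can
be integrated against functions that are continuous up to the boundary. -/
structure IsBarState (Ω : Set (E d)) (ν : E d → Measure (Phase d)) (f : Phase d → ℝ)
    (μ : SignedMeasure (E d)) : Prop where
  integrable : IntegrableOn (fun x => ∫ y, f y ∂(ν x)) Ω
  supported : μ.totalVariation (closure Ω)ᶜ = 0

lemma IsConcentrationMeasure.ae_isBarState {T : ℝ} {Ω : Set (E d)}
    {z : ℕ → ℝ × E d → Phase d} {ν : ℝ × E d → Measure (Phase d)} {f : Phase d → ℝ}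
    {m : ℝ → SignedMeasure (E d)} (h : IsConcentrationMeasure T Ω z ν f m) :
    ∀ᵐ t ∂(volume.restrict (Ioo 0 T)), IsBarState Ω (fun x => ν (t, x)) f (m t) := by
  obtain ⟨h1, -, -, h4, -⟩ := h
  rw [restrict_cyl] at h4
  filter_upwards [h1.2.2, h4.prod_right_ae] with t h5 h6 using ⟨h6, h5⟩

namespace IsBarState

variable {Ω : Set (E d)} {ν : E d → Measure (Phase d)} {f : Phase d → ℝ}
  {μ : SignedMeasure (E d)}

lemma barInt_congr (hΩ : IsOpen Ω) (h : IsBarState Ω ν f μ) {c c' : E d → ℝ}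
    (hc : ∀ x ∈ closure Ω, c x = c' x) : barInt Ω ν f μ c = barInt Ω ν f μ c' := by
  rw [barInt, barInt, sint_congr h.supported hc]
  congr 1
  exact setIntegral_congr_fun hΩ.measurableSet fun x hx => by
    simp only [hc x (subset_closure hx)]

lemma barInt_const_mul (a : ℝ) (c : E d → ℝ) :
    barInt Ω ν f μ (fun x => a * c x) = a * barInt Ω ν f μ c := by
  simp_rw [barInt, sint_const_mul, mul_left_comm _ a, integral_const_mul, mul_add]

lemma barInt_add (hΩ : IsOpen Ω) (hb : Bornology.IsBounded Ω) (h : IsBarState Ω ν f μ)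
    {c c' : E d → ℝ} (hc : ContinuousOn c (closure Ω)) (hc' : ContinuousOn c' (closure Ω)) :
    barInt Ω ν f μ (fun x => c x + c' x) = barInt Ω ν f μ c + barInt Ω ν f μ c' := by
  simp_rw [barInt, sint_add hb h.supported hc hc', mul_add]
  rw [integral_add (integrableOn_mul_continuousOn hΩ hb h.integrable hc)
    (integrableOn_mul_continuousOn hΩ hb h.integrable hc')]
  ring

lemma barInt_sub (hΩ : IsOpen Ω) (hb : Bornology.IsBounded Ω) (h : IsBarState Ω ν f μ)
    {c c' : E d → ℝ} (hc : ContinuousOn c (closure Ω)) (hc' : ContinuousOn c' (closure Ω)) :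
    barInt Ω ν f μ (fun x => c x - c' x) = barInt Ω ν f μ c - barInt Ω ν f μ c' := by
  have h1 := h.barInt_add hΩ hb hc (c' := fun x => (-1) * c' x) (continuousOn_const.mul hc')
  rw [barInt_const_mul] at h1
  simp only [neg_one_mul, ← sub_eq_add_neg] at h1
  exact h1

end IsBarState

/-- Twice the kinetic relative energy `∫ |v - U|² s` of a measure-valued state with respect to the
velocity field `U`. -/
def kinRel (Ω : Set (E d)) (ν : E d → Measure (Phase d)) (m : Defects d) (U : E d → E d) : ℝ :=
  barInt Ω ν fKin m.kin (fun _ => 1) - 2 * ∑ i, barInt Ω ν (fMom i) (m.mom i) (fun x => U x i)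
    + barInt Ω ν fRho m.rho (fun x => ∑ i, U x i ^ 2)

/-- The scalar test function `½|U|² - ½|x|² - Φ` of the relative energy estimate: tested with the
density, it completes the square in the kinetic energy and, by the Poisson equation, in the field
energy, and it cancels the energy of the confining potential. -/
def testPotential (U : ℝ → E d → E d) (Φ : ℝ → E d → ℝ) (p : ℝ × E d) : ℝ :=
  (1 / 2) * (∑ i, U p.1 p.2 i ^ 2) - (1 / 2) * ‖p.2‖ ^ 2 - Φ p.1 p.2

/-- The material derivative `∂_t Φ + U · ∇Φ` of the potential. -/
def matDeriv (T : ℝ) (Ω : Set (E d)) (U : ℝ → E d → E d) (Φ : ℝ → E d → ℝ) (t : ℝ) (x : E d) : ℝ :=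
  tderiv T Φ t x + ∑ k, U t x k * pd Ω k (Φ t) x

/-- The part of the rate of change of the relative energy that involves density and velocity. The
last term is compensated in `gradRate`; it removes `Φ` from the integrand. -/
def kinRate (T γ : ℝ) (Ω : Set (E d)) (U : ℝ → E d → E d) (Φ : ℝ → E d → ℝ)
    (ν : E d → Measure (Phase d)) (m : Defects d) (t : ℝ) : ℝ :=
  - γ * barInt Ω ν fKin m.kin (fun _ => 1)
    + barInt Ω ν fRho m.rho (fun x => tderiv T (fun s y => testPotential U Φ (s, y)) t x)
    + (∑ i, barInt Ω ν (fMom i) (m.mom i) (fun x => pd Ω i (fun y => testPotential U Φ (t, y)) x))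
    - (∑ i, barInt Ω ν (fMom i) (m.mom i) (fun x => tderiv T (fun s y => U s y i) t x))
    - (∑ i, ∑ j, barInt Ω ν (fConv i j) (m.conv i j) (fun x => pd Ω j (fun y => U t y i) x))
    + γ * (∑ i, barInt Ω ν (fMom i) (m.mom i) (fun x => U t x i))
    + barInt Ω ν fRho m.rho (fun x => inner ℝ x (U t x))
    + barInt Ω ν fRho m.rho (fun x => matDeriv T Ω U Φ t x)

/-- The algebra of the relative energy: inserting the velocity equation, the integrand of the
kinetic rate becomes quadratic in `v - u`. -/
lemma kinetic_identity {a : Fin d → Fin d → ℝ} {u v x φ w : Fin d → ℝ} {γ s b : ℝ}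
    (hvel : ∀ i, w i + ∑ j, u j * a i j = - γ * u i - φ i - x i) :
    - γ * (s * ∑ i, v i ^ 2) + ((∑ i, u i * w i) - b) * s
      + (∑ i, ((∑ k, u k * a k i) - x i - φ i) * (s * v i)) - (∑ i, w i * (s * v i))
      - (∑ i, ∑ j, a i j * (s * (v i * v j))) + γ * (∑ i, u i * (s * v i))
      + (∑ i, x i * u i) * s + (b + ∑ i, u i * φ i) * s
      = - γ * (s * ∑ i, (v i - u i) ^ 2)
        - s * ∑ i, ∑ j, (v i - u i) * (v j - u j) * a i j := by
  have hw : w = fun i => - γ * u i - φ i - x i - ∑ j, u j * a i j := by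
    funext i; linarith [hvel i]
  subst hw
  have e1 : ∑ i, u i * (- γ * u i - φ i - x i - ∑ j, u j * a i j)
      = - γ * (∑ i, u i ^ 2) - (∑ i, u i * φ i) - (∑ i, x i * u i)
        - ∑ i, ∑ j, u i * u j * a i j := by
    simp only [Finset.mul_sum, ← Finset.sum_sub_distrib]
    refine Finset.sum_congr rfl fun i _ => ?_
    simp only [mul_sub, Finset.mul_sum, mul_assoc]; ring
  have e2 : ∑ i, ((∑ k, u k * a k i) - x i - φ i) * (s * v i)
      = s * (∑ i, ∑ j, u i * v j * a i j) - s * (∑ i, x i * v i) - s * ∑ i, φ i * v i := by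
    have : ∑ i, ∑ j, u i * v j * a i j = ∑ i, (∑ k, u k * a k i) * v i := by
      rw [Finset.sum_comm]
      refine Finset.sum_congr rfl fun i _ => ?_
      rw [Finset.sum_mul]
      exact Finset.sum_congr rfl fun j _ => by ring
    rw [this]
    simp only [Finset.mul_sum, ← Finset.sum_sub_distrib]
    exact Finset.sum_congr rfl fun i _ => by ring
  have e3 : ∑ i, (- γ * u i - φ i - x i - ∑ j, u j * a i j) * (s * v i)
      = - γ * s * (∑ i, u i * v i) - s * (∑ i, φ i * v i) - s * (∑ i, x i * v i)
        - s * ∑ i, ∑ j, v i * u j * a i j := by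
    have : ∀ i, ∑ j, v i * u j * a i j = v i * ∑ j, u j * a i j := fun i => by
      rw [Finset.mul_sum]; exact Finset.sum_congr rfl fun j _ => by ring
    simp only [this]
    simp only [Finset.mul_sum _ _ s, Finset.mul_sum _ _ (- γ * s), ← Finset.sum_sub_distrib]
    exact Finset.sum_congr rfl fun i _ => by ring
  have e4 : ∑ i, ∑ j, a i j * (s * (v i * v j)) = s * ∑ i, ∑ j, v i * v j * a i j := by
    simp only [Finset.mul_sum]
    exact Finset.sum_congr rfl fun i _ => Finset.sum_congr rfl fun j _ => by ring
  have e5 : ∑ i, u i * (s * v i) = s * ∑ i, u i * v i := by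
    simp only [Finset.mul_sum]
    exact Finset.sum_congr rfl fun i _ => by ring
  have e6 : ∑ i, (v i - u i) ^ 2 = (∑ i, v i ^ 2) - 2 * (∑ i, u i * v i) + ∑ i, u i ^ 2 := by
    simp only [Finset.mul_sum, ← Finset.sum_sub_distrib, ← Finset.sum_add_distrib]
    exact Finset.sum_congr rfl fun i _ => by ring
  have e7 : ∑ i, ∑ j, (v i - u i) * (v j - u j) * a i j
      = (∑ i, ∑ j, v i * v j * a i j) - (∑ i, ∑ j, v i * u j * a i j)
        - (∑ i, ∑ j, u i * v j * a i j) + ∑ i, ∑ j, u i * u j * a i j := by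
    simp only [← Finset.sum_sub_distrib, ← Finset.sum_add_distrib]
    exact Finset.sum_congr rfl fun i _ => Finset.sum_congr rfl fun j _ => by ring
  rw [e1, e2, e3, e4, e5, e6, e7]
  ring

section Coefficients

variable {T γ : ℝ} {Ω : Set (E d)} {r : ℝ → E d → ℝ} {U : ℝ → E d → E d} {Φ : ℝ → E d → ℝ}
  {g : E d → ℝ}

lemma continuousOn_pd_slice (hu : UniqueDiffOn ℝ (closure Ω)) {F : ℝ × E d → ℝ}
    (hF : ContDiffOn ℝ 1 F (Ico 0 T ×ˢ closure Ω)) (i : Fin d) :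
    ContinuousOn (fun p : ℝ × E d => pd Ω i (fun y => F (p.1, y)) p.2)
      (Ico 0 T ×ˢ closure Ω) :=
  (contDiffOn_pd_slice (n := 0) (uniqueDiffOn_Ico_zero T) hu (by simpa using hF) i).continuousOn

lemma continuousOn_tderiv (hu : UniqueDiffOn ℝ (closure Ω)) {F : ℝ → E d → ℝ}
    (hF : ContDiffOn ℝ 1 (fun p : ℝ × E d => F p.1 p.2) (Ico 0 T ×ˢ closure Ω)) :
    ContinuousOn (fun p : ℝ × E d => tderiv T F p.1 p.2) (Ico 0 T ×ˢ closure Ω) :=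
  (contDiffOn_derivWithin_slice (n := 0) (F := fun p : ℝ × E d => F p.1 p.2)
    (uniqueDiffOn_Ico_zero T) hu (by simpa using hF)).continuousOn

namespace IsStrongSolution

lemma contDiffOn_testPotential (hs : IsStrongSolution T γ Ω r U Φ) :
    ContDiffOn ℝ 1 (testPotential U Φ) (Ico 0 T ×ˢ closure Ω) := by
  refine ContDiffOn.sub (ContDiffOn.sub (contDiffOn_const.mul ?_) ?_) (hs.Φ_C2.of_le (by simp))
  · exact ContDiffOn.sum fun i _ => (hs.contDiffOn_U i).pow 2
  · exact (contDiff_const.mul (contDiff_snd.norm_sq ℝ)).contDiffOn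

lemma continuousOn_matDeriv (hg : IsDefiningFunction g Ω) (hs : IsStrongSolution T γ Ω r U Φ) :
    ContinuousOn (fun p : ℝ × E d => matDeriv T Ω U Φ p.1 p.2) (Ico 0 T ×ˢ closure Ω) := by
  refine ContinuousOn.add (hs.contDiffOn_tderiv_potential hg).continuousOn ?_
  exact continuousOn_finsetSum _ fun k _ =>
    (hs.contDiffOn_U k).continuousOn.mul (hs.contDiffOn_grad hg k).continuousOn

lemma tderiv_testPotential (hs : IsStrongSolution T γ Ω r U Φ) {t : ℝ}
    (ht : t ∈ Ioo 0 T) {x : E d} (hx : x ∈ closure Ω) :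
    tderiv T (fun s y => testPotential U Φ (s, y)) t x
      = (∑ i, U t x i * tderiv T (fun s y => U s y i) t x) - tderiv T Φ t x := by
  have hU : ∀ i, HasDerivAt (fun s => U s x i) (tderiv T (fun s y => U s y i) t x) t :=
    fun i => hasDerivAt_slice (hs.contDiffOn_U i) ht hx
  have hΦ : HasDerivAt (fun s => Φ s x) (tderiv T Φ t x) t :=
    hasDerivAt_slice (hs.Φ_C2.of_le (by simp) : ContDiffOn ℝ 1 _ _) ht hx
  have h1 : HasDerivAt (fun s => testPotential U Φ (s, x))
      ((1 / 2) * (∑ i, (2 : ℕ) * U t x i ^ (2 - 1) * tderiv T (fun s y => U s y i) t x)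
        - tderiv T Φ t x) t := by
    simp only [testPotential]
    exact ((((HasDerivAt.fun_sum fun i _ => (hU i).fun_pow 2)).const_mul (1 / 2)).sub_const _).fun_sub hΦ
  have h2 := h1.hasDerivWithinAt.derivWithin
    (uniqueDiffOn_Ico_zero T _ (Ioo_subset_Ico_self ht))
  rw [tderiv, h2, Finset.mul_sum]
  congr 1
  exact Finset.sum_congr rfl fun i _ => by norm_num; ring

lemma pd_testPotential (hΩ : IsOpen Ω) (hs : IsStrongSolution T γ Ω r U Φ) {t : ℝ}
    (ht : t ∈ Ioo 0 T) {x : E d} (hx : x ∈ Ω) (i : Fin d) :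
    pd Ω i (fun y => testPotential U Φ (t, y)) x
      = (∑ k, U t x k * pd Ω i (fun y => U t y k) x) - x i - pd Ω i (Φ t) x := by
  have ht' := Ioo_subset_Ico_self ht
  have hU := fun k => hs.contDiffOn_U_slice k ht'
  have hΦ : ContDiffOn ℝ 1 (Φ t) (closure Ω) :=
    (hs.contDiffOn_potential_slice ht').of_le (by simp)
  have hn : ContDiff ℝ 1 (fun y : E d => (1 / 2) * ‖y‖ ^ 2) :=
    contDiff_const.mul (contDiff_norm_sq ℝ)
  have hS : ContDiffOn ℝ 1 (fun y => ∑ k, U t y k * U t y k) (closure Ω) :=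
    ContDiffOn.sum fun k _ => (hU k).mul (hU k)
  have e : (fun y => testPotential U Φ (t, y))
      = fun y => ((1 / 2) * (∑ k, U t y k * U t y k) - (1 / 2) * ‖y‖ ^ 2) - Φ t y := by
    funext y; simp only [testPotential, pow_two]
  have e2 : pd Ω i (fun y => (1 / 2) * ‖y‖ ^ 2) x = x i := by
    rw [pd_eq_fderiv hΩ _ _ hx]
    have h3 := ((hasStrictFDerivAt_norm_sq x).hasFDerivAt.const_mul (1 / 2 : ℝ)).fderiv
    rw [h3]
    simp [bv, EuclideanSpace.inner_single_right]
  rw [e, pd_sub hΩ ((contDiffOn_const.mul hS).sub hn.contDiffOn) hΦ i hx,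
    pd_sub hΩ (contDiffOn_const.mul hS) hn.contDiffOn i hx, pd_const_mul hΩ hS _ i hx, e2,
    pd_sum hΩ (fun k => (hU k).mul (hU k)) i hx]
  congr 2
  rw [Finset.mul_sum]
  refine Finset.sum_congr rfl fun k _ => ?_
  rw [pd_mul hΩ (hU k) (hU k) i hx]; ring

lemma exists_bound_pd_U (hg : IsDefiningFunction g Ω) (hb : Bornology.IsBounded Ω)
    (hs : IsStrongSolution T γ Ω r U Φ) {τ : ℝ} (hτ : τ < T) :
    ∃ B : ℝ, 0 ≤ B ∧ ∀ t ∈ Icc 0 τ, ∀ x ∈ closure Ω, ∀ i j,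
      |pd Ω j (fun y => U t y i) x| ≤ B := by
  have h : ∀ i j, ∃ B : ℝ, ∀ p ∈ Icc 0 τ ×ˢ closure Ω,
      ‖pd Ω j (fun y => U p.1 y i) p.2‖ ≤ B := fun i j =>
    (isCompact_Icc.prod hb.isCompact_closure).exists_bound_of_continuousOn
      ((continuousOn_pd_slice hg.uniqueDiffOn_closure (hs.contDiffOn_U i) j).mono
        (prod_mono (fun s hs => ⟨hs.1, hs.2.trans_lt hτ⟩) subset_rfl))
  choose B hB using h
  refine ⟨∑ i, ∑ j, |B i j|, by positivity, fun t ht x hx i j => ?_⟩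
  refine (hB i j (t, x) ⟨ht, hx⟩).trans ((le_abs_self _).trans ?_)
  exact (Finset.single_le_sum (f := fun j => |B i j|) (fun _ _ => abs_nonneg _)
    (Finset.mem_univ j)).trans (Finset.single_le_sum (f := fun i => ∑ j, |B i j|)
    (fun _ _ => Finset.sum_nonneg fun _ _ => abs_nonneg _) (Finset.mem_univ i))

end IsStrongSolution

end Coefficients

/-! ### Control of the kinetic rate -/

namespace GeneratedBy

variable {T γ τ : ℝ} {Ω : Set (E d)} {r : ℝ → E d → ℝ} {U : ℝ → E d → E d} {Φ : ℝ → E d → ℝ}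
  {g : E d → ℝ} {z : ℕ → ℝ × E d → Phase d} {ν : ℝ × E d → Measure (Phase d)}
  {m : ℝ → Defects d} {ζ : ℝ → ℝ}

lemma hasLimit_kinRel (hg : IsDefiningFunction g Ω) (hb : Bornology.IsBounded Ω)
    (hs : IsStrongSolution T γ Ω r U Φ) (hζ : IsTimeCutoff T τ ζ) (hz : GeneratedBy T Ω z ν m) :
    HasLimit T Ω z ν
      (fun p y => 1 * fKin y - 2 * (∑ i, U (ζ p.1) p.2 i * fMom i y)
        + (∑ i, U (ζ p.1) p.2 i ^ 2) * fRho y)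
      (fun t => kinRel Ω (fun x => ν (t, x)) (m t) (U (ζ t)))
      (fun t => sint (m t).kin (fun _ => 1)
        - 2 * (∑ i, sint ((m t).mom i) (fun x => U (ζ t) x i))
        + sint (m t).rho (fun x => ∑ i, U (ζ t) x i ^ 2)) := by
  have hΩ := hg.isOpen
  have hz' := hz.young.2.1
  have hU : ∀ i, ContinuousOn (fun p : ℝ × E d => U (ζ p.1) p.2 i) (Icc 0 T ×ˢ closure Ω) :=
    fun i => hζ.continuousOn_comp (hs.contDiffOn_U i).continuousOn
  exact ((HasLimit.of_concentration hΩ hb hz.young continuous_fKin hz.kin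
      (c := fun _ => 1) continuousOn_const).sub hΩ hb hz'
    ((HasLimit.sum hΩ hb hz' Finset.univ fun i => HasLimit.of_concentration hΩ hb hz.young
      (continuous_fMom i) (hz.mom i) (hU i)).const_mul 2)).add hΩ hb hz'
    (HasLimit.of_concentration hΩ hb hz.young continuous_fRho hz.rho
      (c := fun p => ∑ i, U (ζ p.1) p.2 i ^ 2)
      (continuousOn_finsetSum _ fun i _ => (hU i).pow 2))

lemma hasLimit_kinRate (hg : IsDefiningFunction g Ω) (hb : Bornology.IsBounded Ω)
    (hs : IsStrongSolution T γ Ω r U Φ) (hζ : IsTimeCutoff T τ ζ) (hz : GeneratedBy T Ω z ν m) :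
    ∃ D, HasLimit T Ω z ν
      (fun p y => - γ * (1 * fKin y)
        + tderiv T (fun s y => testPotential U Φ (s, y)) (ζ p.1) p.2 * fRho y
        + (∑ i, pd Ω i (fun y => testPotential U Φ (ζ p.1, y)) p.2 * fMom i y)
        - (∑ i, tderiv T (fun s y => U s y i) (ζ p.1) p.2 * fMom i y)
        - (∑ i, ∑ j, pd Ω j (fun y => U (ζ p.1) y i) p.2 * fConv i j y)
        + γ * (∑ i, U (ζ p.1) p.2 i * fMom i y)
        + inner ℝ p.2 (U (ζ p.1) p.2) * fRho y
        + matDeriv T Ω U Φ (ζ p.1) p.2 * fRho y)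
      (fun t => kinRate T γ Ω U Φ (fun x => ν (t, x)) (m t) (ζ t)) D := by
  have hΩ := hg.isOpen
  have hu := hg.uniqueDiffOn_closure
  have hz' := hz.young.2.1
  have hU : ∀ i, ContinuousOn (fun p : ℝ × E d => U (ζ p.1) p.2 i) (Icc 0 T ×ˢ closure Ω) :=
    fun i => hζ.continuousOn_comp (hs.contDiffOn_U i).continuousOn
  have hψ := hs.contDiffOn_testPotential
  refine ⟨_, (((((((((HasLimit.of_concentration hΩ hb hz.young continuous_fKin hz.kin
      (c := fun _ => 1) continuousOn_const).const_mul (-γ)).add hΩ hb hz'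
    (HasLimit.of_concentration hΩ hb hz.young continuous_fRho hz.rho
      (hζ.continuousOn_comp (continuousOn_tderiv hu hψ)))).add hΩ hb hz'
    (HasLimit.sum hΩ hb hz' Finset.univ fun i => HasLimit.of_concentration hΩ hb hz.young
      (continuous_fMom i) (hz.mom i) (hζ.continuousOn_comp (continuousOn_pd_slice hu hψ i)))).sub
        hΩ hb hz'
    (HasLimit.sum hΩ hb hz' Finset.univ fun i => HasLimit.of_concentration hΩ hb hz.young
      (continuous_fMom i) (hz.mom i) (hζ.continuousOn_comp
        (continuousOn_tderiv hu (hs.contDiffOn_U i))))).sub hΩ hb hz'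
    (HasLimit.sum hΩ hb hz' Finset.univ fun i => HasLimit.sum hΩ hb hz' Finset.univ fun j =>
      HasLimit.of_concentration hΩ hb hz.young (continuous_fConv i j) (hz.conv i j)
        (hζ.continuousOn_comp (continuousOn_pd_slice hu (hs.contDiffOn_U i) j)))).add hΩ hb hz'
    ((HasLimit.sum hΩ hb hz' Finset.univ fun i => HasLimit.of_concentration hΩ hb hz.young
      (continuous_fMom i) (hz.mom i) (hU i)).const_mul γ)).add hΩ hb hz'
    (HasLimit.of_concentration hΩ hb hz.young continuous_fRho hz.rho
      (c := fun p => inner ℝ p.2 (U (ζ p.1) p.2))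
      (continuousOn_snd.inner (hζ.contDiffOn_comp hs.U_C1).continuousOn))).add hΩ hb hz'
    (HasLimit.of_concentration hΩ hb hz.young continuous_fRho hz.rho
      (hζ.continuousOn_comp (hs.continuousOn_matDeriv hg))))⟩

/-- The kinetic rate is controlled by the kinetic relative energy. -/
lemma kinRate_le (hg : IsDefiningFunction g Ω) (hb : Bornology.IsBounded Ω)
    (hs : IsStrongSolution T γ Ω r U Φ) (hγ : 0 ≤ γ) (h0 : 0 < τ) (hτ : τ < T)
    (hz : GeneratedBy T Ω z ν m) {B : ℝ}
    (hB : ∀ t ∈ Icc 0 τ, ∀ x ∈ closure Ω, ∀ i j, |pd Ω j (fun y => U t y i) x| ≤ B) :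
    ∀ᵐ t ∂(volume.restrict (Ioo 0 τ)), kinRate T γ Ω U Φ (fun x => ν (t, x)) (m t) t
      ≤ B * d * kinRel Ω (fun x => ν (t, x)) (m t) (U t) := by
  have hΩ := hg.isOpen
  obtain ⟨ζ, hζ⟩ := exists_isTimeCutoff h0 hτ
  obtain ⟨D, H2⟩ := hz.hasLimit_kinRate hg hb hs hζ
  have H1 := hz.hasLimit_kinRel hg hb hs hζ
  have H := (H1.const_mul (B * d)).sub hΩ hb hz.young.2.1 H2
  have hpos := H.total_nonneg hΩ hτ.le fun t ht x hx y => by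
    have htT : t ∈ Ioo 0 T := ⟨ht.1, ht.2.trans hτ⟩
    have hxK := subset_closure hx
    simp only [hζ.eq_self t (Ioo_subset_Icc_self ht)]
    rw [hs.tderiv_testPotential htT hxK]
    simp only [hs.pd_testPotential hΩ htT hx, PiLp.inner_apply, RCLike.inner_apply, conj_trivial,
      matDeriv, fKin, fRho, fMom, fConv, EuclideanSpace.real_norm_sq_eq, one_mul]
    have key := kinetic_identity (a := fun i j => pd Ω j (fun y => U t y i) x) (u := fun i => U t x i)
      (v := fun i => y.1.2 i) (x := fun i => x i) (φ := fun i => pd Ω i (Φ t) x)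
      (w := fun i => tderiv T (fun s y => U s y i) t x) (γ := γ) (s := y.1.1) (b := tderiv T Φ t x)
      (fun i => hs.velocity_eq hΩ htT hx i)
    simp only [mul_comm (U t x _) (x _)] at key ⊢
    rw [key]
    have hq := (abs_le.1 (abs_sum_sum_mul_le (hB t (Ioo_subset_Icc_self ht) x hxK)
      (fun i => y.1.2 i - U t x i))).1
    have hs0 : (0 : ℝ) ≤ y.1.1 := y.1.1.2
    have e5 : ∑ i, U t x i * (y.1.1 * y.1.2 i) = y.1.1 * ∑ i, U t x i * y.1.2 i := by
      rw [Finset.mul_sum]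
      exact Finset.sum_congr rfl fun i _ => by ring
    have e6 : ∑ i, (y.1.2 i - U t x i) ^ 2
        = (∑ i, y.1.2 i ^ 2) - 2 * (∑ i, U t x i * y.1.2 i) + ∑ i, U t x i ^ 2 := by
      simp only [Finset.mul_sum, ← Finset.sum_sub_distrib, ← Finset.sum_add_distrib]
      exact Finset.sum_congr rfl fun i _ => by ring
    have h6 : 0 ≤ ∑ i, (y.1.2 i - U t x i) ^ 2 := Finset.sum_nonneg fun _ _ => sq_nonneg _
    have h7 := mul_nonneg hγ (mul_nonneg hs0 h6)
    have h8 := mul_nonneg hs0 (neg_le_iff_add_nonneg'.1 hq)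
    rw [e5]
    rw [e6] at h7 h8 ⊢
    linarith
  filter_upwards [hpos, ae_restrict_mem measurableSet_Ioo] with t h ht
  rw [hζ.eq_self t (Ioo_subset_Icc_self ht)] at h
  linarith

end GeneratedBy

/-! ### The field part of the relative energy -/

/-- Twice the relative energy `∫ |F - φ|²` of the field. The integral of `F` involves no
concentration measure. -/
def gradRel (Ω : Set (E d)) (ν : E d → Measure (Phase d)) (m : Defects d)
    (φ : Fin d → E d → ℝ) : ℝ :=
  barInt Ω ν fGradSq m.gradSq (fun _ => 1)
    - 2 * (∑ i, ∫ x in Ω, (∫ y, fGrad i y ∂(ν x)) * φ i x) + ∫ x in Ω, ∑ i, φ i x ^ 2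

/-- The part of the rate of change of the relative energy that is due to the field. -/
def gradRate (T M : ℝ) (Ω : Set (E d)) (U : ℝ → E d → E d) (Φ : ℝ → E d → ℝ)
    (ν : E d → Measure (Phase d)) (m : Defects d) (t : ℝ) : ℝ :=
  - barInt Ω ν fRho m.rho (fun x => matDeriv T Ω U Φ t x)
    - (1 / 2) * barInt Ω ν fGradSq m.gradSq (fun x => ∑ i, pd Ω i (fun y => U t y i) x)
    + (∑ i, ∑ j, barInt Ω ν (fGradTensor i j) (m.gradTensor i j)
        (fun x => pd Ω j (fun y => U t y i) x))
    + M * (∑ i, ∫ x in Ω, (∫ y, fGrad i y ∂(ν x)) * U t x i)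
    + ∫ x in Ω, (M * tderiv T Φ t x
        + ∑ i, pd Ω i (Φ t) x * tderiv T (fun s y => pd Ω i (Φ s) y) t x)

lemma integrable_fGrad {μ : Measure (Phase d)} [IsFiniteMeasure μ] (h : Integrable fGradSq μ)
    (i : Fin d) : Integrable (fGrad i) μ := by
  refine ((integrable_const (1 : ℝ)).add h).mono' (continuous_fGrad i).aestronglyMeasurable
    (ae_of_all _ fun y => ?_)
  simp only [Pi.add_apply, fGrad, fGradSq, EuclideanSpace.real_norm_sq_eq, Real.norm_eq_abs]
  have h1 : y.2 i ^ 2 ≤ ∑ j, y.2 j ^ 2 :=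
    Finset.single_le_sum (f := fun j => y.2 j ^ 2) (fun _ _ => sq_nonneg _) (Finset.mem_univ i)
  have h2 : |y.2 i| ≤ 1 + y.2 i ^ 2 := by
    rw [← sq_abs]; nlinarith [sq_nonneg (|y.2 i| - 1)]
  linarith

/-- A quadratic form in `F`, integrated against a measure of mass possibly less than one, and
expanded around `φ`. -/
lemma integral_quadratic_form {μ : Measure (Phase d)} [IsFiniteMeasure μ]
    (hF : Integrable fGradSq μ) (hT : ∀ i j, Integrable (fGradTensor i j) μ) (c D : ℝ)
    (a : Fin d → Fin d → ℝ) (φ : Fin d → ℝ) :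
    (∫ y, (c * (1 * fGradSq y) + (1 / 2) * (D * fGradSq y)
        - ∑ i, ∑ j, a i j * fGradTensor i j y) ∂μ)
      + (∑ i, (∫ y, fGrad i y ∂μ)
          * (- 2 * c * φ i + ((∑ k, φ k * a i k) + (∑ k, φ k * a k i) - φ i * D)))
      + (c * (∑ i, φ i ^ 2) + (1 / 2) * D * (∑ i, φ i ^ 2) - ∑ i, ∑ j, φ i * φ j * a i j)
    = (∫ y, (c * (∑ i, (y.2 i - φ i) ^ 2) + (1 / 2) * D * (∑ i, (y.2 i - φ i) ^ 2)
        - ∑ i, ∑ j, (y.2 i - φ i) * (y.2 j - φ j) * a i j) ∂μ)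
      + (1 - μ.real univ) * (c * (∑ i, φ i ^ 2) + (1 / 2) * D * (∑ i, φ i ^ 2)
        - ∑ i, ∑ j, φ i * φ j * a i j) := by
  have hG := integrable_fGrad hF
  set Q : ℝ := c * (∑ i, φ i ^ 2) + (1 / 2) * D * (∑ i, φ i ^ 2) - ∑ i, ∑ j, φ i * φ j * a i j
    with hQ
  let ℓ : Fin d → ℝ := fun i =>
    - 2 * c * φ i + ((∑ k, φ k * a i k) + (∑ k, φ k * a k i) - φ i * D)
  have e : ∀ y : Phase d, c * (∑ i, (y.2 i - φ i) ^ 2) + (1 / 2) * D * (∑ i, (y.2 i - φ i) ^ 2)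
        - ∑ i, ∑ j, (y.2 i - φ i) * (y.2 j - φ j) * a i j
      = (c * (1 * fGradSq y) + (1 / 2) * (D * fGradSq y) - ∑ i, ∑ j, a i j * fGradTensor i j y)
        + (∑ i, fGrad i y * ℓ i) + Q := by
    intro y
    simp only [fGradSq, fGradTensor, fGrad, EuclideanSpace.real_norm_sq_eq, one_mul, ℓ, hQ]
    have e1 : ∑ i, (y.2 i - φ i) ^ 2
        = (∑ i, y.2 i ^ 2) - 2 * (∑ i, y.2 i * φ i) + ∑ i, φ i ^ 2 := by
      simp only [Finset.mul_sum, ← Finset.sum_sub_distrib, ← Finset.sum_add_distrib]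
      exact Finset.sum_congr rfl fun i _ => by ring
    have e2 : ∑ i, ∑ j, (y.2 i - φ i) * (y.2 j - φ j) * a i j
        = (∑ i, ∑ j, a i j * (y.2 i * y.2 j)) - (∑ i, y.2 i * ∑ k, φ k * a i k)
          - (∑ i, y.2 i * ∑ k, φ k * a k i) + ∑ i, ∑ j, φ i * φ j * a i j := by
      have : ∑ i, y.2 i * ∑ k, φ k * a k i = ∑ i, ∑ j, y.2 j * (φ i * a i j) := by
        rw [Finset.sum_comm]
        simp only [Finset.mul_sum]
      rw [this]
      simp only [Finset.mul_sum, ← Finset.sum_sub_distrib, ← Finset.sum_add_distrib]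
      exact Finset.sum_congr rfl fun i _ => Finset.sum_congr rfl fun j _ => by ring
    have e3 : ∑ i, y.2 i * (- 2 * c * φ i + ((∑ k, φ k * a i k) + (∑ k, φ k * a k i) - φ i * D))
        = - 2 * c * (∑ i, y.2 i * φ i) + (∑ i, y.2 i * ∑ k, φ k * a i k)
          + (∑ i, y.2 i * ∑ k, φ k * a k i) - D * ∑ i, y.2 i * φ i := by
      have : ∀ i, y.2 i * (- 2 * c * φ i + ((∑ k, φ k * a i k) + (∑ k, φ k * a k i) - φ i * D))
          = - 2 * c * (y.2 i * φ i) + y.2 i * (∑ k, φ k * a i k) + y.2 i * (∑ k, φ k * a k i)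
            - D * (y.2 i * φ i) := fun i => by ring
      rw [Finset.sum_congr rfl fun i _ => this i, Finset.sum_sub_distrib, Finset.sum_add_distrib,
        Finset.sum_add_distrib, ← Finset.mul_sum, ← Finset.mul_sum]
    rw [e1, e2, e3]; ring
  have i1 : Integrable (fun y => c * (1 * fGradSq y) + (1 / 2) * (D * fGradSq y)
      - ∑ i, ∑ j, a i j * fGradTensor i j y) μ :=
    (((hF.const_mul 1).const_mul c).add ((hF.const_mul D).const_mul (1 / 2))).sub
      (integrable_finsetSum _ fun i _ => integrable_finsetSum _ fun j _ => (hT i j).const_mul _)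
  have i2 : Integrable (fun y => ∑ i, fGrad i y * ℓ i) μ :=
    integrable_finsetSum _ fun i _ => (hG i).mul_const _
  have i3 : Integrable (fun y => (c * (1 * fGradSq y) + (1 / 2) * (D * fGradSq y)
      - ∑ i, ∑ j, a i j * fGradTensor i j y) + ∑ i, fGrad i y * ℓ i) μ := i1.add i2
  simp_rw [e]
  rw [integral_add i3 (integrable_const Q), integral_add i1 i2,
    integral_finsetSum _ fun i _ => (hG i).mul_const _, integral_const]
  simp_rw [integral_mul_const, smul_eq_mul]
  ring

/-- Slices of the potential of a measure-valued solution. -/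
lemma HasPotential.ae_hasWeakGradient {T : ℝ} {Ω : Set (E d)} {ν : ℝ × E d → Measure (Phase d)}
    (hΩ : IsOpen Ω) (hb : Bornology.IsBounded Ω) (h : HasPotential T Ω ν) :
    (∀ i, IntegrableOn (fun p => ∫ y, fGrad i y ∂(ν p)) (cyl T Ω)) ∧
    ∀ᵐ t ∂(volume.restrict (Ioo 0 T)), ∃ Ψ : E d → ℝ,
      HasWeakGradient Ω Ψ fun i x => ∫ y, fGrad i y ∂(ν (t, x)) := by
  have hfin := isFiniteMeasure_cyl (T := T) hb
  obtain ⟨Ψ, h1, h2, h3⟩ := h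
  have h1' : IntegrableOn Ψ (cyl T Ω) := h1.integrable (by norm_num)
  have h2' : ∀ i, IntegrableOn (fun p => ∫ y, fGrad i y ∂(ν p)) (cyl T Ω) := fun i =>
    (h2 i).integrable (by norm_num)
  refine ⟨h2', ?_⟩
  have h1s := h1'
  have h2s := h2'
  simp only [IntegrableOn, restrict_cyl] at h1s h2s
  filter_upwards [h3, h1s.prod_right_ae, ae_all_iff.2 fun i => (h2s i).prod_right_ae]
    with t h4 h5 h6
  refine ⟨fun x => Ψ (t, x), h5, h6, fun η hη hc hsupp i => ?_⟩
  rw [← h4 η hη hc hsupp i]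
  exact setIntegral_congr_fun hΩ.measurableSet fun x hx => by
    simp only [pd_eq_fderiv hΩ i η hx]

namespace GeneratedBy

variable {T γ τ : ℝ} {Ω : Set (E d)} {r : ℝ → E d → ℝ} {U : ℝ → E d → E d} {Φ : ℝ → E d → ℝ}
  {g : E d → ℝ} {z : ℕ → ℝ × E d → Phase d} {ν : ℝ × E d → Measure (Phase d)}
  {m : ℝ → Defects d} {ζ : ℝ → ℝ}

/-- At almost every point the state is a measure of mass at most one with finite second moments in
the field variable. -/
lemma ae_moments (hb : Bornology.IsBounded Ω) (hz : GeneratedBy T Ω z ν m) :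
    ∀ᵐ p ∂(volume.restrict (cyl T Ω)), ν p univ ≤ 1 ∧ Integrable fGradSq (ν p) ∧
      ∀ i j, Integrable (fGradTensor i j) (ν p) := by
  filter_upwards [hz.young.measure_univ_le_one hb, hz.gradSq.2.2.1,
    ae_all_iff.2 fun i => ae_all_iff.2 fun j => (hz.gradTensor i j).2.2.1] with p h1 h2 h3
    using ⟨h1, h2, h3⟩

/-- The field rate is controlled by the relative energy of the field. The Poisson equation and the
orthogonality to `elField` remove the part that is linear in the mean field, and what remains is a
nonnegative quadratic form in `F - ∇Φ`, up to a loss of mass and a concentration. -/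
lemma gradRate_le (hg : IsDefiningFunction g Ω) (hb : Bornology.IsBounded Ω)
    (hs : IsStrongSolution T γ Ω r U Φ) (h0 : 0 < τ) (hτ : τ < T)
    (hz : GeneratedBy T Ω z ν m) {ν₀ : E d → Measure (Phase d)} {m₀ : Defects d}
    (hP : MVPoisson T Ω ν₀ m₀ ν m) (hM : meanDensity Ω ν₀ m₀ = average Ω (r 0))
    (hpot : HasPotential T Ω ν) {B : ℝ} (hB0 : 0 ≤ B)
    (hB : ∀ t ∈ Icc 0 τ, ∀ x ∈ closure Ω, ∀ i j, |pd Ω j (fun y => U t y i) x| ≤ B) :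
    ∀ᵐ t ∂(volume.restrict (Ioo 0 τ)),
      gradRate T (average Ω (r 0)) Ω U Φ (fun x => ν (t, x)) (m t) t
      ≤ 2 * (B * d) * gradRel Ω (fun x => ν (t, x)) (m t) (fun i x => pd Ω i (Φ t) x) := by
  have hΩ := hg.isOpen
  have hu := hg.uniqueDiffOn_closure
  have hz' := hz.young.2.1
  obtain ⟨ζ, hζ⟩ := exists_isTimeCutoff h0 hτ
  set M := average Ω (r 0) with hMdef
  set c : ℝ := 2 * (B * d) with hc
  have hUc : ∀ i j, ContinuousOn (fun p : ℝ × E d => pd Ω j (fun y => U p.1 y i) p.2)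
      (Ico 0 T ×ˢ closure Ω) := fun i j => continuousOn_pd_slice hu (hs.contDiffOn_U i) j
  have H := (((HasLimit.of_concentration hΩ hb hz.young continuous_fGradSq hz.gradSq
      (c := fun _ => 1) continuousOn_const).const_mul c).add hΩ hb hz'
    ((HasLimit.of_concentration hΩ hb hz.young continuous_fGradSq hz.gradSq
      (hζ.continuousOn_comp (F := fun p => ∑ i, pd Ω i (fun y => U p.1 y i) p.2)
        (continuousOn_finsetSum _ fun i _ => hUc i i))).const_mul (1 / 2))).sub hΩ hb hz'
    (HasLimit.sum hΩ hb hz' Finset.univ fun i => HasLimit.sum hΩ hb hz' Finset.univ fun j =>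
      HasLimit.of_concentration hΩ hb hz.young (continuous_fGradTensor i j) (hz.gradTensor i j)
        (hζ.continuousOn_comp (hUc i j)))
  -- the quadratic form is nonnegative
  have hq : ∀ t ∈ Icc 0 τ, ∀ x ∈ closure Ω, ∀ w : Fin d → ℝ,
      0 ≤ c * (∑ i, w i ^ 2) + (1 / 2) * (∑ i, pd Ω i (fun y => U t y i) x) * (∑ i, w i ^ 2)
        - ∑ i, ∑ j, w i * w j * pd Ω j (fun y => U t y i) x := by
    intro t ht x hx w
    have h1 := (abs_le.1 (abs_sum_sum_mul_le (hB t ht x hx) w)).2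
    have h2 : |∑ i, pd Ω i (fun y => U t y i) x| ≤ B * d := by
      refine (Finset.abs_sum_le_sum_abs _ _).trans
        ((Finset.sum_le_sum fun i _ => hB t ht x hx i i).trans (le_of_eq ?_))
      simp [mul_comm]
    have h3 : 0 ≤ ∑ i, w i ^ 2 := Finset.sum_nonneg fun _ _ => sq_nonneg _
    have h4 := mul_nonneg (neg_le_iff_add_nonneg'.1 (abs_le.1 h2).1) h3
    have h5 : 0 ≤ B * d * ∑ i, w i ^ 2 := by positivity
    rw [hc]
    nlinarith
  have hdef := H.defect_nonneg hΩ hb hz' hτ.le fun t ht x hx y => by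
    simp only [hζ.eq_self t (Ioo_subset_Icc_self ht)]
    have h1 := hq t (Ioo_subset_Icc_self ht) x (subset_closure hx) fun i => y.2 i
    simp only [fGradSq, fGradTensor, EuclideanSpace.real_norm_sq_eq, one_mul]
    simp only [mul_comm (pd Ω _ _ x) (_ * _), ← mul_assoc]
    exact h1
  have hsub : volume.restrict (Ioo 0 τ) ≤ volume.restrict (Ioo 0 T) :=
    Measure.restrict_mono (Ioo_subset_Ioo_right hτ.le) le_rfl
  have hosc := H.integrable_osc
  rw [IntegrableOn, restrict_cyl] at hosc
  obtain ⟨hfint, hpot'⟩ := hpot.ae_hasWeakGradient hΩ hb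
  filter_upwards [hdef, ae_mono hsub (H.ae_eq_integral_add hΩ hb), ae_mono hsub hpot',
    ae_mono hsub hP, ae_mono hsub (ae_ae_of_ae_cyl (hz.ae_moments hb)),
    ae_mono hsub hosc.prod_right_ae, ae_restrict_mem measurableSet_Ioo]
    with t hD hL hΨ hPt hmom hoscint ht
  obtain ⟨Ψ, hΨ⟩ := hΨ
  have htI := Ioo_subset_Icc_self ht
  have htT : t ∈ Ioo 0 T := ⟨ht.1, ht.2.trans hτ⟩
  have htT' := Ioo_subset_Ico_self htT
  simp only [hζ.eq_self t htI] at hD hL hoscint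
  have hUC := fun i => hs.contDiffOn_U_slice i htT'
  have hφC := fun i => hs.contDiffOn_grad_slice hg i htT'
  have hdU := fun i j => continuousOn_pd hu (hUC i) j
  have hf := hΨ.integrable_grad
  set f : Fin d → E d → ℝ := fun i x => ∫ y, fGrad i y ∂(ν (t, x)) with hfdef
  let φ : Fin d → E d → ℝ := fun i x => pd Ω i (Φ t) x
  let a : Fin d → Fin d → E d → ℝ := fun i j x => pd Ω j (fun y => U t y i) x
  let β : Fin d → E d → ℝ := fun i x =>
    (∑ k, φ k x * a i k x) + (∑ k, φ k x * a k i x) - φ i x * ∑ k, a k k x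
  -- `β` collects the coefficients that are linear in the mean field, `κ` those free of it
  let κ : E d → ℝ := fun x =>
    (1 / 2) * (∑ k, a k k x) * (∑ i, φ i x ^ 2) - ∑ i, ∑ j, φ i x * φ j x * a i j x
  have hφc : ∀ i, ContinuousOn (φ i) (closure Ω) := fun i => (hφC i).continuousOn
  have hac : ∀ i j, ContinuousOn (a i j) (closure Ω) := hdU
  have hβc : ∀ i, ContinuousOn (β i) (closure Ω) := fun i => by
    refine ((continuousOn_finsetSum _ fun k _ => (hφc k).mul (hac i k)).add
      (continuousOn_finsetSum _ fun k _ => (hφc k).mul (hac k i))).sub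
      ((hφc i).mul (continuousOn_finsetSum _ fun k _ => hac k k))
  have hκc : ContinuousOn κ (closure Ω) := by
    refine ((continuousOn_const.mul (continuousOn_finsetSum _ fun k _ => hac k k)).mul
      (continuousOn_finsetSum _ fun i _ => (hφc i).pow 2)).sub
      (continuousOn_finsetSum _ fun i _ => continuousOn_finsetSum _ fun j _ =>
        ((hφc i).mul (hφc j)).mul (hac i j))
  have hsqc : ContinuousOn (fun x => ∑ i, φ i x ^ 2) (closure Ω) :=
    continuousOn_finsetSum _ fun i _ => (hφc i).pow 2
  have hθC : ContDiffOn ℝ 1 (fun x => matDeriv T Ω U Φ t x) (closure Ω) :=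
    (hs.contDiffOn_tderiv_potential_slice hg htT').add
      (ContDiffOn.sum fun k _ => (hUC k).mul (hφC k))
  -- the Poisson equation, tested with the material derivative of the potential
  have hPθ := hPt _ hθC
  rw [hM] at hPθ
  have hel := hs.integral_mul_elField hg hb htT hΨ
  have hel' : ∑ i, ∫ x in Ω, f i x * β i x
      = (∑ i, ∫ x in Ω, f i x * pd Ω i (fun y => matDeriv T Ω U Φ t y) x)
        - M * ∑ i, ∫ x in Ω, f i x * U t x i := by
    have : ∀ i, ∫ x in Ω, f i x * elField T Ω M U Φ t i x
        = (∫ x in Ω, f i x * β i x) - (∫ x in Ω, f i x * pd Ω i (fun y => matDeriv T Ω U Φ t y) x)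
          + M * ∫ x in Ω, f i x * U t x i := by
      intro i
      have i1 := integrableOn_mul_continuousOn hΩ hb (hf i) (hβc i)
      have i2 := integrableOn_mul_continuousOn hΩ hb (hf i) (continuousOn_pd hu hθC i)
      have i3 := (integrableOn_mul_continuousOn hΩ hb (hf i) (hUC i).continuousOn).const_mul M
      have i4 : IntegrableOn (fun x => f i x * β i x
        - f i x * pd Ω i (fun y => matDeriv T Ω U Φ t y) x) Ω := i1.sub i2
      rw [← integral_const_mul, ← integral_sub i1 i2, ← integral_add i4 i3]
      congr 1; funext x
      simp only [elField, β, φ, a, matDeriv]; ring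
    rw [Finset.sum_congr rfl fun i _ => this i, Finset.sum_add_distrib, Finset.sum_sub_distrib,
      ← Finset.mul_sum] at hel
    linarith
  have hcU : ContinuousOn (fun x => ∑ i, U t x i * φ i x) (closure Ω) :=
    continuousOn_finsetSum _ fun i _ => (hUC i).continuousOn.mul (hφc i)
  have hctφ : ContinuousOn (fun x => ∑ i, φ i x * tderiv T (fun s y => pd Ω i (Φ s) y) t x)
      (closure Ω) :=
    continuousOn_finsetSum _ fun i _ => (hφc i).mul (hs.continuousOn_tderiv_grad_slice hg i htT')
  have hctΦ : ContinuousOn (fun x => tderiv T Φ t x) (closure Ω) :=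
    (hs.contDiffOn_tderiv_potential_slice hg htT').continuousOn
  have io : ∀ {v : E d → ℝ}, ContinuousOn v (closure Ω) → IntegrableOn v Ω :=
    fun hv => integrableOn_of_continuousOn_closure hΩ hb hv
  have hκ : M * (∫ x in Ω, matDeriv T Ω U Φ t x)
      - ∫ x in Ω, (M * tderiv T Φ t x
        + ∑ i, φ i x * tderiv T (fun s y => pd Ω i (Φ s) y) t x)
      = ∫ x in Ω, κ x := by
    have hquad := hs.integral_quadratic_eq_zero hg hb htT
    rw [← hMdef] at hquad
    have i5 : IntegrableOn (fun x => M * tderiv T Φ t x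
        + ∑ i, φ i x * tderiv T (fun s y => pd Ω i (Φ s) y) t x) Ω :=
      io ((continuousOn_const.mul hctΦ).add hctφ)
    have i6 : IntegrableOn (fun x => M * matDeriv T Ω U Φ t x) Ω :=
      io (continuousOn_const.mul hθC.continuousOn)
    rw [← integral_const_mul, ← integral_sub i6 i5, ← sub_eq_zero, ← integral_sub
      (f := fun x => M * matDeriv T Ω U Φ t x - (M * tderiv T Φ t x
        + ∑ i, φ i x * tderiv T (fun s y => pd Ω i (Φ s) y) t x)) (i6.sub i5) (io hκc),
      ← neg_eq_zero, ← integral_neg, ← hquad]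
    congr 1; funext x
    simp only [κ, φ, a, matDeriv]; ring
  -- pointwise, the integrand is the mean of a nonnegative quadratic form in `F - φ` plus the lost
  -- mass times the same form in `φ`
  have hpt : 0 ≤ ∫ x in Ω, ((∫ y, (c * (1 * fGradSq y)
      + (1 / 2) * ((∑ i, pd Ω i (fun y => U t y i) x) * fGradSq y)
      - ∑ i, ∑ j, pd Ω j (fun y => U t y i) x * fGradTensor i j y) ∂(ν (t, x)))
      + (∑ i, f i x * (- 2 * c * φ i x + β i x)) + (c * (∑ i, φ i x ^ 2) + κ x)) := by
    refine integral_nonneg_of_ae ?_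
    filter_upwards [hmom, ae_restrict_mem hΩ.measurableSet] with x hx hxΩ
    obtain ⟨hx1, hx2, hx3⟩ := hx
    have hfin : IsFiniteMeasure (ν (t, x)) := ⟨hx1.trans_lt ENNReal.one_lt_top⟩
    have key := integral_quadratic_form hx2 hx3 c (∑ k, a k k x) (fun i j => a i j x)
      (fun i => φ i x)
    have h1 := hq t htI x (subset_closure hxΩ)
    have h2 : 0 ≤ 1 - (ν (t, x)).real univ := by
      rw [sub_nonneg, Measure.real]
      exact ENNReal.toReal_le_of_le_ofReal zero_le_one (by simpa using hx1)
    have h3 := add_nonneg (integral_nonneg (μ := ν (t, x)) fun y => h1 fun i => y.2 i - φ i x)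
      (mul_nonneg h2 (h1 fun i => φ i x))
    simp only [a] at key
    rw [← key] at h3
    refine h3.trans_eq ?_
    simp only [β, κ, a, f]
    ring
  have j1 : ∀ i, IntegrableOn (fun x => f i x * (- 2 * c * φ i x + β i x)) Ω := fun i =>
    integrableOn_mul_continuousOn hΩ hb (hf i) ((continuousOn_const.mul (hφc i)).add (hβc i))
  have j2 : IntegrableOn (fun x => ∑ i, f i x * (- 2 * c * φ i x + β i x)) Ω :=
    integrable_finsetSum _ fun i _ => j1 i
  have j3 : IntegrableOn (fun x => c * (∑ i, φ i x ^ 2) + κ x) Ω :=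
    io ((continuousOn_const.mul hsqc).add hκc)
  rw [integral_add (hoscint.fun_add j2) j3, integral_add hoscint j2, integral_finsetSum _
    fun i _ => j1 i, integral_add ((io hsqc).const_mul c) (io hκc), integral_const_mul] at hpt
  have j4 : ∀ i, ∫ x in Ω, f i x * (- 2 * c * φ i x + β i x)
      = - 2 * c * (∫ x in Ω, f i x * φ i x) + ∫ x in Ω, f i x * β i x := fun i => by
    rw [← integral_const_mul, ← integral_add
      ((integrableOn_mul_continuousOn hΩ hb (hf i) (hφc i)).const_mul _)
      (integrableOn_mul_continuousOn hΩ hb (hf i) (hβc i))]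
    congr 1; funext x; ring
  rw [Finset.sum_congr rfl fun i _ => j4 i, Finset.sum_add_distrib, ← Finset.mul_sum, hel', ← hκ]
    at hpt
  simp only [gradRate, gradRel]
  simp only [φ, f] at hpt hPθ
  linarith

end GeneratedBy

/-! ### The relative energy inequality -/

section RelativeEnergy

variable {T γ τ : ℝ} {Ω : Set (E d)} {r : ℝ → E d → ℝ} {U : ℝ → E d → E d} {Φ : ℝ → E d → ℝ}
  {g : E d → ℝ} {z : ℕ → ℝ × E d → Phase d} {ν : ℝ × E d → Measure (Phase d)}
  {m : ℝ → Defects d} {ζ : ℝ → ℝ}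

lemma IsConcentrationMeasure.integrableOn_barInt (hΩ : IsOpen Ω) (hb : Bornology.IsBounded Ω)
    (hζ : IsTimeCutoff T τ ζ) (hτ : τ < T) (hY : IsYoungMeasureOf (cyl T Ω) z ν)
    {f : Phase d → ℝ} (hf : Continuous f) {μ : ℝ → SignedMeasure (E d)}
    (hμ : IsConcentrationMeasure T Ω z ν f μ) {c : ℝ × E d → ℝ}
    (hc : ContinuousOn c (Ico 0 T ×ˢ closure Ω)) :
    IntegrableOn (fun t => barInt Ω (fun x => ν (t, x)) f (μ t) (fun x => c (t, x)))
      (Ioo 0 τ) := by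
  have h := ((HasLimit.of_concentration hΩ hb hY hf hμ
    (hζ.continuousOn_comp hc)).integrable_total).mono_set (Ioo_subset_Ioo_right hτ.le)
  refine h.congr_fun (fun t ht => ?_) measurableSet_Ioo
  simp only [hζ.eq_self t (Ioo_subset_Icc_self ht)]

/-- The right-hand side of the continuity equation, tested with `testPotential`. -/
def continuityRate (T : ℝ) (Ω : Set (E d)) (U : ℝ → E d → E d) (Φ : ℝ → E d → ℝ)
    (ν : E d → Measure (Phase d)) (m : Defects d) (t : ℝ) : ℝ :=
  barInt Ω ν fRho m.rho (fun x => tderiv T (fun s y => testPotential U Φ (s, y)) t x)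
    + ∑ i, barInt Ω ν (fMom i) (m.mom i) (fun x => pd Ω i (fun y => testPotential U Φ (t, y)) x)

/-- The right-hand side of the momentum equation, tested with the velocity field `U`. -/
def momentumRate (T γ M : ℝ) (Ω : Set (E d)) (U : ℝ → E d → E d)
    (ν : E d → Measure (Phase d)) (m : Defects d) (t : ℝ) : ℝ :=
  (∑ i, barInt Ω ν (fMom i) (m.mom i) (fun x => tderiv T (fun s y => U s y i) t x))
    + (∑ i, ∑ j, barInt Ω ν (fConv i j) (m.conv i j) (fun x => pd Ω j (fun y => U t y i) x))
    - γ * (∑ i, barInt Ω ν (fMom i) (m.mom i) (fun x => U t x i))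
    - barInt Ω ν fRho m.rho (fun x => inner ℝ x (U t x))
    + (1 / 2) * barInt Ω ν fGradSq m.gradSq (fun x => ∑ i, pd Ω i (fun y => U t y i) x)
    - (∑ i, ∑ j, barInt Ω ν (fGradTensor i j) (m.gradTensor i j)
        (fun x => pd Ω j (fun y => U t y i) x))
    - M * ∑ i, ∫ x in Ω, (∫ y, fGrad i y ∂(ν x)) * U t x i

/-- The part of the relative energy that depends on the strong solution only. -/
def strongEnergy (M : ℝ) (Ω : Set (E d)) (Φ : ℝ → E d → ℝ) (p : ℝ × E d) : ℝ :=
  M * Φ p.1 p.2 + (1 / 2) * ∑ i, pd Ω i (Φ p.1) p.2 ^ 2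

lemma kinRate_add_gradRate (M : ℝ) (μ : E d → Measure (Phase d)) (n : Defects d) (t : ℝ) :
    kinRate T γ Ω U Φ μ n t + gradRate T M Ω U Φ μ n t
      = - γ * barInt Ω μ fKin n.kin (fun _ => 1) + continuityRate T Ω U Φ μ n t
        - momentumRate T γ M Ω U μ n t
        + ∫ x in Ω, (M * tderiv T Φ t x
          + ∑ i, pd Ω i (Φ t) x * tderiv T (fun s y => pd Ω i (Φ s) y) t x) := by
  simp only [kinRate, gradRate, continuityRate, momentumRate]; ring

namespace IsStrongSolution

lemma contDiffOn_strongEnergy (hg : IsDefiningFunction g Ω) (hs : IsStrongSolution T γ Ω r U Φ)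
    (M : ℝ) : ContDiffOn ℝ 1 (strongEnergy M Ω Φ) (Ico 0 T ×ˢ closure Ω) :=
  (contDiffOn_const.mul (hs.Φ_C2.of_le (by simp))).add
    (contDiffOn_const.mul (ContDiffOn.sum fun i _ => (hs.contDiffOn_grad hg i).pow 2))

lemma derivWithin_strongEnergy (hg : IsDefiningFunction g Ω) (hs : IsStrongSolution T γ Ω r U Φ)
    (M : ℝ) {t : ℝ} (ht : t ∈ Ioo 0 T) {x : E d} (hx : x ∈ closure Ω) :
    derivWithin (fun s => strongEnergy M Ω Φ (s, x)) (Ico 0 T) t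
      = M * tderiv T Φ t x
        + ∑ i, pd Ω i (Φ t) x * tderiv T (fun s y => pd Ω i (Φ s) y) t x := by
  have hφ : ∀ i, HasDerivAt (fun s => pd Ω i (Φ s) x)
      (tderiv T (fun s y => pd Ω i (Φ s) y) t x) t :=
    fun i => hasDerivAt_slice (hs.contDiffOn_grad hg i) ht hx
  have hΦ : HasDerivAt (fun s => Φ s x) (tderiv T Φ t x) t :=
    hasDerivAt_slice (hs.Φ_C2.of_le (by simp) : ContDiffOn ℝ 1 _ _) ht hx
  have h1 : HasDerivAt (fun s => strongEnergy M Ω Φ (s, x))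
      (M * tderiv T Φ t x + (1 / 2) * (∑ i, (2 : ℕ) * pd Ω i (Φ t) x ^ (2 - 1)
        * tderiv T (fun s y => pd Ω i (Φ s) y) t x)) t := by
    simp only [strongEnergy]
    exact (hΦ.const_mul M).fun_add
      ((HasDerivAt.fun_sum fun i _ => (hφ i).fun_pow 2).const_mul (1 / 2))
  rw [h1.hasDerivWithinAt.derivWithin (uniqueDiffOn_Ico_zero T _ (Ioo_subset_Ico_self ht)),
    Finset.mul_sum]
  congr 1
  exact Finset.sum_congr rfl fun i _ => by norm_num; ring

lemma continuousOn_strongRate (hg : IsDefiningFunction g Ω) (hs : IsStrongSolution T γ Ω r U Φ)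
    (M : ℝ) : ContinuousOn (fun p : ℝ × E d => M * tderiv T Φ p.1 p.2
      + ∑ i, pd Ω i (Φ p.1) p.2 * tderiv T (fun s y => pd Ω i (Φ s) y) p.1 p.2)
      (Ico 0 T ×ˢ closure Ω) :=
  (continuousOn_const.mul (hs.contDiffOn_tderiv_potential hg).continuousOn).add
    (continuousOn_finsetSum _ fun i _ => (hs.contDiffOn_grad hg i).continuousOn.mul
      (continuousOn_tderiv hg.uniqueDiffOn_closure (hs.contDiffOn_grad hg i)))

lemma continuousOn_integral_strongRate (hg : IsDefiningFunction g Ω)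
    (hb : Bornology.IsBounded Ω) (hs : IsStrongSolution T γ Ω r U Φ) (M : ℝ) :
    ContinuousOn (fun t => ∫ x in Ω, (M * tderiv T Φ t x
      + ∑ i, pd Ω i (Φ t) x * tderiv T (fun s y => pd Ω i (Φ s) y) t x)) (Ico 0 T) := by
  simpa only [one_mul] using continuousOn_integral_slice hg.isOpen hb
    (hs.continuousOn_strongRate hg M) (integrableOn_one hb)

lemma integral_strongRate (hg : IsDefiningFunction g Ω) (hb : Bornology.IsBounded Ω)
    (hs : IsStrongSolution T γ Ω r U Φ) (M : ℝ) {t : ℝ} (ht : t ∈ Ioo 0 T) :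
    ∫ s in (0 : ℝ)..t, ∫ x in Ω, (M * tderiv T Φ s x
        + ∑ i, pd Ω i (Φ s) x * tderiv T (fun s y => pd Ω i (Φ s) y) s x)
      = (∫ x in Ω, strongEnergy M Ω Φ (t, x)) - ∫ x in Ω, strongEnergy M Ω Φ (0, x) := by
  have hΩ := hg.isOpen
  have hC := hs.contDiffOn_strongEnergy hg M
  have hone := integrableOn_one hb
  have hsub : Icc 0 t ⊆ Ico 0 T := fun s hs => ⟨hs.1, hs.2.trans_lt ht.2⟩
  refine intervalIntegral.integral_eq_sub_of_hasDerivAt_of_le ht.1.le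
    (f := fun s => ∫ x in Ω, strongEnergy M Ω Φ (s, x)) ?_ (fun s hs' => ?_) ?_
  · simpa only [one_mul] using
      (continuousOn_integral_slice hΩ hb hC.continuousOn hone).mono hsub
  · have hsT : s ∈ Ioo 0 T := ⟨hs'.1, hs'.2.trans ht.2⟩
    have h := hasDerivAt_integral_slice hΩ hb hg.uniqueDiffOn_closure hC hone hsT
    simp only [one_mul] at h
    rwa [setIntegral_congr_fun hΩ.measurableSet fun x hx =>
      hs.derivWithin_strongEnergy hg M hsT (subset_closure hx)] at h
  · refine ContinuousOn.intervalIntegrable ?_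
    rw [uIcc_of_le ht.1.le]
    exact (hs.continuousOn_integral_strongRate hg hb M).mono hsub

/-- The relative energy in terms of the energy and of the tested conserved quantities. -/
lemma relEnergy_eq (hg : IsDefiningFunction g Ω) (hb : Bornology.IsBounded Ω)
    (hs : IsStrongSolution T γ Ω r U Φ) {t : ℝ} (ht : t ∈ Ico 0 T) {M : ℝ}
    {μ : E d → Measure (Phase d)} {n : Defects d} (hμ : IsBarState Ω μ fRho n.rho)
    (hP : (∑ i, ∫ x in Ω, (∫ y, fGrad i y ∂(μ x)) * pd Ω i (Φ t) x)
      = barInt Ω μ fRho n.rho (Φ t) - M * ∫ x in Ω, Φ t x) :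
    (1 / 2) * (kinRel Ω μ n (U t) + gradRel Ω μ n (fun i x => pd Ω i (Φ t) x))
      = mvEnergy Ω μ n + barInt Ω μ fRho n.rho (fun x => testPotential U Φ (t, x))
        - (∑ i, barInt Ω μ (fMom i) (n.mom i) (fun x => U t x i))
        + ∫ x in Ω, strongEnergy M Ω Φ (t, x) := by
  have hΩ := hg.isOpen
  have hU : ContinuousOn (fun x => ∑ i, U t x i ^ 2) (closure Ω) :=
    continuousOn_finsetSum _ fun i _ => (hs.contDiffOn_U_slice i ht).continuousOn.pow 2
  have hU' : ContinuousOn (fun x => (1 / 2) * ∑ i, U t x i ^ 2) (closure Ω) :=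
    continuousOn_const.mul hU
  have hx : ContinuousOn (fun x : E d => (1 / 2) * ‖x‖ ^ 2) (closure Ω) := by fun_prop
  have hΦ := (hs.contDiffOn_potential_slice ht).continuousOn
  have hφ : ContinuousOn (fun x => ∑ i, pd Ω i (Φ t) x ^ 2) (closure Ω) :=
    continuousOn_finsetSum _ fun i _ => (hs.contDiffOn_grad_slice hg i ht).continuousOn.pow 2
  have e1 : barInt Ω μ fRho n.rho (fun x => testPotential U Φ (t, x))
      = (1 / 2) * barInt Ω μ fRho n.rho (fun x => ∑ i, U t x i ^ 2)
        - barInt Ω μ fRho n.rho (fun x => (1 / 2) * ‖x‖ ^ 2)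
        - barInt Ω μ fRho n.rho (Φ t) := by
    simp only [testPotential]
    rw [hμ.barInt_sub hΩ hb (hU'.fun_sub hx) hΦ, hμ.barInt_sub hΩ hb hU' hx,
      IsBarState.barInt_const_mul]
  have e2 : ∫ x in Ω, strongEnergy M Ω Φ (t, x)
      = M * (∫ x in Ω, Φ t x) + (1 / 2) * ∫ x in Ω, ∑ i, pd Ω i (Φ t) x ^ 2 := by
    simp only [strongEnergy]
    rw [integral_add ((integrableOn_of_continuousOn_closure hΩ hb hΦ).const_mul M)
      ((integrableOn_of_continuousOn_closure hΩ hb hφ).const_mul _), integral_const_mul,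
      integral_const_mul]
  rw [e1, e2, mvEnergy, kinRel, gradRel]
  linarith

end IsStrongSolution

lemma intervalIntegrable_of_integrableOn_Ioo {e : ℝ → ℝ} (he : IntegrableOn e (Ioo 0 τ)) {t : ℝ}
    (ht : t ∈ Ioo 0 τ) : IntervalIntegrable e volume 0 t := by
  rw [intervalIntegrable_iff_integrableOn_Ioo_of_le ht.1.le]
  exact he.mono_set (Ioo_subset_Ioo_right ht.2.le)

lemma intervalIntegral_congr_of_ae_Ioo {e e' : ℝ → ℝ}
    (h : ∀ᵐ t ∂(volume.restrict (Ioo 0 τ)), e t = e' t) {t : ℝ} (ht : t ∈ Ioo 0 τ) :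
    ∫ s in (0 : ℝ)..t, e s = ∫ s in (0 : ℝ)..t, e' s := by
  refine intervalIntegral.integral_congr_ae_restrict ?_
  rw [uIoc_of_le ht.1.le, restrict_Ioo_eq_restrict_Ioc.symm]
  exact ae_mono (Measure.restrict_mono (Ioo_subset_Ioo_right ht.2.le) le_rfl) h

namespace GeneratedBy

lemma integrableOn_kinRel (hg : IsDefiningFunction g Ω) (hb : Bornology.IsBounded Ω)
    (hs : IsStrongSolution T γ Ω r U Φ) (h0 : 0 < τ) (hτ : τ < T) (hz : GeneratedBy T Ω z ν m) :
    IntegrableOn (fun t => kinRel Ω (fun x => ν (t, x)) (m t) (U t)) (Ioo 0 τ) := by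
  obtain ⟨ζ, hζ⟩ := exists_isTimeCutoff h0 hτ
  refine ((hz.hasLimit_kinRel hg hb hs hζ).integrable_total.mono_set
    (Ioo_subset_Ioo_right hτ.le)).congr_fun (fun t ht => ?_) measurableSet_Ioo
  simp only [hζ.eq_self t (Ioo_subset_Icc_self ht)]

lemma integrableOn_grad_mul (hΩ : IsOpen Ω) (hb : Bornology.IsBounded Ω)
    (hζ : IsTimeCutoff T τ ζ) (hτ : τ < T) {f : ℝ × E d → ℝ} (hf : IntegrableOn f (cyl T Ω))
    {c : ℝ × E d → ℝ} (hc : ContinuousOn c (Ico 0 T ×ˢ closure Ω)) :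
    IntegrableOn (fun t => ∫ x in Ω, f (t, x) * c (t, x)) (Ioo 0 τ) := by
  have h := integrableOn_cyl_mul hΩ hb (hζ.continuousOn_comp hc) hf
  rw [IntegrableOn, restrict_cyl] at h
  have h1 : IntegrableOn (fun t => ∫ x in Ω, c (ζ t, x) * f (t, x)) (Ioo 0 T) :=
    h.integral_prod_left
  refine (h1.mono_set (Ioo_subset_Ioo_right hτ.le)).congr_fun (fun t ht => ?_) measurableSet_Ioo
  simp only [hζ.eq_self t (Ioo_subset_Icc_self ht), mul_comm]

lemma integrableOn_of_continuousOn_Ico {e : ℝ → ℝ} (he : ContinuousOn e (Ico 0 T)) (hτ : τ < T) :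
    IntegrableOn e (Ioo 0 τ) :=
  ((he.mono fun _ hs => ⟨hs.1, hs.2.trans_lt hτ⟩ : ContinuousOn e
    (Icc 0 τ)).integrableOn_Icc).mono_set Ioo_subset_Icc_self

lemma integrableOn_gradRel (hg : IsDefiningFunction g Ω) (hb : Bornology.IsBounded Ω)
    (hs : IsStrongSolution T γ Ω r U Φ) (h0 : 0 < τ) (hτ : τ < T) (hz : GeneratedBy T Ω z ν m)
    (hpot : HasPotential T Ω ν) :
    IntegrableOn (fun t => gradRel Ω (fun x => ν (t, x)) (m t) (fun i x => pd Ω i (Φ t) x))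
      (Ioo 0 τ) := by
  have hΩ := hg.isOpen
  obtain ⟨ζ, hζ⟩ := exists_isTimeCutoff h0 hτ
  have hφ := fun i => (hs.contDiffOn_grad hg i).continuousOn
  refine Integrable.add (Integrable.sub (hz.gradSq.integrableOn_barInt hΩ hb hζ hτ hz.young
    continuous_fGradSq (c := fun _ => 1) continuousOn_const) (Integrable.const_mul
      (integrable_finsetSum _ fun i _ => ?_) 2)) ?_
  · exact integrableOn_grad_mul hΩ hb hζ hτ ((hpot.ae_hasWeakGradient hΩ hb).1 i) (hφ i)
  · refine integrableOn_of_continuousOn_Ico ?_ hτ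
    simpa only [one_mul] using continuousOn_integral_slice hΩ hb
      (F := fun p : ℝ × E d => ∑ i, pd Ω i (Φ p.1) p.2 ^ 2)
      (continuousOn_finsetSum _ fun i _ => (hφ i).pow 2) (integrableOn_one hb)

/-- The relative energy inequality: the energy inequality combined with the continuity equation,
tested with `testPotential`, and the momentum equation, tested with `U`. -/
lemma relEnergy_le (hg : IsDefiningFunction g Ω) (hb : Bornology.IsBounded Ω)
    (hs : IsStrongSolution T γ Ω r U Φ) (h0 : 0 < τ) (hτ : τ < T) (hz : GeneratedBy T Ω z ν m)
    {ν₀ : E d → Measure (Phase d)} {m₀ : Defects d}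
    (hC : MVContinuity T Ω ν₀ m₀ ν m) (hMo : MVMomentum T γ Ω ν₀ m₀ ν m)
    (hP : MVPoisson T Ω ν₀ m₀ ν m) (hpot : HasPotential T Ω ν)
    (hE : MVEnergyInequality T γ Ω ν₀ m₀ ν m) (hM : meanDensity Ω ν₀ m₀ = average Ω (r 0))
    (hμ₀ : IsBarState Ω ν₀ fRho m₀.rho)
    (hP₀ : (∑ i, ∫ x in Ω, (∫ y, fGrad i y ∂(ν₀ x)) * pd Ω i (Φ 0) x)
      = barInt Ω ν₀ fRho m₀.rho (Φ 0) - average Ω (r 0) * ∫ x in Ω, Φ 0 x)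
    (hE₀ : kinRel Ω ν₀ m₀ (U 0) + gradRel Ω ν₀ m₀ (fun i x => pd Ω i (Φ 0) x) = 0) :
    IntegrableOn (fun t => kinRate T γ Ω U Φ (fun x => ν (t, x)) (m t) t
      + gradRate T (average Ω (r 0)) Ω U Φ (fun x => ν (t, x)) (m t) t) (Ioo 0 τ) ∧
    ∀ᵐ t ∂(volume.restrict (Ioo 0 τ)),
      (1 / 2) * (kinRel Ω (fun x => ν (t, x)) (m t) (U t)
        + gradRel Ω (fun x => ν (t, x)) (m t) (fun i x => pd Ω i (Φ t) x))
      ≤ ∫ s in (0 : ℝ)..t, (kinRate T γ Ω U Φ (fun x => ν (s, x)) (m s) s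
        + gradRate T (average Ω (r 0)) Ω U Φ (fun x => ν (s, x)) (m s) s) := by
  have hΩ := hg.isOpen
  have hu := hg.uniqueDiffOn_closure
  set M := average Ω (r 0) with hMdef
  obtain ⟨ζ, hζ⟩ := exists_isTimeCutoff h0 hτ
  have hsub : volume.restrict (Ioo 0 τ) ≤ volume.restrict (Ioo 0 T) :=
    Measure.restrict_mono (Ioo_subset_Ioo_right hτ.le) le_rfl
  have hψ := hs.contDiffOn_testPotential
  have hU := hs.contDiffOn_U
  have hdU := fun i j => continuousOn_pd_slice hu (hU i) j
  obtain ⟨hfint, -⟩ := hpot.ae_hasWeakGradient hΩ hb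
  -- time integrability
  have iK := hz.kin.integrableOn_barInt hΩ hb hζ hτ hz.young continuous_fKin (c := fun _ => 1)
    continuousOn_const
  have iC : IntegrableOn (fun t => continuityRate T Ω U Φ (fun x => ν (t, x)) (m t) t)
      (Ioo 0 τ) :=
    (hz.rho.integrableOn_barInt hΩ hb hζ hτ hz.young continuous_fRho
      (continuousOn_tderiv hu hψ)).add (integrable_finsetSum _ fun i _ =>
      (hz.mom i).integrableOn_barInt hΩ hb hζ hτ hz.young (continuous_fMom i)
        (continuousOn_pd_slice hu hψ i))
  have iM : IntegrableOn (fun t => momentumRate T γ M Ω U (fun x => ν (t, x)) (m t) t)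
      (Ioo 0 τ) := by
    refine Integrable.sub (Integrable.sub (Integrable.add (Integrable.sub (Integrable.sub
      (Integrable.add (integrable_finsetSum _ fun i _ => ?_)
        (integrable_finsetSum _ fun i _ => integrable_finsetSum _ fun j _ => ?_))
      (Integrable.const_mul (integrable_finsetSum _ fun i _ => ?_) γ)) ?_)
      (Integrable.const_mul ?_ (1 / 2)))
      (integrable_finsetSum _ fun i _ => integrable_finsetSum _ fun j _ => ?_))
      (Integrable.const_mul (integrable_finsetSum _ fun i _ => ?_) M)
    · exact (hz.mom i).integrableOn_barInt hΩ hb hζ hτ hz.young (continuous_fMom i)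
        (continuousOn_tderiv hu (hU i))
    · exact (hz.conv i j).integrableOn_barInt hΩ hb hζ hτ hz.young (continuous_fConv i j) (hdU i j)
    · exact (hz.mom i).integrableOn_barInt hΩ hb hζ hτ hz.young (continuous_fMom i)
        (hU i).continuousOn
    · exact hz.rho.integrableOn_barInt hΩ hb hζ hτ hz.young continuous_fRho
        (c := fun p => inner ℝ p.2 (U p.1 p.2)) (continuousOn_snd.inner hs.U_C1.continuousOn)
    · exact hz.gradSq.integrableOn_barInt hΩ hb hζ hτ hz.young continuous_fGradSq
        (c := fun p => ∑ i, pd Ω i (fun y => U p.1 y i) p.2)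
        (continuousOn_finsetSum _ fun i _ => hdU i i)
    · exact (hz.gradTensor i j).integrableOn_barInt hΩ hb hζ hτ hz.young
        (continuous_fGradTensor i j) (hdU i j)
    · exact integrableOn_grad_mul hΩ hb hζ hτ (hfint i) (hU i).continuousOn
  have iN : IntegrableOn (fun t => ∫ x in Ω, (M * tderiv T Φ t x
      + ∑ i, pd Ω i (Φ t) x * tderiv T (fun s y => pd Ω i (Φ s) y) t x)) (Ioo 0 τ) :=
    integrableOn_of_continuousOn_Ico (hs.continuousOn_integral_strongRate hg hb M) hτ
  simp only [kinRate_add_gradRate]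
  have i1 : IntegrableOn (fun t => - γ * barInt Ω (fun x => ν (t, x)) fKin (m t).kin (fun _ => 1)
      + continuityRate T Ω U Φ (fun x => ν (t, x)) (m t) t) (Ioo 0 τ) := (iK.const_mul _).add iC
  have i2 : IntegrableOn (fun t => - γ * barInt Ω (fun x => ν (t, x)) fKin (m t).kin (fun _ => 1)
      + continuityRate T Ω U Φ (fun x => ν (t, x)) (m t) t
      - momentumRate T γ M Ω U (fun x => ν (t, x)) (m t) t) (Ioo 0 τ) := i1.sub iM
  refine ⟨i2.add iN, ?_⟩
  -- the integrands of the tested equations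
  have eC : ∀ᵐ t ∂(volume.restrict (Ioo 0 τ)),
      barInt Ω (fun x => ν (t, x)) fRho (m t).rho
          (fun x => dt T (fun p => testPotential U Φ (ζ p.1, p.2)) t x)
        + ∑ i, barInt Ω (fun x => ν (t, x)) (fMom i) ((m t).mom i)
            (fun x => pd Ω i (fun y => testPotential U Φ (ζ t, y)) x)
      = continuityRate T Ω U Φ (fun x => ν (t, x)) (m t) t := by
    filter_upwards [ae_mono hsub hz.rho.ae_isBarState, ae_restrict_mem measurableSet_Ioo]
      with t h1 ht
    rw [continuityRate, hζ.eq_self t (Ioo_subset_Icc_self ht)]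
    congr 1
    exact h1.barInt_congr hΩ fun x hx => hζ.dt_comp hτ hψ ht hx
  have eM : ∀ᵐ t ∂(volume.restrict (Ioo 0 τ)),
      ((∑ i, barInt Ω (fun x => ν (t, x)) (fMom i) ((m t).mom i)
              (fun x => dt T (fun p => U (ζ p.1) p.2 i) t x))
            + (∑ i, ∑ j, barInt Ω (fun x => ν (t, x)) (fConv i j) ((m t).conv i j)
                (fun x => pd Ω j (fun y => U (ζ t) y i) x))
            - γ * (∑ i, barInt Ω (fun x => ν (t, x)) (fMom i) ((m t).mom i)
                (fun x => U (ζ t) x i))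
            - barInt Ω (fun x => ν (t, x)) fRho (m t).rho (fun x => inner ℝ x (U (ζ t) x))
            + (1 / 2) * barInt Ω (fun x => ν (t, x)) fGradSq (m t).gradSq
                (fun x => ∑ i, pd Ω i (fun y => U (ζ t) y i) x)
            - (∑ i, ∑ j, barInt Ω (fun x => ν (t, x)) (fGradTensor i j) ((m t).gradTensor i j)
                (fun x => pd Ω j (fun y => U (ζ t) y i) x))
            - M * ∑ i, ∫ x in Ω, (∫ y, fGrad i y ∂(ν (t, x))) * U (ζ t) x i)
      = momentumRate T γ M Ω U (fun x => ν (t, x)) (m t) t := by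
    filter_upwards [ae_mono hsub (ae_all_iff.2 fun i => (hz.mom i).ae_isBarState),
      ae_restrict_mem measurableSet_Ioo] with t h1 ht
    rw [momentumRate, hζ.eq_self t (Ioo_subset_Icc_self ht)]
    congr 6
    exact Finset.sum_congr rfl fun i _ => (h1 i).barInt_congr hΩ fun x hx =>
      hζ.dt_comp hτ (hU i) ht hx
  have hζ0 : ζ 0 = 0 := hζ.eq_self 0 ⟨le_rfl, h0.le⟩
  have hT0 : (0 : ℝ) ∈ Ico 0 T := ⟨le_rfl, h0.trans hτ⟩
  have rel0 := hs.relEnergy_eq hg hb hT0 hμ₀ hP₀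
  filter_upwards [ae_mono hsub hC, ae_mono hsub hMo, ae_mono hsub hP, ae_mono hsub hE,
    ae_mono hsub hz.rho.ae_isBarState, ae_restrict_mem measurableSet_Ioo] with t hCt hMt hPt hEt hμ ht
  have htT : t ∈ Ioo 0 T := ⟨ht.1, ht.2.trans hτ⟩
  have htT' := Ioo_subset_Ico_self htT
  have hζt := hζ.eq_self t (Ioo_subset_Icc_self ht)
  have c1 := hCt (fun p => testPotential U Φ (ζ p.1, p.2)) (hζ.contDiffOn_comp hψ)
  have c2 := hMt (fun p => U (ζ p.1) p.2) (hζ.contDiffOn_comp hs.U_C1)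
    fun s hs' => hs.tangential_U (hζ.mapsTo s hs')
  rw [hM] at c2
  simp only at c1 c2
  rw [intervalIntegral_congr_of_ae_Ioo eC ht] at c1
  rw [intervalIntegral_congr_of_ae_Ioo eM ht] at c2
  rw [hζt, hζ0] at c1 c2
  have c3 := hPt (Φ t) ((hs.contDiffOn_potential_slice htT').of_le (by simp))
  rw [hM] at c3
  have relt := hs.relEnergy_eq hg hb htT' hμ c3
  have hN := hs.integral_strongRate hg hb M htT
  rw [relt, intervalIntegral.integral_add (intervalIntegrable_of_integrableOn_Ioo i2 ht)
    (intervalIntegrable_of_integrableOn_Ioo iN ht),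
    intervalIntegral.integral_sub (intervalIntegrable_of_integrableOn_Ioo i1 ht)
    (intervalIntegrable_of_integrableOn_Ioo iM ht),
    intervalIntegral.integral_add
    ((intervalIntegrable_of_integrableOn_Ioo iK ht).const_mul _)
    (intervalIntegrable_of_integrableOn_Ioo iC ht), intervalIntegral.integral_const_mul, hN, ← c1,
    ← c2]
  rw [hE₀, mul_zero] at rel0
  linarith

end GeneratedBy

end RelativeEnergy

/-! ### Vanishing of the relative energy -/

section Vanishing

variable {T γ τ : ℝ} {Ω : Set (E d)} {r : ℝ → E d → ℝ} {U : ℝ → E d → E d} {Φ : ℝ → E d → ℝ}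
  {g : E d → ℝ} {z : ℕ → ℝ × E d → Phase d} {ν : ℝ × E d → Measure (Phase d)}
  {m : ℝ → Defects d} {ν₀ : E d → Measure (Phase d)}

lemma sint_zero_measure (c : E d → ℝ) : sint (0 : SignedMeasure (E d)) c = 0 :=
  VectorMeasure.integral_zero_vectorMeasure ..

lemma barInt_dirac {μ : E d → Measure (Phase d)} {s : E d → Phase d}
    (h : ∀ᵐ x ∂(volume.restrict Ω), μ x = Measure.dirac (s x)) {f : Phase d → ℝ}
    (c : E d → ℝ) :
    barInt Ω μ f 0 c = ∫ x in Ω, f (s x) * c x := by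
  rw [barInt, sint_zero_measure, add_zero]
  refine integral_congr_ae ?_
  filter_upwards [h] with x hx
  simp only [hx, integral_dirac]

namespace IsStrongSolution

/-- The initial state of the strong solution. -/
lemma initial (hg : IsDefiningFunction g Ω) (hb : Bornology.IsBounded Ω) (hT : 0 < T)
    (hs : IsStrongSolution T γ Ω r U Φ)
    (hν₀ : ∀ᵐ x ∂(volume.restrict Ω),
      ν₀ x = Measure.dirac ((Real.toNNReal (r 0 x), U 0 x), grad Ω (Φ 0) x)) :
    meanDensity Ω ν₀ 0 = average Ω (r 0) ∧ IsBarState Ω ν₀ fRho (0 : Defects d).rho ∧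
    ((∑ i, ∫ x in Ω, (∫ y, fGrad i y ∂(ν₀ x)) * pd Ω i (Φ 0) x)
      = barInt Ω ν₀ fRho (0 : Defects d).rho (Φ 0) - average Ω (r 0) * ∫ x in Ω, Φ 0 x) ∧
    kinRel Ω ν₀ 0 (U 0) + gradRel Ω ν₀ 0 (fun i x => pd Ω i (Φ 0) x) = 0 := by
  have hΩ := hg.isOpen
  have h0 : (0 : ℝ) ∈ Ico 0 T := ⟨le_rfl, hT⟩
  have hr := (hs.contDiffOn_r_slice h0).continuousOn
  have hU := fun i => (hs.contDiffOn_U_slice i h0).continuousOn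
  have hφ := fun i => (hs.contDiffOn_grad_slice hg i h0).continuousOn
  have hΦ : ContDiffOn ℝ 1 (Φ 0) (closure Ω) :=
    (hs.contDiffOn_potential_slice h0).of_le (by simp)
  have io : ∀ {v : E d → ℝ}, ContinuousOn v (closure Ω) → IntegrableOn v Ω :=
    fun hv => integrableOn_of_continuousOn_closure hΩ hb hv
  have hpos : ∀ x ∈ Ω, ((Real.toNNReal (r 0 x) : ℝ≥0) : ℝ) = r 0 x := fun x hx =>
    Real.coe_toNNReal _ (hs.r_pos 0 h0 x (subset_closure hx)).le
  have eR : ∀ c : E d → ℝ, barInt Ω ν₀ fRho (0 : Defects d).rho c = ∫ x in Ω, r 0 x * c x :=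
    fun c => (barInt_dirac hν₀ c).trans (setIntegral_congr_fun hΩ.measurableSet fun x hx => by
      simp only [fRho, hpos x hx])
  have eM : ∀ i, ∀ c : E d → ℝ, barInt Ω ν₀ (fMom i) ((0 : Defects d).mom i) c
      = ∫ x in Ω, r 0 x * U 0 x i * c x :=
    fun i c => (barInt_dirac hν₀ c).trans (setIntegral_congr_fun hΩ.measurableSet fun x hx => by
      simp only [fMom, hpos x hx])
  have eK : barInt Ω ν₀ fKin (0 : Defects d).kin (fun _ => 1)
      = ∫ x in Ω, r 0 x * ∑ i, U 0 x i ^ 2 :=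
    (barInt_dirac hν₀ _).trans (setIntegral_congr_fun hΩ.measurableSet fun x hx => by
      simp only [fKin, hpos x hx, EuclideanSpace.real_norm_sq_eq, mul_one])
  have eG : barInt Ω ν₀ fGradSq (0 : Defects d).gradSq (fun _ => 1)
      = ∫ x in Ω, ∑ i, pd Ω i (Φ 0) x ^ 2 :=
    (barInt_dirac hν₀ _).trans (setIntegral_congr_fun hΩ.measurableSet fun x hx => by
      simp only [fGradSq, grad, EuclideanSpace.real_norm_sq_eq, mul_one])
  have eF : ∀ i, ∫ x in Ω, (∫ y, fGrad i y ∂(ν₀ x)) * pd Ω i (Φ 0) x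
      = ∫ x in Ω, pd Ω i (Φ 0) x * pd Ω i (Φ 0) x := fun i => by
    refine integral_congr_ae ?_
    filter_upwards [hν₀] with x hx
    simp only [hx, integral_dirac, fGrad, grad]
  refine ⟨?_, ⟨?_, ?_⟩, ?_, ?_⟩
  · rw [meanDensity, eR, average]; simp only [mul_one]
  · refine (io hr).congr ?_
    filter_upwards [hν₀, ae_restrict_mem hΩ.measurableSet] with x hx hxΩ
    simp only [hx, integral_dirac, fRho, hpos x hxΩ]
  · change (0 : SignedMeasure (E d)).totalVariation _ = 0
    rw [SignedMeasure.totalVariation_zero]; rfl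
  · have h1 := hs.integral_grad_mul hg hb h0
      (hasWeakGradient_of_contDiffOn hΩ hb hg.uniqueDiffOn_closure hΦ)
    rw [Finset.sum_congr rfl fun i _ => eF i, h1, eR, ← integral_const_mul,
      ← integral_sub (io (hr.fun_mul hΦ.continuousOn)) ((io hΦ.continuousOn).const_mul _)]
    congr 1; funext x; ring
  · rw [kinRel, gradRel, eK, eG, eR, Finset.sum_congr rfl fun i _ => eF i,
      Finset.sum_congr rfl fun i _ => eM i _, ← integral_finsetSum, ← integral_finsetSum]
    · have e1 : ∀ x, ∑ i, r 0 x * U 0 x i * U 0 x i = r 0 x * ∑ i, U 0 x i ^ 2 := fun x => by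
        rw [Finset.mul_sum]; exact Finset.sum_congr rfl fun i _ => by ring
      simp only [e1, ← pow_two]
      ring
    · exact fun i _ => io ((hφ i).mul (hφ i))
    · exact fun i _ => io ((hr.mul (hU i)).mul (hU i))

end IsStrongSolution

lemma field_integrand_eq {μ : Measure (Phase d)} (h1 : μ univ ≤ 1) (h2 : Integrable fGradSq μ)
    (h3 : ∀ i j, Integrable (fGradTensor i j) μ) (φ : Fin d → ℝ) :
    (∫ y, fGradSq y ∂μ) * 1 - 2 * (∑ i, (∫ y, fGrad i y ∂μ) * φ i) + ∑ i, φ i ^ 2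
      = (∫ y, ∑ i, (y.2 i - φ i) ^ 2 ∂μ) + (1 - μ.real univ) * ∑ i, φ i ^ 2 := by
  have hfin : IsFiniteMeasure μ := ⟨h1.trans_lt ENNReal.one_lt_top⟩
  have key := integral_quadratic_form h2 h3 1 0 (fun _ _ => 0) φ
  simp only [one_mul, zero_mul, mul_zero, add_zero, sub_zero, Finset.sum_const_zero,
    mul_one] at key
  rw [← key, Finset.mul_sum, sub_eq_add_neg, ← Finset.sum_neg_distrib, mul_one]
  congr 2
  exact Finset.sum_congr rfl fun i _ => by ring

namespace GeneratedBy

/-- The relative energy of the field is the sum of a fluctuation, a loss of mass, and a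
concentration. -/
lemma gradRel_eq (hg : IsDefiningFunction g Ω) (hb : Bornology.IsBounded Ω)
    (hs : IsStrongSolution T γ Ω r U Φ) (hz : GeneratedBy T Ω z ν m) (hpot : HasPotential T Ω ν) :
    ∀ᵐ t ∂(volume.restrict (Ioo 0 T)),
      IntegrableOn (fun x => (∫ y, ∑ i, (y.2 i - pd Ω i (Φ t) x) ^ 2 ∂(ν (t, x)))
        + (1 - (ν (t, x)).real univ) * ∑ i, pd Ω i (Φ t) x ^ 2) Ω ∧
      gradRel Ω (fun x => ν (t, x)) (m t) (fun i x => pd Ω i (Φ t) x)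
        = (∫ x in Ω, ((∫ y, ∑ i, (y.2 i - pd Ω i (Φ t) x) ^ 2 ∂(ν (t, x)))
          + (1 - (ν (t, x)).real univ) * ∑ i, pd Ω i (Φ t) x ^ 2))
          + sint (m t).gradSq (fun _ => 1) := by
  have hΩ := hg.isOpen
  filter_upwards [hz.gradSq.ae_isBarState, (hpot.ae_hasWeakGradient hΩ hb).2,
    ae_ae_of_ae_cyl (hz.ae_moments hb), ae_restrict_mem measurableSet_Ioo] with t hμ hΨ hmom ht
  obtain ⟨Ψ, hΨ⟩ := hΨ
  have hf := hΨ.integrable_grad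
  have hφ := fun i => (hs.contDiffOn_grad_slice hg i (Ioo_subset_Ico_self ht)).continuousOn
  have i1 : IntegrableOn (fun x => ∑ i, (∫ y, fGrad i y ∂(ν (t, x))) * pd Ω i (Φ t) x) Ω :=
    integrable_finsetSum _ fun i _ => integrableOn_mul_continuousOn hΩ hb (hf i) (hφ i)
  have i2 : IntegrableOn (fun x => ∑ i, pd Ω i (Φ t) x ^ 2) Ω :=
    integrableOn_of_continuousOn_closure hΩ hb (continuousOn_finsetSum _ fun i _ => (hφ i).pow 2)
  have i3 : IntegrableOn (fun x => (∫ y, fGradSq y ∂(ν (t, x))) * 1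
      - 2 * ∑ i, (∫ y, fGrad i y ∂(ν (t, x))) * pd Ω i (Φ t) x) Ω :=
    (hμ.integrable.mul_const 1).sub (i1.const_mul 2)
  have e : ∀ᵐ x ∂(volume.restrict Ω), (∫ y, fGradSq y ∂(ν (t, x))) * 1
      - 2 * (∑ i, (∫ y, fGrad i y ∂(ν (t, x))) * pd Ω i (Φ t) x) + ∑ i, pd Ω i (Φ t) x ^ 2
      = (∫ y, ∑ i, (y.2 i - pd Ω i (Φ t) x) ^ 2 ∂(ν (t, x)))
        + (1 - (ν (t, x)).real univ) * ∑ i, pd Ω i (Φ t) x ^ 2 := by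
    filter_upwards [hmom] with x hx
    exact field_integrand_eq hx.1 hx.2.1 hx.2.2 _
  refine ⟨(i3.add i2).congr e, ?_⟩
  rw [← integral_congr_ae e, integral_add i3 i2, integral_sub (hμ.integrable.mul_const 1)
    (i1.const_mul 2), integral_const_mul, integral_finsetSum _ fun i _ =>
      integrableOn_mul_continuousOn hΩ hb (hf i) (hφ i), gradRel, barInt]
  ring

lemma sint_gradSq_nonneg (hΩ : IsOpen Ω) (hb : Bornology.IsBounded Ω)
    (hz : GeneratedBy T Ω z ν m) :
    ∀ᵐ t ∂(volume.restrict (Ioo 0 T)), 0 ≤ sint (m t).gradSq (fun _ => 1) :=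
  (HasLimit.of_concentration hΩ hb hz.young continuous_fGradSq hz.gradSq (c := fun _ => 1)
    continuousOn_const).defect_nonneg hΩ hb hz.young.2.1 le_rfl fun t _ x _ y => by
      simp only [fGradSq]; positivity

lemma ae_integrand_nonneg (hb : Bornology.IsBounded Ω) (hz : GeneratedBy T Ω z ν m)
    (φ : ℝ → Fin d → E d → ℝ) :
    ∀ᵐ t ∂(volume.restrict (Ioo 0 T)), ∀ᵐ x ∂(volume.restrict Ω),
      0 ≤ (∫ y, ∑ i, (y.2 i - φ t i x) ^ 2 ∂(ν (t, x))) ∧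
      0 ≤ (1 - (ν (t, x)).real univ) * ∑ i, φ t i x ^ 2 := by
  filter_upwards [ae_ae_of_ae_cyl (hz.ae_moments hb)] with t hmom
  filter_upwards [hmom] with x hx
  have h2 : 0 ≤ 1 - (ν (t, x)).real univ := by
    rw [sub_nonneg, Measure.real]
    exact ENNReal.toReal_le_of_le_ofReal zero_le_one (by simpa using hx.1)
  exact ⟨integral_nonneg fun y => Finset.sum_nonneg fun _ _ => sq_nonneg _,
    mul_nonneg h2 (Finset.sum_nonneg fun _ _ => sq_nonneg _)⟩

lemma gradRel_nonneg (hg : IsDefiningFunction g Ω) (hb : Bornology.IsBounded Ω)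
    (hs : IsStrongSolution T γ Ω r U Φ) (hz : GeneratedBy T Ω z ν m) (hpot : HasPotential T Ω ν) :
    ∀ᵐ t ∂(volume.restrict (Ioo 0 T)),
      0 ≤ gradRel Ω (fun x => ν (t, x)) (m t) (fun i x => pd Ω i (Φ t) x) := by
  filter_upwards [hz.gradRel_eq hg hb hs hpot, hz.sint_gradSq_nonneg hg.isOpen hb,
    hz.ae_integrand_nonneg hb fun t i x => pd Ω i (Φ t) x] with t h1 h2 h3
  rw [h1.2]
  refine add_nonneg (integral_nonneg_of_ae ?_) h2
  filter_upwards [h3] with x hx using add_nonneg hx.1 hx.2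

lemma kinRel_integrand_eq (u v : Fin d → ℝ) (s : ℝ) :
    1 * (s * ∑ i, v i ^ 2) - 2 * (∑ i, u i * (s * v i)) + (∑ i, u i ^ 2) * s
      = s * ∑ i, (v i - u i) ^ 2 := by
  have : ∑ i, (v i - u i) ^ 2 = (∑ i, v i ^ 2) - 2 * (∑ i, u i * v i) + ∑ i, u i ^ 2 := by
    simp only [Finset.mul_sum, ← Finset.sum_sub_distrib, ← Finset.sum_add_distrib]
    exact Finset.sum_congr rfl fun i _ => by ring
  have h2 : ∑ i, u i * (s * v i) = s * ∑ i, u i * v i := by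
    rw [Finset.mul_sum]; exact Finset.sum_congr rfl fun i _ => by ring
  rw [this, h2]; ring

lemma kinRel_nonneg (hg : IsDefiningFunction g Ω) (hb : Bornology.IsBounded Ω)
    (hs : IsStrongSolution T γ Ω r U Φ) (h0 : 0 < τ) (hτ : τ < T) (hz : GeneratedBy T Ω z ν m) :
    ∀ᵐ t ∂(volume.restrict (Ioo 0 τ)),
      0 ≤ kinRel Ω (fun x => ν (t, x)) (m t) (U t) := by
  obtain ⟨ζ, hζ⟩ := exists_isTimeCutoff h0 hτ
  filter_upwards [(hz.hasLimit_kinRel hg hb hs hζ).total_nonneg hg.isOpen hτ.le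
    fun t _ x _ y => by
      simp only [fKin, fMom, fRho, EuclideanSpace.real_norm_sq_eq, kinRel_integrand_eq]
      positivity, ae_restrict_mem measurableSet_Ioo] with t h ht
  rwa [hζ.eq_self t (Ioo_subset_Icc_self ht)] at h

end GeneratedBy

/-- The relative energy of a dissipative measure-valued solution that starts from the initial data
of the strong solution vanishes. -/
theorem IsDissipativeMVSolution.ae_relEnergy_eq_zero (hg : IsDefiningFunction g Ω)
    (hb : Bornology.IsBounded Ω) (hγ : 0 ≤ γ) (hT : 0 < T)
    (hs : IsStrongSolution T γ Ω r U Φ)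
    (hν₀ : ∀ᵐ x ∂(volume.restrict Ω),
      ν₀ x = Measure.dirac ((Real.toNNReal (r 0 x), U 0 x), grad Ω (Φ 0) x))
    (hmv : IsDissipativeMVSolution T γ Ω ν₀ 0 ν m) (hz : GeneratedBy T Ω z ν m) :
    ∀ᵐ t ∂(volume.restrict (Ioo 0 T)), kinRel Ω (fun x => ν (t, x)) (m t) (U t) = 0 ∧
      gradRel Ω (fun x => ν (t, x)) (m t) (fun i x => pd Ω i (Φ t) x) = 0 := by
  obtain ⟨hM, hμ₀, hP₀, hE₀⟩ := hs.initial hg hb hT hν₀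
  refine ae_restrict_Ioo_of_forall_lt fun τ h0 hτ => ?_
  have hsub : volume.restrict (Ioo 0 τ) ≤ volume.restrict (Ioo 0 T) :=
    Measure.restrict_mono (Ioo_subset_Ioo_right hτ.le) le_rfl
  obtain ⟨B, hB0, hB⟩ := hs.exists_bound_pd_U hg hb hτ
  obtain ⟨hint, hle⟩ := hz.relEnergy_le hg hb hs h0 hτ hmv.continuity hmv.momentum hmv.poisson
    hmv.potential hmv.energy hM hμ₀ hP₀ hE₀
  have hk0 := hz.kinRel_nonneg hg hb hs h0 hτ
  have hg0 := ae_mono hsub (hz.gradRel_nonneg hg hb hs hmv.potential)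
  have hrate : ∀ᵐ t ∂(volume.restrict (Ioo 0 τ)),
      kinRate T γ Ω U Φ (fun x => ν (t, x)) (m t) t
        + gradRate T (average Ω (r 0)) Ω U Φ (fun x => ν (t, x)) (m t) t
      ≤ 2 * (B * d) * (kinRel Ω (fun x => ν (t, x)) (m t) (U t)
        + gradRel Ω (fun x => ν (t, x)) (m t) (fun i x => pd Ω i (Φ t) x)) := by
    filter_upwards [hz.kinRate_le hg hb hs hγ h0 hτ hB,
      hz.gradRate_le hg hb hs h0 hτ hmv.poisson hM hmv.potential hB0 hB, hk0] with t h1 h2 h3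
    have : 0 ≤ B * d * kinRel Ω (fun x => ν (t, x)) (m t) (U t) := by positivity
    linarith
  have hi : IntegrableOn (fun t => kinRel Ω (fun x => ν (t, x)) (m t) (U t)
      + gradRel Ω (fun x => ν (t, x)) (m t) (fun i x => pd Ω i (Φ t) x)) (Ioo 0 τ) :=
    (hz.integrableOn_kinRel hg hb hs h0 hτ).add
      (hz.integrableOn_gradRel hg hb hs h0 hτ hmv.potential)
  have hzero := ae_eq_zero_of_le_mul_integral (C := 2 * (2 * (B * d))) h0 hi (by
    filter_upwards [hk0, hg0] with t h1 h2 using add_nonneg h1 h2) (by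
    filter_upwards [hle, ae_restrict_mem measurableSet_Ioo] with t h1 ht
    have h2 := intervalIntegral.integral_mono_ae_restrict ht.1.le
      (intervalIntegrable_of_integrableOn_Ioo hint ht)
      ((intervalIntegrable_of_integrableOn_Ioo hi ht).const_mul (2 * (B * d))) (by
        rw [← restrict_Ioo_eq_restrict_Icc]
        exact ae_mono (Measure.restrict_mono (Ioo_subset_Ioo_right ht.2.le) le_rfl) hrate)
    rw [intervalIntegral.integral_const_mul] at h2
    linarith)
  filter_upwards [hzero, hk0, hg0] with t h1 h2 h3
  constructor <;> linarith

end Vanishing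

/-! ### Signed measures are determined by trigonometric integrals -/

section Wave

/-- A countable family of bounded continuous functions that separates signed measures: the cosines
and sines with frequencies in a fixed dense sequence. -/
def wave (k : ℕ × Bool) (x : E d) : ℝ :=
  if k.2 then Real.cos (inner ℝ x (TopologicalSpace.denseSeq (E d) k.1))
  else Real.sin (inner ℝ x (TopologicalSpace.denseSeq (E d) k.1))

lemma continuous_wave (k : ℕ × Bool) : Continuous (wave (d := d) k) := by
  unfold wave
  split_ifs <;> fun_prop

lemma abs_wave_le_one (k : ℕ × Bool) (x : E d) : |wave k x| ≤ 1 := by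
  unfold wave
  split_ifs
  exacts [Real.abs_cos_le_one _, Real.abs_sin_le_one _]

lemma integrable_wave (μ : Measure (E d)) [IsFiniteMeasure μ] (k : ℕ × Bool) :
    Integrable (wave k) μ :=
  Integrable.of_bound (continuous_wave k).aestronglyMeasurable 1
    (ae_of_all _ fun x => abs_wave_le_one k x)

/-- Two finite measures with equal trigonometric integrals have characteristic functions that agree
on a dense set, hence everywhere. -/
lemma measure_ext_of_wave {μ ν : Measure (E d)} [IsFiniteMeasure μ] [IsFiniteMeasure ν]
    (h : ∀ k, ∫ x, wave k x ∂μ = ∫ x, wave k x ∂ν) : μ = ν := by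
  have key : ∀ (κ : Measure (E d)) [IsFiniteMeasure κ] (n : ℕ),
      charFun κ (TopologicalSpace.denseSeq (E d) n)
        = ((∫ x, wave (n, true) x ∂κ : ℝ) : ℂ) + ((∫ x, wave (n, false) x ∂κ : ℝ) : ℂ) * Complex.I := by
    intro κ _ n
    have i1 : Integrable (fun x => ((wave (n, true) x : ℝ) : ℂ)) κ :=
      (integrable_wave κ (n, true)).ofReal
    have i2 : Integrable (fun x => ((wave (n, false) x : ℝ) : ℂ) * Complex.I) κ :=
      (integrable_wave κ (n, false)).ofReal.mul_const _
    have e : (fun x : E d => Complex.exp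
        (((inner ℝ x (TopologicalSpace.denseSeq (E d) n) : ℝ) : ℂ) * Complex.I))
        = fun x => ((wave (n, true) x : ℝ) : ℂ) + ((wave (n, false) x : ℝ) : ℂ) * Complex.I := by
      funext x
      rw [Complex.exp_mul_I, ← Complex.ofReal_cos, ← Complex.ofReal_sin]
      rfl
    rw [charFun_apply, e, integral_add i1 i2, integral_mul_const, integral_complex_ofReal,
      integral_complex_ofReal]
  refine Measure.ext_of_charFun (Continuous.ext_on (TopologicalSpace.denseRange_denseSeq (E d))
    continuous_charFun continuous_charFun ?_)
  rintro _ ⟨n, rfl⟩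
  rw [key, key, h, h]

lemma sint_toSignedMeasure (μ : Measure (E d)) [IsFiniteMeasure μ] (c : E d → ℝ) :
    sint μ.toSignedMeasure c = ∫ x, c x ∂μ := by
  rw [← VectorMeasure.integral_toSignedMeasure, sint]
  congr 1
  ext
  simp

/-! ### Integrals of bounded continuous functions against signed measures -/

lemma integrable_variation_of_bounded (s : SignedMeasure (E d)) {c : E d → ℝ} (hc : Continuous c)
    {B : ℝ} (hB : ∀ x, |c x| ≤ B) : s.Integrable c := by
  have := isFiniteMeasure_variation s
  exact Integrable.of_bound (μ := s.variation) hc.aestronglyMeasurable B (ae_of_all _ hB)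

lemma sint_sub_measure (s t : SignedMeasure (E d)) {c : E d → ℝ} (hc : Continuous c)
    {B : ℝ} (hB : ∀ x, |c x| ≤ B) : sint (s - t) c = sint s c - sint t c :=
  VectorMeasure.integral_sub_vectorMeasure (integrable_variation_of_bounded s hc hB)
    (integrable_variation_of_bounded t hc hB)

lemma sint_add_measure (s t : SignedMeasure (E d)) {c : E d → ℝ} (hc : Continuous c)
    {B : ℝ} (hB : ∀ x, |c x| ≤ B) : sint (s + t) c = sint s c + sint t c :=
  VectorMeasure.integral_add_vectorMeasure (integrable_variation_of_bounded s hc hB)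
    (integrable_variation_of_bounded t hc hB)

lemma signedMeasure_ext_of_wave {s t : SignedMeasure (E d)}
    (h : ∀ k, sint s (wave k) = sint t (wave k)) : s = t := by
  rw [← sub_eq_zero]
  have h0 : ∀ k, sint (s - t) (wave k) = 0 := fun k => by
    rw [sint_sub_measure s t (continuous_wave k) (abs_wave_le_one k), h, sub_self]
  generalize s - t = σ at h0
  have e := SignedMeasure.toSignedMeasure_toJordanDecomposition σ
  rw [JordanDecomposition.toSignedMeasure] at e
  have := measure_ext_of_wave (μ := σ.toJordanDecomposition.posPart)
    (ν := σ.toJordanDecomposition.negPart) fun k => by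
      have h1 := h0 k
      rw [← e, sint_sub_measure _ _ (continuous_wave k) (abs_wave_le_one k),
        sint_toSignedMeasure, sint_toSignedMeasure] at h1
      exact sub_eq_zero.1 h1
  rw [← e]
  simp only [this, sub_self]

lemma sint_densityMeasure {Ω : Set (E d)} {h : E d → ℝ} (hh : IntegrableOn h Ω)
    {c : E d → ℝ} (hc : Continuous c) {B : ℝ} (hB : ∀ x, |c x| ≤ B) :
    sint (densityMeasure Ω h) c = ∫ x in Ω, h x * c x := by
  have f1 := isFiniteMeasure_withDensity_ofReal hh.2
  have f2 := isFiniteMeasure_withDensity_ofReal hh.neg.2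
  have b1 := hc.aestronglyMeasurable (μ := volume.restrict Ω)
  have hp : ∀ {u : E d → ℝ}, IntegrableOn u Ω →
      ∫ x, c x ∂((volume.restrict Ω).withDensity fun x => ENNReal.ofReal (u x))
        = ∫ x in Ω, max (u x) 0 * c x := fun {u} hu => by
    rw [integral_withDensity_eq_integral_toReal_smul₀
      hu.aestronglyMeasurable.aemeasurable.ennreal_ofReal
      (ae_of_all _ fun x => ENNReal.ofReal_lt_top)]
    simp only [ENNReal.toReal_ofReal', smul_eq_mul]
  have hi : ∀ {u : E d → ℝ}, IntegrableOn u Ω →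
      IntegrableOn (fun x => max (u x) 0 * c x) Ω := fun {u} hu =>
    Integrable.mul_bdd hu.pos_part b1 (ae_of_all _ hB)
  rw [densityMeasure, withDensityᵥ_eq_withDensity_pos_part_sub_withDensity_neg_part hh,
    sint_sub_measure _ _ hc hB, sint_toSignedMeasure, sint_toSignedMeasure, hp hh,
    hp (u := fun x => - h x) hh.neg, ← integral_sub (hi hh) (hi (u := fun x => - h x) hh.neg)]
  refine integral_congr_ae (ae_of_all _ fun x => ?_)
  rcases le_total 0 (h x) with h0 | h0
  · simp [h0]
  · simp [h0]

lemma IsBarState.sint_barMeasure {Ω : Set (E d)} {ν : E d → Measure (Phase d)}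
    {f : Phase d → ℝ} {μ : SignedMeasure (E d)} (h : IsBarState Ω ν f μ)
    {c : E d → ℝ} (hc : Continuous c) {B : ℝ} (hB : ∀ x, |c x| ≤ B) :
    sint (barMeasure Ω ν f μ) c = barInt Ω ν f μ c := by
  rw [barMeasure, sint_add_measure _ _ hc hB, barInt]
  congr 1
  exact sint_densityMeasure h.integrable hc hB

lemma exists_bounded_continuous_extension {Ω : Set (E d)} (hb : Bornology.IsBounded Ω)
    {c : E d → ℝ} (hc : ContinuousOn c (closure Ω)) :
    ∃ (c' : E d → ℝ) (B : ℝ), Continuous c' ∧ (∀ x, |c' x| ≤ B) ∧ ∀ x ∈ closure Ω, c x = c' x := by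
  obtain ⟨c₀, h1, h2⟩ := exists_continuous_extension isClosed_closure hc
  obtain ⟨B, hB⟩ := hb.isCompact_closure.exists_bound_of_continuousOn hc
  have hB' : ∀ x ∈ closure Ω, |c x| ≤ |B| := fun x hx => (hB x hx).trans (le_abs_self B)
  refine ⟨fun x => max (-|B|) (min |B| (c₀ x)), |B|, by fun_prop, fun x => abs_le.2
    ⟨le_max_left _ _, max_le (neg_le_self (abs_nonneg B)) (min_le_left _ _)⟩, fun x hx => ?_⟩
  obtain ⟨h3, h4⟩ := abs_le.1 (hB' x hx)
  simp only [h2 x hx, min_eq_right h4, max_eq_right h3]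

/-- If the barred measure is a density, then so are its integrals of functions that are only
continuous on the closure of the domain. -/
lemma IsBarState.barInt_eq_of_barMeasure_eq {Ω : Set (E d)} (hΩ : IsOpen Ω)
    (hb : Bornology.IsBounded Ω) {ν : E d → Measure (Phase d)} {f : Phase d → ℝ}
    {μ : SignedMeasure (E d)} (h : IsBarState Ω ν f μ) {w : E d → ℝ} (hw : IntegrableOn w Ω)
    (e : barMeasure Ω ν f μ = densityMeasure Ω w) {c : E d → ℝ}
    (hc : ContinuousOn c (closure Ω)) : barInt Ω ν f μ c = ∫ x in Ω, w x * c x := by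
  obtain ⟨c', B, h1, h2, h3⟩ := exists_bounded_continuous_extension hb hc
  rw [h.barInt_congr hΩ h3, ← h.sint_barMeasure h1 h2, e, sint_densityMeasure hw h1 h2]
  exact setIntegral_congr_fun hΩ.measurableSet fun x hx => by
    simp only [h3 x (subset_closure hx)]

end Wave

/-! ### Consequences of the vanishing of the relative energy -/

section Identification

variable {T γ τ : ℝ} {Ω : Set (E d)} {r : ℝ → E d → ℝ} {U : ℝ → E d → E d} {Φ : ℝ → E d → ℝ}
  {g : E d → ℝ} {z : ℕ → ℝ × E d → Phase d} {ν : ℝ × E d → Measure (Phase d)}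
  {m : ℝ → Defects d} {ν₀ : E d → Measure (Phase d)}

lemma ae_cyl_eq_zero {G : ℝ × E d → ℝ}
    (hG : AEStronglyMeasurable G (volume.restrict (cyl T Ω)))
    (h : ∀ᵐ t ∂(volume.restrict (Ioo 0 T)), ∀ᵐ x ∂(volume.restrict Ω), G (t, x) = 0) :
    ∀ᵐ p ∂(volume.restrict (cyl T Ω)), G p = 0 := by
  obtain ⟨G', hG', e⟩ := hG
  have h1 : ∀ᵐ p ∂(volume.restrict (cyl T Ω)), G' p = 0 := by
    rw [restrict_cyl]
    refine (Measure.ae_prod_iff_ae_ae (p := fun p => G' p = 0)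
      (hG'.measurable (measurableSet_singleton 0))).2 ?_
    filter_upwards [h, ae_ae_of_ae_cyl e] with t h2 h3
    filter_upwards [h2, h3] with x h4 h5 using h5.symm.trans h4
  filter_upwards [e, h1] with p h2 h3 using h2.trans h3

lemma ae_cyl_of_forall_lt {P : ℝ × E d → Prop}
    (h : ∀ τ, 0 < τ → τ < T → ∀ᵐ p ∂(volume.restrict (cyl τ Ω)), P p) :
    ∀ᵐ p ∂(volume.restrict (cyl T Ω)), P p := by
  have hsub : cyl T Ω ⊆ ⋃ n : ℕ, cyl (T - 1 / ((n : ℝ) + 1)) Ω := fun p hp => by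
    obtain ⟨n, hn⟩ := exists_nat_one_div_lt (sub_pos.2 hp.1.2)
    exact mem_iUnion.2 ⟨n, ⟨hp.1.1, by linarith⟩, hp.2⟩
  refine ae_mono (Measure.restrict_mono hsub le_rfl)
    ((ae_restrict_iUnion_iff _ _).2 fun n => ?_)
  rcases le_or_gt (T - 1 / ((n : ℝ) + 1)) 0 with h0 | h0
  · have : cyl (T - 1 / ((n : ℝ) + 1)) Ω = ∅ := by
      rw [cyl, Ioo_eq_empty (not_lt.2 h0), empty_prod]
    rw [this, Measure.restrict_empty]
    simp
  · exact h _ h0 (sub_lt_self _ (by positivity))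

namespace GeneratedBy

/-- If the relative energy of the field vanishes, then the field equals `∇Φ` almost surely, no mass
is lost where `∇Φ ≠ 0`, and the field does not concentrate. -/
lemma ae_field (hg : IsDefiningFunction g Ω) (hb : Bornology.IsBounded Ω)
    (hs : IsStrongSolution T γ Ω r U Φ) (hz : GeneratedBy T Ω z ν m) (hpot : HasPotential T Ω ν)
    (h0 : ∀ᵐ t ∂(volume.restrict (Ioo 0 T)),
      gradRel Ω (fun x => ν (t, x)) (m t) (fun i x => pd Ω i (Φ t) x) = 0) :
    (∀ᵐ t ∂(volume.restrict (Ioo 0 T)), sint (m t).gradSq (fun _ => 1) = 0) ∧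
    ∀ᵐ p ∂(volume.restrict (cyl T Ω)), (∀ᵐ y ∂(ν p), y.2 = grad Ω (Φ p.1) p.2) ∧
      ∀ i, ∫ y, fGrad i y ∂(ν p) = pd Ω i (Φ p.1) p.2 := by
  have hΩ := hg.isOpen
  have key : ∀ᵐ t ∂(volume.restrict (Ioo 0 T)), sint (m t).gradSq (fun _ => 1) = 0 ∧
      ∀ᵐ x ∂(volume.restrict Ω), (∫ y, ∑ i, (y.2 i - pd Ω i (Φ t) x) ^ 2 ∂(ν (t, x)))
        + (1 - (ν (t, x)).real univ) * ∑ i, pd Ω i (Φ t) x ^ 2 = 0 := by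
    filter_upwards [hz.gradRel_eq hg hb hs hpot, hz.sint_gradSq_nonneg hΩ hb,
      hz.ae_integrand_nonneg hb fun t i x => pd Ω i (Φ t) x, h0] with t h1 h2 h3 h4
    have h5 : 0 ≤ᵐ[volume.restrict Ω] fun x =>
        (∫ y, ∑ i, (y.2 i - pd Ω i (Φ t) x) ^ 2 ∂(ν (t, x)))
          + (1 - (ν (t, x)).real univ) * ∑ i, pd Ω i (Φ t) x ^ 2 := by
      filter_upwards [h3] with x hx using add_nonneg hx.1 hx.2
    have h6 := integral_nonneg_of_ae h5
    rw [h1.2] at h4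
    refine ⟨by linarith, (integral_eq_zero_iff_of_nonneg_ae h5 h1.1).1 (by linarith)⟩
  refine ⟨key.mono fun t ht => ht.1, ?_⟩
  have hφ : ∀ i, AEStronglyMeasurable (fun p : ℝ × E d => pd Ω i (Φ p.1) p.2)
      (volume.restrict (cyl T Ω)) := fun i =>
    ((hs.contDiffOn_grad hg i).continuousOn.mono
      (prod_mono Ioo_subset_Ico_self subset_closure)).aestronglyMeasurable (measurableSet_cyl hΩ)
  have hmeas : AEStronglyMeasurable (fun p : ℝ × E d =>
      (∫ y, fGradSq y ∂(ν p)) * 1 - 2 * (∑ i, (∫ y, fGrad i y ∂(ν p)) * pd Ω i (Φ p.1) p.2)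
        + ∑ i, pd Ω i (Φ p.1) p.2 ^ 2) (volume.restrict (cyl T Ω)) := by
    refine ((hz.gradSq.2.2.2.1.aestronglyMeasurable.mul_const 1).sub
      (AEStronglyMeasurable.const_mul ?_ 2)).add ?_
    · exact Finset.aestronglyMeasurable_fun_sum _ fun i _ =>
        ((hpot.ae_hasWeakGradient hΩ hb).1 i).aestronglyMeasurable.mul (hφ i)
    · exact Finset.aestronglyMeasurable_fun_sum _ fun i _ => (hφ i).pow 2
  have hmom := hz.ae_moments hb
  have hzero := ae_cyl_eq_zero hmeas (by
    filter_upwards [key, ae_ae_of_ae_cyl hmom] with t h1 h2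
    filter_upwards [h1.2, h2] with x h3 h4
    rw [← h3]
    exact field_integrand_eq h4.1 h4.2.1 h4.2.2 _)
  filter_upwards [hzero, hmom] with p h1 hmp
  obtain ⟨h2, h3, h4⟩ := hmp
  rw [field_integrand_eq h2 h3 h4] at h1
  have hfin : IsFiniteMeasure (ν p) := ⟨h2.trans_lt ENNReal.one_lt_top⟩
  have hsq : ∀ y : Phase d, 0 ≤ ∑ i, (y.2 i - pd Ω i (Φ p.1) p.2) ^ 2 :=
    fun y => Finset.sum_nonneg fun _ _ => sq_nonneg _
  have h5 : 0 ≤ 1 - (ν p).real univ := by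
    rw [sub_nonneg, Measure.real]
    exact ENNReal.toReal_le_of_le_ofReal zero_le_one (by simpa using h2)
  have h6 := mul_nonneg h5 (Finset.sum_nonneg fun i (_ : i ∈ Finset.univ) =>
    sq_nonneg (pd Ω i (Φ p.1) p.2))
  have h7 : 0 ≤ ∫ y, ∑ i, (y.2 i - pd Ω i (Φ p.1) p.2) ^ 2 ∂(ν p) :=
    integral_nonneg fun y => hsq y
  have hi : Integrable (fun y : Phase d => ∑ i, (y.2 i - pd Ω i (Φ p.1) p.2) ^ 2) (ν p) := by
    refine integrable_finsetSum _ fun i _ => ?_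
    have e : (fun y : Phase d => (y.2 i - pd Ω i (Φ p.1) p.2) ^ 2) = fun y =>
        fGradTensor i i y - 2 * pd Ω i (Φ p.1) p.2 * fGrad i y + pd Ω i (Φ p.1) p.2 ^ 2 := by
      funext y; simp only [fGradTensor, fGrad]; ring
    rw [e]
    exact ((h4 i i).sub ((integrable_fGrad h3 i).const_mul _)).add (integrable_const _)
  have h8 : ∀ᵐ y ∂(ν p), y.2 = grad Ω (Φ p.1) p.2 := by
    filter_upwards [(integral_eq_zero_iff_of_nonneg hsq hi).1 (by linarith)] with y hy
    ext i
    have := (Finset.sum_eq_zero_iff_of_nonneg fun _ _ => sq_nonneg _).1 hy i (Finset.mem_univ i)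
    simpa [sub_eq_zero, grad] using this
  refine ⟨h8, fun i => ?_⟩
  have h9 : (1 - (ν p).real univ) * pd Ω i (Φ p.1) p.2 = 0 := by
    rcases mul_eq_zero.1 (show (1 - (ν p).real univ) * ∑ i, pd Ω i (Φ p.1) p.2 ^ 2 = 0 by
      linarith) with h | h
    · rw [h, zero_mul]
    · have := (Finset.sum_eq_zero_iff_of_nonneg fun _ _ => sq_nonneg _).1 h i (Finset.mem_univ i)
      rw [pow_eq_zero_iff two_ne_zero] at this
      rw [this, mul_zero]
  have h10 : ∫ y, fGrad i y ∂(ν p) = ∫ _y : Phase d, pd Ω i (Φ p.1) p.2 ∂(ν p) :=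
    integral_congr_ae (h8.mono fun y hy => by simp only [fGrad, hy, grad])
  rw [h10, integral_const, smul_eq_mul]
  linarith

/-- If the kinetic relative energy vanishes, then the velocity equals `U` almost surely where the
density is positive. -/
lemma ae_velocity (hg : IsDefiningFunction g Ω) (hb : Bornology.IsBounded Ω)
    (hs : IsStrongSolution T γ Ω r U Φ) (hz : GeneratedBy T Ω z ν m)
    (h0 : ∀ᵐ t ∂(volume.restrict (Ioo 0 T)), kinRel Ω (fun x => ν (t, x)) (m t) (U t) = 0) :
    ∀ᵐ p ∂(volume.restrict (cyl T Ω)), ∀ᵐ y ∂(ν p), 0 < y.1.1 → y.1.2 = U p.1 p.2 := by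
  have hΩ := hg.isOpen
  refine ae_cyl_of_forall_lt fun τ hτ0 hτ => ?_
  obtain ⟨ζ, hζ⟩ := exists_isTimeCutoff hτ0 hτ
  have H := hz.hasLimit_kinRel hg hb hs hζ
  have hsubI : volume.restrict (Ioo 0 τ) ≤ volume.restrict (Ioo 0 T) :=
    Measure.restrict_mono (Ioo_subset_Ioo_right hτ.le) le_rfl
  have hsub : volume.restrict (cyl τ Ω) ≤ volume.restrict (cyl T Ω) :=
    Measure.restrict_mono (prod_mono (Ioo_subset_Ioo_right hτ.le) subset_rfl) le_rfl
  have eh : ∀ (p : ℝ × E d) (y : Phase d), 1 * fKin y - 2 * (∑ i, U (ζ p.1) p.2 i * fMom i y)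
      + (∑ i, U (ζ p.1) p.2 i ^ 2) * fRho y
      = (y.1.1 : ℝ) * ∑ i, (y.1.2 i - U (ζ p.1) p.2 i) ^ 2 := fun p y => by
    simp only [fKin, fMom, fRho, EuclideanSpace.real_norm_sq_eq, kinRel_integrand_eq]
  simp only [eh] at H
  have hpos : ∀ (p : ℝ × E d) (y : Phase d),
      0 ≤ (y.1.1 : ℝ) * ∑ i, (y.1.2 i - U (ζ p.1) p.2 i) ^ 2 := fun p y => by positivity
  have hosc := H.integrable_osc
  rw [IntegrableOn, restrict_cyl] at hosc
  have hzero := ae_cyl_eq_zero (T := τ) (H.integrable_osc.aestronglyMeasurable.mono_measure hsub) (by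
    filter_upwards [ae_mono hsubI (H.ae_eq_integral_add hΩ hb), ae_mono hsubI h0,
      H.defect_nonneg hΩ hb hz.young.2.1 hτ.le fun t _ x _ y => hpos (t, x) y,
      ae_mono hsubI hosc.prod_right_ae,
      ae_restrict_mem measurableSet_Ioo] with t h1 h2 h3 h4 ht
    rw [hζ.eq_self t (Ioo_subset_Icc_self ht), h2] at h1
    have h5 : 0 ≤ fun x => ∫ y : Phase d, (y.1.1 : ℝ) * ∑ i, (y.1.2 i - U (ζ t) x i) ^ 2 ∂(ν (t, x)) :=
      fun x => integral_nonneg fun y => hpos (t, x) y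
    have h6 := integral_nonneg (μ := volume.restrict Ω) h5
    refine (integral_eq_zero_iff_of_nonneg h5 h4).1 ?_
    simp only [hζ.eq_self t (Ioo_subset_Icc_self ht)] at h1 h3 h6 ⊢
    linarith)
  filter_upwards [hzero, ae_mono hsub H.ae_integrable, ae_restrict_mem (measurableSet_cyl hΩ)]
    with p h1 h2 hp
  filter_upwards [(integral_eq_zero_iff_of_nonneg (fun y => hpos p y) h2).1 h1] with y hy hy0
  rw [hζ.eq_self p.1 (Ioo_subset_Icc_self hp.1)] at hy
  have h3 := (mul_eq_zero.1 hy).resolve_left (NNReal.coe_pos.2 hy0).ne'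
  ext i
  have := (Finset.sum_eq_zero_iff_of_nonneg fun _ _ => sq_nonneg _).1 h3 i (Finset.mem_univ i)
  simpa [sub_eq_zero] using this

end GeneratedBy

end Identification

/-! ### Identification of the measures -/

section Measures

variable {T γ τ : ℝ} {Ω : Set (E d)} {r : ℝ → E d → ℝ} {U : ℝ → E d → E d} {Φ : ℝ → E d → ℝ}
  {g : E d → ℝ} {z : ℕ → ℝ × E d → Phase d} {ν : ℝ × E d → Measure (Phase d)}
  {m : ℝ → Defects d} {ν₀ : E d → Measure (Phase d)} {m₀ : Defects d}

lemma contDiff_wave (k : ℕ × Bool) : ContDiff ℝ 1 (wave (d := d) k) := by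
  unfold wave
  split_ifs
  · exact Real.contDiff_cos.comp (contDiff_id.inner ℝ contDiff_const)
  · exact Real.contDiff_sin.comp (contDiff_id.inner ℝ contDiff_const)

lemma absolutelyContinuous_of_barMeasure_eq {ν : E d → Measure (Phase d)} {f : Phase d → ℝ}
    {μ : SignedMeasure (E d)} {w : E d → ℝ} (h : barMeasure Ω ν f μ = densityMeasure Ω w) :
    μ ≪ᵥ volume.toENNRealVectorMeasure := by
  have key : ∀ u : E d → ℝ,
      densityMeasure Ω u ≪ᵥ (volume : Measure (E d)).toENNRealVectorMeasure := fun u =>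
    VectorMeasure.AbsolutelyContinuous.mk fun s hs h0 => by
      refine Measure.withDensityᵥ_absolutelyContinuous (volume.restrict Ω) u ?_
      rw [Measure.toENNRealVectorMeasure_apply_measurable hs] at h0 ⊢
      exact Measure.absolutelyContinuous_of_le Measure.restrict_le_self h0
  rw [eq_sub_of_add_eq' h]
  exact (key w).sub (key _)

namespace GeneratedBy

/-- By the Poisson equation, the field determines the density. -/
lemma ae_barMeasure_rho_eq (hg : IsDefiningFunction g Ω) (hb : Bornology.IsBounded Ω)
    (hs : IsStrongSolution T γ Ω r U Φ) (hz : GeneratedBy T Ω z ν m)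
    (hP : MVPoisson T Ω ν₀ m₀ ν m) (hM : meanDensity Ω ν₀ m₀ = average Ω (r 0))
    (hF : ∀ᵐ p ∂(volume.restrict (cyl T Ω)), ∀ i, ∫ y, fGrad i y ∂(ν p) = pd Ω i (Φ p.1) p.2) :
    ∀ᵐ t ∂(volume.restrict (Ioo 0 T)),
      barMeasure Ω (fun x => ν (t, x)) fRho (m t).rho = densityMeasure Ω (r t) := by
  have hΩ := hg.isOpen
  filter_upwards [hz.rho.ae_isBarState, hP, ae_ae_of_ae_cyl hF,
    ae_restrict_mem measurableSet_Ioo] with t hμ hP hF ht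
  have ht' := Ioo_subset_Ico_self ht
  have hr := (hs.contDiffOn_r_slice ht').continuousOn
  have io : ∀ {v : E d → ℝ}, ContinuousOn v (closure Ω) → IntegrableOn v Ω :=
    fun hv => integrableOn_of_continuousOn_closure hΩ hb hv
  refine signedMeasure_ext_of_wave fun k => ?_
  have hk : ContDiffOn ℝ 1 (wave (d := d) k) (closure Ω) := (contDiff_wave k).contDiffOn
  rw [hμ.sint_barMeasure (continuous_wave k) (abs_wave_le_one k),
    sint_densityMeasure (io hr) (continuous_wave k) (abs_wave_le_one k)]
  have h1 := hP _ hk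
  have h2 := hs.integral_grad_mul hg hb ht'
    (hasWeakGradient_of_contDiffOn hΩ hb hg.uniqueDiffOn_closure hk)
  have h3 : ∀ i, ∫ x in Ω, (∫ y, fGrad i y ∂(ν (t, x))) * pd Ω i (wave k) x
      = ∫ x in Ω, pd Ω i (wave k) x * pd Ω i (Φ t) x := fun i => by
    refine integral_congr_ae ?_
    filter_upwards [hF] with x hx
    rw [hx i, mul_comm]
  rw [Finset.sum_congr rfl fun i _ => h3 i, h2, hM] at h1
  have h4 : ∫ x in Ω, r t x * wave k x = (∫ x in Ω, wave k x * (r t x - average Ω (r 0)))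
      + average Ω (r 0) * ∫ x in Ω, wave k x := by
    rw [← integral_const_mul, ← integral_add
      (io (hk.continuousOn.fun_mul (hr.fun_sub continuousOn_const)))
      ((io hk.continuousOn).const_mul _)]
    congr 1; funext x; ring
  rw [h4]; linarith

/-- If the kinetic relative energy vanishes, and if `f - a s` is controlled by an arbitrarily small
multiple of `s` up to a multiple of `s |v - U|²`, then the barred measures of `f` and `s` are
related by `f̄ = a ρ̄`. -/
lemma ae_barInt_eq (hg : IsDefiningFunction g Ω) (hb : Bornology.IsBounded Ω)
    (hs : IsStrongSolution T γ Ω r U Φ) (hz : GeneratedBy T Ω z ν m)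
    (hK : ∀ᵐ t ∂(volume.restrict (Ioo 0 T)), kinRel Ω (fun x => ν (t, x)) (m t) (U t) = 0)
    {f : Phase d → ℝ} (hf : Continuous f) {μ : ℝ → SignedMeasure (E d)}
    (hμ : IsConcentrationMeasure T Ω z ν f μ) {a : ℝ → E d → ℝ}
    (ha : ContinuousOn (fun p : ℝ × E d => a p.1 p.2) (Ico 0 T ×ˢ closure Ω))
    (hfa : ∀ τ < T, ∀ ε > 0, ∃ C : ℝ, ∀ t ∈ Ioo 0 τ, ∀ x ∈ Ω, ∀ y : Phase d,
      |f y - a t x * fRho y| ≤ ε * fRho y + C * (y.1.1 * ∑ i, (y.1.2 i - U t x i) ^ 2)) :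
    ∀ᵐ t ∂(volume.restrict (Ioo 0 T)), ∀ k, barInt Ω (fun x => ν (t, x)) f (μ t) (wave k)
      = barInt Ω (fun x => ν (t, x)) fRho (m t).rho (fun x => a t x * wave k x) := by
  have hΩ := hg.isOpen
  have hz' := hz.young.2.1
  refine ae_restrict_Ioo_of_forall_lt fun τ h0 hτ => ?_
  rw [ae_all_iff]
  intro k
  obtain ⟨ζ, hζ⟩ := exists_isTimeCutoff h0 hτ
  have hsub : volume.restrict (Ioo 0 τ) ≤ volume.restrict (Ioo 0 T) :=
    Measure.restrict_mono (Ioo_subset_Ioo_right hτ.le) le_rfl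
  have key : ∀ n : ℕ, ∀ᵐ t ∂(volume.restrict (Ioo 0 τ)),
      |barInt Ω (fun x => ν (t, x)) f (μ t) (wave k)
        - barInt Ω (fun x => ν (t, x)) fRho (m t).rho (fun x => a t x * wave k x)|
      ≤ 1 / ((n : ℝ) + 1) * barInt Ω (fun x => ν (t, x)) fRho (m t).rho (fun _ => 1) := by
    intro n
    obtain ⟨C, hC⟩ := hfa τ hτ (1 / ((n : ℝ) + 1)) (by positivity)
    have H1 := ((HasLimit.of_concentration hΩ hb hz.young continuous_fRho hz.rho
      (c := fun _ => 1) continuousOn_const).const_mul (1 / ((n : ℝ) + 1))).add hΩ hb hz'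
      ((hz.hasLimit_kinRel hg hb hs hζ).const_mul C)
    have H2 := (HasLimit.of_concentration hΩ hb hz.young hf hμ
      (c := fun p => wave k p.2) ((continuous_wave k).comp continuous_snd).continuousOn).sub hΩ hb hz'
      (HasLimit.of_concentration hΩ hb hz.young continuous_fRho hz.rho
        (c := fun p => a (ζ p.1) p.2 * wave k p.2)
        ((hζ.continuousOn_comp ha).mul ((continuous_wave k).comp continuous_snd).continuousOn))
    have hpt : ∀ t ∈ Ioo 0 τ, ∀ x ∈ Ω, ∀ y : Phase d,
        |wave k x * f y - a (ζ t) x * wave k x * fRho y|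
        ≤ 1 / ((n : ℝ) + 1) * (1 * fRho y) + C * (1 * fKin y - 2 * (∑ i, U (ζ t) x i * fMom i y)
          + (∑ i, U (ζ t) x i ^ 2) * fRho y) := fun t ht x hx y => by
      simp only [hζ.eq_self t (Ioo_subset_Icc_self ht)]
      have h1 := hC t ht x hx y
      have e : wave k x * f y - a t x * wave k x * fRho y
          = wave k x * (f y - a t x * fRho y) := by ring
      have h2 : |wave k x| * |f y - a t x * fRho y| ≤ 1 * |f y - a t x * fRho y| :=
        mul_le_mul_of_nonneg_right (abs_wave_le_one k x) (abs_nonneg _)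
      rw [e, abs_mul]
      simp only [fKin, fMom, EuclideanSpace.real_norm_sq_eq]
      simp only [fRho] at h1 h2 ⊢
      rw [kinRel_integrand_eq, one_mul]
      linarith
    have h1 := (H1.sub hΩ hb hz' H2).total_nonneg hΩ hτ.le fun t ht x hx y =>
      sub_nonneg.2 ((le_abs_self _).trans (hpt t ht x hx y))
    have h2 := (H1.add hΩ hb hz' H2).total_nonneg hΩ hτ.le fun t ht x hx y => by
      have := (abs_le.1 (hpt t ht x hx y)).1
      linarith
    filter_upwards [h1, h2, ae_mono hsub hK, ae_restrict_mem measurableSet_Ioo] with t h1 h2 h3 ht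
    simp only [hζ.eq_self t (Ioo_subset_Icc_self ht), h3] at h1 h2
    exact abs_le.2 ⟨by linarith, by linarith⟩
  filter_upwards [ae_all_iff.2 key] with t ht
  have hlim : Tendsto (fun n : ℕ => 1 / ((n : ℝ) + 1)
      * barInt Ω (fun x => ν (t, x)) fRho (m t).rho (fun _ => 1)) atTop (𝓝 0) := by
    simpa using tendsto_one_div_add_atTop_nhds_zero_nat.mul_const
      (barInt Ω (fun x => ν (t, x)) fRho (m t).rho (fun _ => 1))
  exact sub_eq_zero.1 (abs_nonpos_iff.1 (ge_of_tendsto' hlim ht))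

/-- The version of `ae_barInt_eq` for measures, once the density is identified. -/
lemma ae_barMeasure_eq (hg : IsDefiningFunction g Ω) (hb : Bornology.IsBounded Ω)
    (hs : IsStrongSolution T γ Ω r U Φ) (hz : GeneratedBy T Ω z ν m)
    (hK : ∀ᵐ t ∂(volume.restrict (Ioo 0 T)), kinRel Ω (fun x => ν (t, x)) (m t) (U t) = 0)
    (hρ : ∀ᵐ t ∂(volume.restrict (Ioo 0 T)),
      barMeasure Ω (fun x => ν (t, x)) fRho (m t).rho = densityMeasure Ω (r t))
    {f : Phase d → ℝ} (hf : Continuous f) {μ : ℝ → SignedMeasure (E d)}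
    (hμ : IsConcentrationMeasure T Ω z ν f μ) {a : ℝ → E d → ℝ}
    (ha : ContinuousOn (fun p : ℝ × E d => a p.1 p.2) (Ico 0 T ×ˢ closure Ω))
    (hfa : ∀ τ < T, ∀ ε > 0, ∃ C : ℝ, ∀ t ∈ Ioo 0 τ, ∀ x ∈ Ω, ∀ y : Phase d,
      |f y - a t x * fRho y| ≤ ε * fRho y + C * (y.1.1 * ∑ i, (y.1.2 i - U t x i) ^ 2)) :
    ∀ᵐ t ∂(volume.restrict (Ioo 0 T)),
      barMeasure Ω (fun x => ν (t, x)) f (μ t) = densityMeasure Ω (fun x => r t x * a t x) := by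
  have hΩ := hg.isOpen
  filter_upwards [hz.ae_barInt_eq hg hb hs hK hf hμ ha hfa, hρ, hz.rho.ae_isBarState,
    hμ.ae_isBarState, ae_restrict_mem measurableSet_Ioo] with t h1 h2 h3 h4 ht
  have ht' := Ioo_subset_Ico_self ht
  have hr := (hs.contDiffOn_r_slice ht').continuousOn
  have hat : ContinuousOn (a t) (closure Ω) :=
    ha.comp (f := fun x : E d => (t, x)) (by fun_prop) fun x hx => ⟨ht', hx⟩
  have io : ∀ {v : E d → ℝ}, ContinuousOn v (closure Ω) → IntegrableOn v Ω :=
    fun hv => integrableOn_of_continuousOn_closure hΩ hb hv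
  refine signedMeasure_ext_of_wave fun k => ?_
  rw [h4.sint_barMeasure (continuous_wave k) (abs_wave_le_one k), h1 k,
    sint_densityMeasure (io (hr.fun_mul hat)) (continuous_wave k) (abs_wave_le_one k),
    h3.barInt_eq_of_barMeasure_eq hΩ hb (io hr) h2 (hat.fun_mul (continuous_wave k).continuousOn)]
  simp only [mul_assoc]

/-- A nonlinearity that is dominated by `|F|²` does not concentrate, if `|F|²` does not. -/
lemma ae_concentration_eq_zero (hΩ : IsOpen Ω) (hb : Bornology.IsBounded Ω)
    (hz : GeneratedBy T Ω z ν m)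
    (h0 : ∀ᵐ t ∂(volume.restrict (Ioo 0 T)), sint (m t).gradSq (fun _ => 1) = 0)
    {f : Phase d → ℝ} (hf : Continuous f) {μ : ℝ → SignedMeasure (E d)}
    (hμ : IsConcentrationMeasure T Ω z ν f μ) (hle : ∀ y, |f y| ≤ fGradSq y) :
    ∀ᵐ t ∂(volume.restrict (Ioo 0 T)), μ t = 0 := by
  have hz' := hz.young.2.1
  have key : ∀ k, ∀ᵐ t ∂(volume.restrict (Ioo 0 T)), sint (μ t) (wave k) = 0 := fun k => by
    have H1 := HasLimit.of_concentration hΩ hb hz.young continuous_fGradSq hz.gradSq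
      (c := fun _ => 1) continuousOn_const
    have H2 := HasLimit.of_concentration hΩ hb hz.young hf hμ
      (c := fun p => wave k p.2) ((continuous_wave k).comp continuous_snd).continuousOn
    have hpt : ∀ (x : E d) (y : Phase d), |wave k x * f y| ≤ 1 * fGradSq y := fun x y => by
      rw [abs_mul]
      exact mul_le_mul (abs_wave_le_one k x) (hle y) (abs_nonneg _) zero_le_one
    filter_upwards [(H1.sub hΩ hb hz' H2).defect_nonneg hΩ hb hz' le_rfl fun t _ x _ y =>
        sub_nonneg.2 ((le_abs_self _).trans (hpt x y)),
      (H1.add hΩ hb hz' H2).defect_nonneg hΩ hb hz' le_rfl fun t _ x _ y => by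
        have := (abs_le.1 (hpt x y)).1
        linarith, h0] with t h1 h2 h3
    rw [h3] at h1 h2
    linarith
  filter_upwards [ae_all_iff.2 key] with t ht
  exact signedMeasure_ext_of_wave fun k => by rw [ht k, sint_zero_measure]

end GeneratedBy

end Measures

/-! ### Structure of the Young measure -/

section Young

variable {T γ τ : ℝ} {Ω : Set (E d)} {r : ℝ → E d → ℝ} {U : ℝ → E d → E d} {Φ : ℝ → E d → ℝ}
  {g : E d → ℝ} {z : ℕ → ℝ × E d → Phase d} {ν : ℝ × E d → Measure (Phase d)}
  {m : ℝ → Defects d}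

lemma eq_map_fst_prod_dirac {α β : Type*} [MeasurableSpace α] [MeasurableSpace β]
    {μ : Measure (α × β)} [IsFiniteMeasure μ] {b : β} (h : ∀ᵐ y ∂μ, y.2 = b) :
    μ = (μ.map Prod.fst).prod (Measure.dirac b) := by
  rw [Measure.prod_dirac, Measure.map_map (by fun_prop) measurable_fst]
  conv_lhs => rw [← Measure.map_id (μ := μ)]
  exact Measure.map_congr (h.mono fun y hy => Prod.ext rfl hy)

/-- The pairing of a parameterized measure with a bounded continuous function is measurable, being a
limit of pairings with compactly supported functions. -/
lemma IsParameterizedMeasure.aemeasurable_integral {X : Set (ℝ × E d)}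
    (hν : IsParameterizedMeasure X ν) {f : Phase d → ℝ} (hf : Continuous f) {B : ℝ}
    (hB : ∀ y, |f y| ≤ B) :
    AEMeasurable (fun p => ∫ y, f y ∂(ν p)) (volume.restrict X) := by
  obtain ⟨C, hC⟩ := hν.2
  let F : ℕ → ZeroAtInftyContinuousMap (Phase d) ℝ := fun n =>
    ⟨⟨fun y => phaseCutoff n y * f y, (continuous_phaseCutoff n).mul hf⟩,
      ((hasCompactSupport_phaseCutoff n).mul_right (f' := f)).is_zero_at_infty⟩
  refine aemeasurable_of_tendsto_metrizable_ae atTop (fun n => hν.1 (F n)) ?_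
  filter_upwards [hC] with p hp
  have hfin : IsFiniteMeasure (ν p) := ⟨hp.trans_lt ENNReal.coe_lt_top⟩
  exact tendsto_integral_phaseCutoff_mul
    (Integrable.of_bound hf.aestronglyMeasurable B (ae_of_all _ hB))

lemma exists_bound_zeroAtInfty {Y : Type*} [TopologicalSpace Y]
    (f : ZeroAtInftyContinuousMap Y ℝ) : ∃ B : ℝ, ∀ y, |f y| ≤ B :=
  ⟨‖f.toBCF‖, fun y => f.toBCF.norm_coe_le_norm y⟩

/-- The joint distribution of density and velocity of a Young measure. -/
def stateMarginal (ν : ℝ × E d → Measure (Phase d)) (p : ℝ × E d) : Measure (ℝ≥0 × E d) :=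
  (ν p).map Prod.fst

/-- The distribution of the density of a Young measure, vacuum discarded. -/
def densityMarginal (ν : ℝ × E d → Measure (Phase d)) (p : ℝ × E d) : Measure ℝ≥0 :=
  ((stateMarginal ν p).restrict (Ioi 0 ×ˢ univ)).map Prod.fst

lemma measurableSet_pos : MeasurableSet (Ioi 0 ×ˢ univ : Set (ℝ≥0 × E d)) :=
  measurableSet_Ioi.prod MeasurableSet.univ

lemma stateMarginal_univ (p : ℝ × E d) : stateMarginal ν p univ = ν p univ := by
  rw [stateMarginal, Measure.map_apply measurable_fst MeasurableSet.univ, preimage_univ]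

lemma densityMarginal_univ_le (p : ℝ × E d) : densityMarginal ν p univ ≤ ν p univ := by
  rw [densityMarginal, Measure.map_apply measurable_fst MeasurableSet.univ, preimage_univ,
    ← stateMarginal_univ]
  exact Measure.restrict_apply_le _ _

lemma densityMarginal_zero (p : ℝ × E d) : densityMarginal ν p {0} = 0 := by
  rw [densityMarginal, Measure.map_apply measurable_fst (measurableSet_singleton 0),
    Measure.restrict_apply (measurable_fst (measurableSet_singleton 0))]
  convert measure_empty (μ := stateMarginal ν p)
  ext y
  simp only [mem_inter_iff, mem_preimage, mem_singleton_iff, mem_prod, mem_Ioi, mem_univ, and_true,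
    mem_empty_iff_false, iff_false, not_and]
  intro h
  simp [h]

lemma isParameterizedMeasure_stateMarginal {X : Set (ℝ × E d)}
    (hν : IsParameterizedMeasure X ν) : IsParameterizedMeasure X (stateMarginal ν) := by
  obtain ⟨C, hC⟩ := hν.2
  refine ⟨fun f => ?_, C, hC.mono fun p hp => (stateMarginal_univ p).trans_le hp⟩
  obtain ⟨B, hB⟩ := exists_bound_zeroAtInfty f
  refine (hν.aemeasurable_integral (f.continuous.comp continuous_fst) fun y => hB y.1).congr
    (ae_of_all _ fun p => ?_)
  exact (integral_map measurable_fst.aemeasurable f.continuous.aestronglyMeasurable).symm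

/-- The indicator of positive densities is the limit of the functions `min 1 (n s)`, which makes the
pairings with `densityMarginal ν` measurable. -/
lemma isParameterizedMeasure_densityMarginal {X : Set (ℝ × E d)}
    (hν : IsParameterizedMeasure X ν) : IsParameterizedMeasure X (densityMarginal ν) := by
  obtain ⟨C, hC⟩ := hν.2
  refine ⟨fun f => ?_, C, hC.mono fun p hp => (densityMarginal_univ_le p).trans hp⟩
  obtain ⟨B, hB⟩ := exists_bound_zeroAtInfty f
  have hfc : Continuous fun s => f s := f.continuous
  have hfc' : Continuous fun y : ℝ≥0 × E d => f y.1 := hfc.comp continuous_fst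
  have hpos : MeasurableSet {y : Phase d | 0 < y.1.1} :=
    measurableSet_lt measurable_const (by fun_prop)
  have e : ∀ p, ∫ s, f s ∂(densityMarginal ν p)
      = ∫ y, {y : Phase d | 0 < y.1.1}.indicator (fun y => f y.1.1) y ∂(ν p) := fun p => by
    rw [densityMarginal, integral_map measurable_fst.aemeasurable
      hfc.aestronglyMeasurable, stateMarginal,
      Measure.restrict_map measurable_fst measurableSet_pos, integral_map
      measurable_fst.aemeasurable hfc'.aestronglyMeasurable,
      integral_indicator hpos]
    congr 2
    ext y
    simp
  simp only [e]
  let F : ℕ → Phase d → ℝ := fun n y => min 1 ((n : ℝ) * y.1.1) * f y.1.1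
  have hF : ∀ n, Continuous (F n) := fun n => by
    have : Continuous fun y : Phase d => f y.1.1 := f.continuous.comp (by fun_prop)
    exact Continuous.mul (by fun_prop) this
  have hFB : ∀ n y, |F n y| ≤ B := fun n y => by
    have h0 : (0 : ℝ) ≤ min 1 ((n : ℝ) * y.1.1) := le_min zero_le_one (by positivity)
    rw [abs_mul, abs_of_nonneg h0]
    exact (mul_le_of_le_one_left (abs_nonneg _) (min_le_left _ _)).trans (hB _)
  refine aemeasurable_of_tendsto_metrizable_ae atTop
    (fun n => hν.aemeasurable_integral (hF n) (hFB n)) ?_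
  filter_upwards [hC] with p hp
  have hfin : IsFiniteMeasure (ν p) := ⟨hp.trans_lt ENNReal.coe_lt_top⟩
  refine tendsto_integral_of_dominated_convergence (fun _ => B)
    (fun n => (hF n).aestronglyMeasurable) (integrable_const _)
    (fun n => ae_of_all _ (hFB n)) (ae_of_all _ fun y => ?_)
  rcases eq_zero_or_pos (y.1.1) with h0 | h0
  · simp [F, h0]
  · rw [indicator_of_mem (show y ∈ {y : Phase d | 0 < y.1.1} from h0)]
    refine tendsto_const_nhds.congr' ?_
    obtain ⟨N, hN⟩ := exists_nat_gt ((y.1.1 : ℝ)⁻¹)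
    filter_upwards [eventually_ge_atTop N] with n hn
    have h1 : (1 : ℝ) ≤ (n : ℝ) * y.1.1 := by
      have h2 : (0 : ℝ) < y.1.1 := h0
      rw [← div_le_iff₀ h2, one_div]
      exact hN.le.trans (by exact_mod_cast hn)
    simp only [F, min_eq_left h1, one_mul]

lemma stateMarginal_restrict_eq {p : ℝ × E d} [IsFiniteMeasure (ν p)] {u : E d}
    (h : ∀ᵐ y ∂(ν p), 0 < y.1.1 → y.1.2 = u) :
    (stateMarginal ν p).restrict (Ioi 0 ×ˢ univ)
      = (densityMarginal ν p).prod (Measure.dirac u) := by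
  have : IsFiniteMeasure (stateMarginal ν p) := by unfold stateMarginal; infer_instance
  refine eq_map_fst_prod_dirac ?_
  rw [ae_restrict_iff' measurableSet_pos]
  have hset : MeasurableSet {y : ℝ≥0 × E d | y ∈ (Ioi 0 ×ˢ univ : Set (ℝ≥0 × E d)) → y.2 = u} :=
    measurableSet_pos.imp (measurable_snd (measurableSet_singleton u))
  rw [stateMarginal, ae_map_iff measurable_fst.aemeasurable hset]
  filter_upwards [h] with y hy hy' using hy hy'.1

end Young

/-! ### Taylor estimates for the kinetic nonlinearities -/

section Pointwise

variable {T γ τ : ℝ} {Ω : Set (E d)} {r : ℝ → E d → ℝ} {U : ℝ → E d → E d} {Φ : ℝ → E d → ℝ}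

lemma IsStrongSolution.exists_bound_U (hb : Bornology.IsBounded Ω)
    (hs : IsStrongSolution T γ Ω r U Φ) (hτ : τ < T) :
    ∃ B : ℝ, ∀ t ∈ Ioo 0 τ, ∀ x ∈ Ω, ∀ i, |U t x i| ≤ B := by
  obtain ⟨B, hB⟩ := (isCompact_Icc.prod hb.isCompact_closure).exists_bound_of_continuousOn
    (hs.U_C1.continuousOn.mono (prod_mono (fun s hs => ⟨hs.1, hs.2.trans_lt hτ⟩) subset_rfl))
  exact ⟨B, fun t ht x hx i => (PiLp.norm_apply_le (U t x) i).trans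
    (hB (t, x) ⟨Ioo_subset_Icc_self ht, subset_closure hx⟩)⟩

lemma abs_sub_le_add_sum_sq {u v : Fin d → ℝ} {ε : ℝ} (hε : 0 < ε) (i : Fin d) :
    |v i - u i| ≤ ε + ε⁻¹ * ∑ k, (v k - u k) ^ 2 := by
  have h1 : (v i - u i) ^ 2 ≤ ∑ k, (v k - u k) ^ 2 :=
    Finset.single_le_sum (f := fun k => (v k - u k) ^ 2) (fun _ _ => sq_nonneg _)
      (Finset.mem_univ i)
  have h2 : |v i - u i| ≤ ε + ε⁻¹ * (v i - u i) ^ 2 := by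
    rw [← sq_abs]
    generalize |v i - u i| = a
    have : 0 ≤ ε⁻¹ * ((a - ε / 2) ^ 2 + 3 / 4 * ε ^ 2) := by positivity
    have e : ε⁻¹ * ((a - ε / 2) ^ 2 + 3 / 4 * ε ^ 2) = ε⁻¹ * a ^ 2 - a + ε := by field_simp; ring
    linarith
  have := mul_le_mul_of_nonneg_left h1 (inv_pos.2 hε).le
  linarith

lemma abs_mul_sub_mul_le {u v : Fin d → ℝ} {B ε : ℝ} (hB : ∀ i, |u i| ≤ B) (hε : 0 < ε)
    (i j : Fin d) :
    |v i * v j - u i * u j| ≤ ε + (1 + B ^ 2 / ε) * ∑ k, (v k - u k) ^ 2 := by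
  have hS : ∀ k, (v k - u k) ^ 2 ≤ ∑ k, (v k - u k) ^ 2 := fun k =>
    Finset.single_le_sum (f := fun k => (v k - u k) ^ 2) (fun _ _ => sq_nonneg _)
      (Finset.mem_univ k)
  have hi := hS i
  have hj := hS j
  generalize ∑ k, (v k - u k) ^ 2 = S at hi hj
  have hB0 : 0 ≤ B := (abs_nonneg _).trans (hB i)
  have e : v i * v j - u i * u j
      = (v i - u i) * (v j - u j) + (v i - u i) * u j + u i * (v j - u j) := by ring
  have a1 : |(v i - u i) * (v j - u j)| ≤ S := by
    rw [abs_mul]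
    nlinarith [sq_nonneg (|v i - u i| - |v j - u j|), sq_abs (v i - u i), sq_abs (v j - u j)]
  have a2 : ∀ w b : ℝ, w ^ 2 ≤ S → |b| ≤ B → |w| * |b| ≤ ε / 2 + B ^ 2 / ε / 2 * S := fun w b hw hb => by
    have h1 : |w| * |b| ≤ |w| * B := mul_le_mul_of_nonneg_left hb (abs_nonneg _)
    have h2 : B ^ 2 / ε / 2 * w ^ 2 ≤ B ^ 2 / ε / 2 * S :=
      mul_le_mul_of_nonneg_left hw (by positivity)
    rw [← sq_abs w] at h2
    have h3 : 0 ≤ (ε - B * |w|) ^ 2 / ε / 2 := by positivity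
    have h4 : (ε - B * |w|) ^ 2 / ε / 2 = ε / 2 - |w| * B + B ^ 2 / ε / 2 * |w| ^ 2 := by
      field_simp; ring
    linarith
  have a3 := a2 _ _ hi (hB j)
  have a4 := a2 _ _ hj (hB i)
  rw [← abs_mul] at a3 a4
  rw [mul_comm (v j - u j)] at a4
  rw [e]
  refine (abs_add_le _ _).trans ((add_le_add_left (abs_add_le _ _) _).trans ?_)
  linarith

lemma abs_norm_sq_sub_norm_sq_le {u v : E d} {B ε : ℝ} (hB : ∀ i, |u i| ≤ B) (hε : 0 < ε) :
    |‖v‖ ^ 2 - ‖u‖ ^ 2| ≤ d * ε + d * (1 + B ^ 2 / ε) * ∑ k, (v k - u k) ^ 2 := by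
  rw [EuclideanSpace.real_norm_sq_eq, EuclideanSpace.real_norm_sq_eq, ← Finset.sum_sub_distrib]
  have e : d * ε + d * (1 + B ^ 2 / ε) * ∑ k, (v k - u k) ^ 2
      = ∑ _i : Fin d, (ε + (1 + B ^ 2 / ε) * ∑ k, (v k - u k) ^ 2) := by
    rw [Finset.sum_const, Finset.card_univ, Fintype.card_fin, nsmul_eq_mul]; ring
  rw [e]
  refine (Finset.abs_sum_le_sum_abs _ _).trans (Finset.sum_le_sum fun i _ => ?_)
  simpa only [pow_two (u i), pow_two (v i)] using
    abs_mul_sub_mul_le (u := u) (v := v) hB hε i i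

lemma abs_mul_sub_le {s p a ε C S : ℝ} (hs : 0 ≤ s) (h : |p - a| ≤ ε + C * S) :
    |s * p - a * s| ≤ ε * s + C * (s * S) := by
  have e : s * p - a * s = s * (p - a) := by ring
  rw [e, abs_mul, abs_of_nonneg hs]
  linarith [mul_le_mul_of_nonneg_left h hs]

/-- If the kinetic relative energy vanishes, and if the density is `r`, then the momentum, the
convective term and the kinetic energy are those of the strong solution. -/
lemma GeneratedBy.ae_barMeasure_kinetic_eq {g : E d → ℝ} {z : ℕ → ℝ × E d → Phase d}
    {ν : ℝ × E d → Measure (Phase d)} {m : ℝ → Defects d}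
    (hg : IsDefiningFunction g Ω) (hb : Bornology.IsBounded Ω)
    (hs : IsStrongSolution T γ Ω r U Φ) (hz : GeneratedBy T Ω z ν m)
    (hK : ∀ᵐ t ∂(volume.restrict (Ioo 0 T)), kinRel Ω (fun x => ν (t, x)) (m t) (U t) = 0)
    (hρ : ∀ᵐ t ∂(volume.restrict (Ioo 0 T)),
      barMeasure Ω (fun x => ν (t, x)) fRho (m t).rho = densityMeasure Ω (r t)) :
    ∀ᵐ t ∂(volume.restrict (Ioo 0 T)),
      (∀ i, barMeasure Ω (fun x => ν (t, x)) (fMom i) ((m t).mom i)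
        = densityMeasure Ω (fun x => r t x * U t x i)) ∧
      (∀ i j, barMeasure Ω (fun x => ν (t, x)) (fConv i j) ((m t).conv i j)
        = densityMeasure Ω (fun x => r t x * (U t x i * U t x j))) ∧
      barMeasure Ω (fun x => ν (t, x)) fKin (m t).kin
        = densityMeasure Ω (fun x => r t x * ‖U t x‖ ^ 2) := by
  have hU := fun i => (hs.contDiffOn_U i).continuousOn
  have h1 : ∀ i, ∀ᵐ t ∂(volume.restrict (Ioo 0 T)),
      barMeasure Ω (fun x => ν (t, x)) (fMom i) ((m t).mom i)
        = densityMeasure Ω (fun x => r t x * U t x i) := fun i =>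
    hz.ae_barMeasure_eq hg hb hs hK hρ (continuous_fMom i) (hz.mom i) (a := fun t x => U t x i)
      (hU i) fun τ hτ ε hε => ⟨ε⁻¹, fun t ht x hx y =>
        abs_mul_sub_le y.1.1.2 (abs_sub_le_add_sum_sq hε i)⟩
  have h2 : ∀ i j, ∀ᵐ t ∂(volume.restrict (Ioo 0 T)),
      barMeasure Ω (fun x => ν (t, x)) (fConv i j) ((m t).conv i j)
        = densityMeasure Ω (fun x => r t x * (U t x i * U t x j)) := fun i j =>
    hz.ae_barMeasure_eq hg hb hs hK hρ (continuous_fConv i j) (hz.conv i j)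
      (a := fun t x => U t x i * U t x j) ((hU i).fun_mul (hU j)) fun τ hτ ε hε => by
        obtain ⟨B, hB⟩ := hs.exists_bound_U hb hτ
        exact ⟨1 + B ^ 2 / ε, fun t ht x hx y =>
          abs_mul_sub_le y.1.1.2 (abs_mul_sub_mul_le (hB t ht x hx) hε i j)⟩
  have h3 : ∀ᵐ t ∂(volume.restrict (Ioo 0 T)), barMeasure Ω (fun x => ν (t, x)) fKin (m t).kin
        = densityMeasure Ω (fun x => r t x * ‖U t x‖ ^ 2) :=
    hz.ae_barMeasure_eq hg hb hs hK hρ continuous_fKin hz.kin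
      (a := fun t x => ‖U t x‖ ^ 2) (hs.U_C1.continuousOn.norm.pow 2) fun τ hτ ε hε => by
        obtain ⟨B, hB⟩ := hs.exists_bound_U hb hτ
        refine ⟨d * (1 + B ^ 2 / (ε / (d + 1))), fun t ht x hx y => abs_mul_sub_le y.1.1.2
          ((abs_norm_sq_sub_norm_sq_le (hB t ht x hx) (show 0 < ε / (d + 1) by positivity)).trans
            (add_le_add_left ?_ _))⟩
        rw [mul_div_assoc', div_le_iff₀ (by positivity)]
        linarith
  filter_upwards [ae_all_iff.2 h1, ae_all_iff.2 fun i => ae_all_iff.2 (h2 i), h3] with t a b c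
    using ⟨a, b, c⟩

end Pointwise

end EulerPoisson

end

open EulerPoisson in
theorem mainTheorem1 (d : ℕ) (hd₁ : 1 ≤ d) (hd₃ : d ≤ 3)
    (Ω : Set (E d)) (hΩ : IsBoundedSmoothDomain Ω)
    (T γ : ℝ) (hT : 0 < T) (hγ : 0 ≤ γ)
    (r : ℝ → E d → ℝ) (U : ℝ → E d → E d) (Φ : ℝ → E d → ℝ)
    (hstrong : IsStrongSolution T γ Ω r U Φ)
    (ν₀ : E d → Measure (Phase d)) (ν : ℝ × E d → Measure (Phase d)) (m : ℝ → Defects d)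
    (hν₀ : ∀ᵐ x ∂(volume.restrict Ω),
      ν₀ x = Measure.dirac ((Real.toNNReal (r 0 x), U 0 x), grad Ω (Φ 0) x))
    (hmv : IsDissipativeMVSolution T γ Ω ν₀ 0 ν m) :
    -- no concentrations in the gradient of the potential
    (∀ᵐ t ∂(volume.restrict (Ioo 0 T)), (m t).gradSq = 0 ∧ ∀ i j, (m t).gradTensor i j = 0) ∧
    -- identification of the oscillation-concentration pairs
    (∀ᵐ t ∂(volume.restrict (Ioo 0 T)),
      barMeasure Ω (fun x => ν (t, x)) fRho (m t).rho = densityMeasure Ω (r t) ∧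
      (∀ i, barMeasure Ω (fun x => ν (t, x)) (fMom i) ((m t).mom i)
        = densityMeasure Ω (fun x => r t x * U t x i)) ∧
      (∀ i j, barMeasure Ω (fun x => ν (t, x)) (fConv i j) ((m t).conv i j)
        = densityMeasure Ω (fun x => r t x * (U t x i * U t x j))) ∧
      barMeasure Ω (fun x => ν (t, x)) fKin (m t).kin
        = densityMeasure Ω (fun x => r t x * ‖U t x‖ ^ 2)) ∧
    -- structure of the Young measure
    (∃ νb : ℝ × E d → Measure (ℝ≥0 × E d),
      IsParameterizedMeasure (cyl T Ω) νb ∧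
      (∀ᵐ p ∂(volume.restrict (cyl T Ω)),
        ν p = (νb p).prod (Measure.dirac (grad Ω (Φ p.1) p.2))) ∧
      ∃ νbb : ℝ × E d → Measure ℝ≥0,
        IsParameterizedMeasure (cyl T Ω) νbb ∧
        (∀ᵐ p ∂(volume.restrict (cyl T Ω)), νbb p {0} = 0) ∧
        ∀ᵐ p ∂(volume.restrict (cyl T Ω)),
          (νb p).restrict (Ioi 0 ×ˢ univ) = (νbb p).prod (Measure.dirac (U p.1 p.2))) ∧
    -- absolute continuity of the remaining concentration measures
    (∀ᵐ t ∂(volume.restrict (Ioo 0 T)),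
      (m t).rho ≪ᵥ volume.toENNRealVectorMeasure ∧
      (∀ i, (m t).mom i ≪ᵥ volume.toENNRealVectorMeasure) ∧
      (∀ i j, (m t).conv i j ≪ᵥ volume.toENNRealVectorMeasure) ∧
      (m t).kin ≪ᵥ volume.toENNRealVectorMeasure) := by
  obtain ⟨-, -, hb, g, hg⟩ := hΩ
  obtain ⟨z, h1, h2, h3, h4, h5, h6, h7⟩ := hmv.generated
  have hz : GeneratedBy T Ω z ν m := ⟨h1, h2, h3, h4, h5, h6, h7⟩
  have hE := hmv.ae_relEnergy_eq_zero hg hb hγ hT hstrong hν₀ hz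
  have hK := hE.mono fun _ h => h.1
  obtain ⟨hgrad, hfield⟩ := hz.ae_field hg hb hstrong hmv.potential (hE.mono fun _ h => h.2)
  have hρ := hz.ae_barMeasure_rho_eq hg hb hstrong hmv.poisson
    (hstrong.initial hg hb hT hν₀).1 (hfield.mono fun _ h => h.2)
  have hkin := hz.ae_barMeasure_kinetic_eq hg hb hstrong hK hρ
  have hmass := h1.measure_univ_le_one hb
  refine ⟨?_, ?_, ⟨stateMarginal ν, isParameterizedMeasure_stateMarginal h1.1, ?_,
    densityMarginal ν, isParameterizedMeasure_densityMarginal h1.1,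
    ae_of_all _ densityMarginal_zero, ?_⟩, ?_⟩
  · have htensor : ∀ i j, ∀ᵐ t ∂(volume.restrict (Ioo 0 T)), (m t).gradTensor i j = 0 :=
      fun i j => hz.ae_concentration_eq_zero hg.isOpen hb hgrad (continuous_fGradTensor i j)
        (h7 i j) fun y => by
          rw [fGradTensor, fGradSq, abs_mul, pow_two]
          exact mul_le_mul (PiLp.norm_apply_le y.2 i) (PiLp.norm_apply_le y.2 j) (abs_nonneg _)
            (norm_nonneg _)
    filter_upwards [hz.ae_concentration_eq_zero hg.isOpen hb hgrad continuous_fGradSq h6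
      fun y => (abs_of_nonneg (by unfold fGradSq; positivity)).le,
      ae_all_iff.2 fun i => ae_all_iff.2 (htensor i)] with t ha hb' using ⟨ha, hb'⟩
  · filter_upwards [hρ, hkin] with t ha hb' using ⟨ha, hb'⟩
  · filter_upwards [hfield, hmass] with p hp hp1
    have : IsFiniteMeasure (ν p) := ⟨hp1.trans_lt ENNReal.one_lt_top⟩
    exact eq_map_fst_prod_dirac hp.1
  · filter_upwards [hz.ae_velocity hg hb hstrong hK, hmass] with p hp hp1
    have : IsFiniteMeasure (ν p) := ⟨hp1.trans_lt ENNReal.one_lt_top⟩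
    exact stateMarginal_restrict_eq hp
  · filter_upwards [hρ, hkin] with t ha hb'
    exact ⟨absolutelyContinuous_of_barMeasure_eq ha,
      fun i => absolutelyContinuous_of_barMeasure_eq (hb'.1 i),
      fun i j => absolutelyContinuous_of_barMeasure_eq (hb'.2.1 i j),
      absolutelyContinuous_of_barMeasure_eq hb'.2.2⟩
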